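/- Let $n\ge 0$ be an integer, and let $\mathrm{sgn}(0)=0$. For a density $p$ of ordered coordinates $x_1>\dots>x_{2n}$, let $\rho_k(x_1,\dots,x_k)=\frac{(2n)!}{(2n-k)!}\int p_{\rm sym}(x_1,\dots,x_{2n})\,dx_{k+1}\cdots dx_{2n}$ be its (parity-blind) $k$-point correlation function, where $p_{\rm sym}(x)=\frac1{(2n)!}\sum_{\sigma\in S_{2n}}p(x_{\sigma(1)},\dots,x_{\sigma(2n)})$ and $p$ is extended by zero. For a $2k\times 2k$ matrix $B$ with $BZ_{2k}$ antisymmetric, $Z_{2k}={\bf 1}_k\otimes\begin{bmatrix}0&-1\\1&0\end{bmatrix}$, put ${\rm qdet}\,B={\rm Pf}(BZ_{2k})$, where ${\rm Pf}\,D=\frac1{2^kk!}\sum_{P\in S_{2k}}\varepsilon(P)\prod_{l=1}^k d_{P(2l),P(2l-1)}$. We consider two ensembles. Laguerre case: $A<1$, $I=[0,\infty)$, $w(x)=e^{-x/2}$, $\epsilon(x,y)=e^{A|x-y|/2}\,{\rm sgn}(x-y)$, and $$p(x)=\frac1C\prod_{j=1}^{2n}e^{-x_j/2}\prod_{j=1}^n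 e^{A(x_{2j-1}-x_{2j})/2}\prod_{1\le j<k\le 2n}(x_j-x_k),\qquad x_1>\dots>x_{2n}\ge 0 .$$ Jacobi case: $a>-1$, $A<a+1$, $I=(-1,1)$, $w(x)=(1-x)^{(a-1)/2}$, $\epsilon(x,y)=\big(\frac{1-x}{1-y}\big)^{-A\,{\rm sgn}(x-y)/2}{\rm sgn}(x-y)$, and $$p(x)=\frac1C\prod_{j=1}^{2n}(1-x_j)^{(a-1)/2}\prod_{l=1}^n\Big(\frac{1-x_{2l-1}}{1-x_{2l}}\Big)^{-A/2}\prod_{1\le j<k\le 2n}(x_j-x_k),\qquad 1>x_1>\dots>x_{2n}>-1 .$$ In both cases put $\kappa(x,y)=\epsilon(x,y)$ for $x>y$ and $\kappa(x,y)=0$ otherwise. Let $R_0,\dots,R_{2n-1}$ be any real polynomials with $\deg R_j=j$, and put $(\epsilon\cdot R)(x)=\int_I w(y)\epsilon(x,y)R(y)\,dy$ and $$M_{jk}=\int_I dx\,w(x)\int_I dy\,w(y)\big(R_j(x)R_k(y)-R_k(x)R_j(y)\big)\kappa(x,y).$$ Then the normalization $C$ (the integral of the unnormalized density) is positive and finite,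 and $M$ is invertible. With $M^{-t}$ the transposed inverse of $M$ and $$f(x,y)=\begin{bmatrix}\sum_{j,k}w(x)R_j(x)M^{-t}_{jk}(\epsilon\cdot R_k)(y)&-\sum_{j,k}w(x)R_j(x)M^{-t}_{jk}w(y)R_k(y)\\-\epsilon(x,y)+\sum_{j,k}(\epsilon\cdot R_j)(x)M^{-t}_{jk}(\epsilon\cdot R_k)(y)&-\sum_{j,k}(\epsilon\cdot R_j)(x)M^{-t}_{jk}w(y)R_k(y)\end{bmatrix},$$ where the sums are over $0\le j,k\le 2n-1$, we have for all $0\le k\le 2n$ and all $x_1,\dots,x_k\in I$ $$\rho_k(x_1,\dots,x_k)={\rm qdet}\,[f(x_j,x_l)]_{j,l=1,\dots,k}.$$ Moreover, for all $x,y\in I$, $f^{11}(x,y)=f^{22}(y,x)$, and the other entries are as follows. In the Laguerre case, with $L_l$ the Laguerre polynomials of parameter $0$ and $K(x,y)=K^L_{2n}(x,y)=e^{-(x+y)/2}\sum_{l=0}^{2n-1}L_l(x)L_l(y)$, $$f^{22}(x,y)=\tfrac12K(x,y)-\tfrac12\frac{\partial}{\partial y}\int_0^xe^{A(x-t)/2}K(t,y)\,dt-\tfrac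 A4\int_0^xdt\,e^{A(x-t)/2}\int_y^\infty du\,\frac{\partial}{\partial t}K(u,t)+\tfrac A4e^{Ax/2}\int_0^\infty K(y,u)\,du,$$ $$f^{12}(x,y)=\tfrac14\Big(\tfrac A2+\frac{\partial}{\partial x}\Big)\Big(\tfrac A2+\frac{\partial}{\partial y}\Big)\Big\{\int_x^\infty K(y,t)\,dt-\int_y^\infty K(x,t)\,dt\Big\},$$ $$f^{21}(x,y)=-e^{A|x-y|/2}{\rm sgn}(x-y)-\Big\{\int_0^ye^{A(y-t)/2}K(x,t)\,dt-\int_0^xe^{A(x-t)/2}K(y,t)\,dt\Big\}.$$ In the Jacobi case, with $P_l^{(a,0)}$ the Jacobi polynomials, $h_l=2^{a+1}/(2l+a+1)$ and $K(x,y)=K^J_{2n}(x,y)=(1-x)^{(a-1)/2}(1-y)^{(a-1)/2}\sum_{l=0}^{2n-1}\frac1{h_l}P_l^{(a,0)}(x)P_l^{(a,0)}(y)$, $$f^{22}(x,y)=\tfrac12(1-x)K(x,y)-\tfrac12\Big\{(1-y)\frac{\partial}{\partial y}-1\Big\}\int_{-1}^x\Big(\frac{1-t}{1-x}\Big)^{A/2}K(t,y)\,dt$$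 $$\qquad+\frac{A}{4(1-y)}\int_{-1}^xdt\Big(\frac{1-t}{1-x}\Big)^{A/2}\int_y^1du\Big\{1-(1-t)\frac{\partial}{\partial t}\Big\}K(u,t)+\frac A4\Big(\frac2{1-x}\Big)^{A/2}\int_{-1}^1K(y,u)\,du,$$ $$f^{12}(x,y)=\tfrac14\Big(\frac{A}{2(1-x)}+\frac{\partial}{\partial x}\Big)\Big(\frac{A}{2(1-y)}+\frac{\partial}{\partial y}\Big)\Big\{(1-y)\int_x^1K(y,t)\,dt-(1-x)\int_y^1K(x,t)\,dt\Big\},$$ $$f^{21}(x,y)=-\Big(\frac{1-x}{1-y}\Big)^{-A\,{\rm sgn}(x-y)/2}{\rm sgn}(x-y)-\Big\{(1-x)\int_{-1}^y\Big(\frac{1-t}{1-y}\Big)^{A/2}K(x,t)\,dt-(1-y)\int_{-1}^x\Big(\frac{1-t}{1-x}\Big)^{A/2}K(y,t)\,dt\Big\}.$$ -/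

import Mathlib

open MeasureTheory
open scoped Kronecker Polynomial

namespace DecimatedEnsemble

noncomputable section

/-! ### Pfaffians and quaternion determinants

A `2k × 2k` matrix is indexed by `Fin k × Fin 2`; the pair `(l, 0)` stands for the row `2l - 1` and
`(l, 1)` for the row `2l`, where `l = 1, …, k`. -/

/-- The Pfaffian of an antisymmetric `2k × 2k` matrix, with the sign convention
`Pf A = ∑* ε(P) ∏_l a_{P(2l), P(2l-1)}`. The starred sum runs over permutations that give distinct
products; here the sum is over all permutations, each product then occurring `2^k k!` times. -/
def pfaffian {k : ℕ} (A : Matrix (Fin k × Fin 2) (Fin k × Fin 2) ℝ) : ℝ :=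
  (∑ P : Equiv.Perm (Fin k × Fin 2),
    ((Equiv.Perm.sign P : ℤ) : ℝ) * ∏ l : Fin k, A (P (l, 1)) (P (l, 0))) /
    (2 ^ k * (k.factorial : ℝ))

/-- `Z_{2k} = 1_k ⊗ [[0, -1], [1, 0]]`. -/
def zMatrix (k : ℕ) : Matrix (Fin k × Fin 2) (Fin k × Fin 2) ℝ :=
  (1 : Matrix (Fin k) (Fin k) ℝ) ⊗ₖ !![0, -1; 1, 0]

/-- The quaternion determinant `qdet A = Pf (A Z_{2k})` of a self-dual matrix. -/
def qdet {k : ℕ} (A : Matrix (Fin k × Fin 2) (Fin k × Fin 2) ℝ) : ℝ :=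
  pfaffian (A * zMatrix k)

/-- The `2k × 2k` matrix `[f(x_j, x_l)]_{j,l=1,…,k}` with `2 × 2` blocks. -/
def blockMatrix {k : ℕ} (f : ℝ → ℝ → Matrix (Fin 2) (Fin 2) ℝ) (x : Fin k → ℝ) :
    Matrix (Fin k × Fin 2) (Fin k × Fin 2) ℝ :=
  Matrix.of fun p q => f (x p.1) (x q.1) p.2 q.2

/-! ### Correlation functions -/

/-- The point of `ℝ^N` with first coordinates `x` and remaining coordinates `y`. -/
def glue {N k : ℕ} (x : Fin k → ℝ) (y : Fin (N - k) → ℝ) : Fin N → ℝ := fun i =>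
  if h : (i : ℕ) < k then x ⟨i, h⟩ else y ⟨(i : ℕ) - k, by omega⟩

/-- The symmetric density of the unlabelled configuration whose ordered coordinates have density
`p`. -/
def symmetrize {N : ℕ} (p : (Fin N → ℝ) → ℝ) (x : Fin N → ℝ) : ℝ :=
  (∑ σ : Equiv.Perm (Fin N), p (x ∘ σ)) / (N.factorial : ℝ)

/-- The parity-blind `k`-point correlation function
`ρ_k(x_1,…,x_k) = N (N-1) ⋯ (N-k+1) ∫ dx_{k+1} ⋯ dx_N p_sym(x_1,…,x_N)` of a configuration of `N`
points whose ordered coordinates have density `p`. -/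
def correlation {N : ℕ} (p : (Fin N → ℝ) → ℝ) (k : ℕ) (x : Fin k → ℝ) : ℝ :=
  (N.descFactorial k : ℝ) * ∫ y : Fin (N - k) → ℝ, symmetrize p (glue x y)

/-- `∏_{1 ≤ j < k ≤ N} (x_j - x_k)`. -/
def diffProd {N : ℕ} (x : Fin N → ℝ) : ℝ :=
  ∏ j : Fin N, ∏ k ∈ Finset.Ioi j, (x j - x k)

/-- The odd labelled coordinate `x_{2j-1}` (labels start at `1`, `Fin` at `0`). -/
def oddCoord {n : ℕ} (x : Fin (2 * n) → ℝ) (j : Fin n) : ℝ := x ⟨2 * (j : ℕ), by omega⟩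

/-- The even labelled coordinate `x_{2j}`. -/
def evenCoord {n : ℕ} (x : Fin (2 * n) → ℝ) (j : Fin n) : ℝ := x ⟨2 * (j : ℕ) + 1, by omega⟩

/-! ### The quaternion kernel of `∏ w(x_j) ∏_{j<k} (x_j - x_k) Pf [ε(x_j, x_k)]` on the set `I` -/

/-- `(ε · R)(x) = ∫_I w(y) ε(x,y) R(y) dy`. -/
def epsDot (I : Set ℝ) (w : ℝ → ℝ) (ε : ℝ → ℝ → ℝ) (R : ℝ[X]) (x : ℝ) : ℝ :=
  ∫ y in I, w y * ε x y * R.eval y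

/-- `M_{jk} = ∫_I dx w(x) ∫_I dy w(y) (R_j(x) R_k(y) - R_k(x) R_j(y)) κ(x,y)`. -/
def skewMatrix (I : Set ℝ) (w : ℝ → ℝ) (κ : ℝ → ℝ → ℝ) {N : ℕ} (R : Fin N → ℝ[X]) :
    Matrix (Fin N) (Fin N) ℝ :=
  Matrix.of fun j k => ∫ x in I, w x * ∫ y in I,
    w y * ((R j).eval x * (R k).eval y - (R k).eval x * (R j).eval y) * κ x y

/-- The `2 × 2` matrix `f(x,y)` built from the polynomials `R_j` and the transposed inverse of
`M`. -/
def quatKernel (I : Set ℝ) (w : ℝ → ℝ) (ε κ : ℝ → ℝ → ℝ) {N : ℕ} (R : Fin N → ℝ[X]) (x y : ℝ) :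
    Matrix (Fin 2) (Fin 2) ℝ :=
  let Mt : Matrix (Fin N) (Fin N) ℝ := ((skewMatrix I w κ R)⁻¹).transpose
  !![∑ j, ∑ k, w x * (R j).eval x * Mt j k * epsDot I w ε (R k) y,
     -∑ j, ∑ k, w x * (R j).eval x * Mt j k * (w y * (R k).eval y);
     -ε x y + ∑ j, ∑ k, epsDot I w ε (R j) x * Mt j k * epsDot I w ε (R k) y,
     -∑ j, ∑ k, epsDot I w ε (R j) x * Mt j k * (w y * (R k).eval y)]

/-! ### The Laguerre case, on `[0, ∞)` -/

/-- The unnormalized density of the ordered coordinates,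
`∏_{j=1}^{2n} e^{-x_j/2} ∏_{j=1}^n e^{A(x_{2j-1}-x_{2j})/2} ∏_{j<k} (x_j - x_k)` on
`x_1 > ⋯ > x_{2n} ≥ 0`. -/
def laguerreWeight (n : ℕ) (A : ℝ) : (Fin (2 * n) → ℝ) → ℝ :=
  Set.indicator {x | StrictAnti x ∧ ∀ j, 0 ≤ x j} fun x =>
    (∏ j, Real.exp (-x j / 2)) *
      (∏ j : Fin n, Real.exp (A * (oddCoord x j - evenCoord x j) / 2)) * diffProd x

/-- The normalization `C`. -/
def laguerreNorm (n : ℕ) (A : ℝ) : ℝ := ∫ x, laguerreWeight n A x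

/-- The probability density of the ordered coordinates. -/
def laguerrePDF (n : ℕ) (A : ℝ) (x : Fin (2 * n) → ℝ) : ℝ :=
  (1 / laguerreNorm n A) * laguerreWeight n A x

def wL (x : ℝ) : ℝ := Real.exp (-x / 2)

def epsL (A x y : ℝ) : ℝ := Real.exp (A * |x - y| / 2) * Real.sign (x - y)

def kappaL (A x y : ℝ) : ℝ := if y < x then Real.exp (A * (x - y) / 2) else 0

/-- `f(x,y)` in the Laguerre case. -/
def fL (A : ℝ) {N : ℕ} (R : Fin N → ℝ[X]) : ℝ → ℝ → Matrix (Fin 2) (Fin 2) ℝ :=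
  quatKernel (Set.Ici 0) wL (epsL A) (kappaL A) R

/-- The Laguerre polynomial `L_l` with parameter `0`,
`L_l(x) = ∑_m binom(l, m) (-x)^m / m!`. -/
def laguerreL (l : ℕ) (x : ℝ) : ℝ :=
  ∑ m ∈ Finset.range (l + 1), (l.choose m : ℝ) * (-x) ^ m / (m.factorial : ℝ)

/-- `K^L_N(x,y) = e^{-(x+y)/2} ∑_{l<N} L_l(x) L_l(y)` (the norms `h_l^L` are all `1`). -/
def KL (N : ℕ) (x y : ℝ) : ℝ :=
  Real.exp (-(x + y) / 2) * ∑ l ∈ Finset.range N, laguerreL l x * laguerreL l y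

/-- The operator `A/2 + d/dx`. -/
def opL (A : ℝ) (g : ℝ → ℝ) (x : ℝ) : ℝ := A / 2 * g x + deriv g x

def f22L (n : ℕ) (A x y : ℝ) : ℝ :=
  1 / 2 * KL (2 * n) x y
    - 1 / 2 * deriv (fun y' => ∫ t in (0 : ℝ)..x, Real.exp (A * (x - t) / 2) * KL (2 * n) t y') y
    - A / 4 * (∫ t in (0 : ℝ)..x, Real.exp (A * (x - t) / 2) *
        ∫ u in Set.Ioi y, deriv (fun t' => KL (2 * n) u t') t)
    + A / 4 * Real.exp (A * x / 2) * ∫ u in Set.Ioi (0 : ℝ), KL (2 * n) y u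

def f12L (n : ℕ) (A x y : ℝ) : ℝ :=
  1 / 4 * opL A (fun x' => opL A (fun y' =>
    (∫ t in Set.Ioi x', KL (2 * n) y' t) - ∫ t in Set.Ioi y', KL (2 * n) x' t) y) x

def f21L (n : ℕ) (A x y : ℝ) : ℝ :=
  -(Real.exp (A * |x - y| / 2) * Real.sign (x - y))
    - ((∫ t in (0 : ℝ)..y, Real.exp (A * (y - t) / 2) * KL (2 * n) x t)
      - ∫ t in (0 : ℝ)..x, Real.exp (A * (x - t) / 2) * KL (2 * n) y t)

/-! ### The Jacobi case, on `(-1, 1)` -/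

/-- The unnormalized density of the ordered coordinates,
`∏_{j=1}^{2n} (1-x_j)^{(a-1)/2} ∏_{l=1}^n ((1-x_{2l-1})/(1-x_{2l}))^{-A/2} ∏_{j<k} (x_j - x_k)` on
`1 > x_1 > ⋯ > x_{2n} > -1`. -/
def jacobiWeight (n : ℕ) (a A : ℝ) : (Fin (2 * n) → ℝ) → ℝ :=
  Set.indicator {x | StrictAnti x ∧ ∀ j, -1 < x j ∧ x j < 1} fun x =>
    (∏ j, (1 - x j) ^ ((a - 1) / 2)) *
      (∏ l : Fin n, ((1 - oddCoord x l) / (1 - evenCoord x l)) ^ (-A / 2)) * diffProd x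

/-- The normalization `C`. -/
def jacobiNorm (n : ℕ) (a A : ℝ) : ℝ := ∫ x, jacobiWeight n a A x

/-- The probability density of the ordered coordinates. -/
def jacobiPDF (n : ℕ) (a A : ℝ) (x : Fin (2 * n) → ℝ) : ℝ :=
  (1 / jacobiNorm n a A) * jacobiWeight n a A x

def wJ (a x : ℝ) : ℝ := (1 - x) ^ ((a - 1) / 2)

def epsJ (A x y : ℝ) : ℝ :=
  ((1 - x) / (1 - y)) ^ (-A * Real.sign (x - y) / 2) * Real.sign (x - y)

def kappaJ (A x y : ℝ) : ℝ := if y < x then ((1 - x) / (1 - y)) ^ (-A / 2) else 0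

/-- `f(x,y)` in the Jacobi case. -/
def fJ (a A : ℝ) {N : ℕ} (R : Fin N → ℝ[X]) : ℝ → ℝ → Matrix (Fin 2) (Fin 2) ℝ :=
  quatKernel (Set.Ioo (-1) 1) (wJ a) (epsJ A) (kappaJ A) R

/-- The Jacobi polynomial `P_l^{(a,b)}`,
`∑_m (l+a+b+1)_m (a+m+1)_{l-m} / (m! (l-m)!) ((x-1)/2)^m` with `(c)_m = c (c+1) ⋯ (c+m-1)`. -/
def jacobiP (l : ℕ) (a b x : ℝ) : ℝ :=
  ∑ m ∈ Finset.range (l + 1),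
    (ascPochhammer ℝ m).eval (l + a + b + 1) * (ascPochhammer ℝ (l - m)).eval (a + m + 1) /
      ((m.factorial : ℝ) * ((l - m).factorial : ℝ)) * ((x - 1) / 2) ^ m

/-- The norm `h_l^J = 2^{a+1} / (2l + a + 1)` of `P_l^{(a,0)}` with respect to `(1-t)^a`. -/
def hJ (a : ℝ) (l : ℕ) : ℝ := 2 ^ (a + 1) / (2 * l + a + 1)

/-- `K^J_N(x,y) = (1-x)^{(a-1)/2} (1-y)^{(a-1)/2} ∑_{l<N} P_l^{(a,0)}(x) P_l^{(a,0)}(y) / h_l^J`. -/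
def KJ (a : ℝ) (N : ℕ) (x y : ℝ) : ℝ :=
  (1 - x) ^ ((a - 1) / 2) * (1 - y) ^ ((a - 1) / 2) *
    ∑ l ∈ Finset.range N, 1 / hJ a l * jacobiP l a 0 x * jacobiP l a 0 y

/-- The operator `A/(2(1-x)) + d/dx`. -/
def opJ (A : ℝ) (g : ℝ → ℝ) (x : ℝ) : ℝ := A / (2 * (1 - x)) * g x + deriv g x

def f22J (n : ℕ) (a A x y : ℝ) : ℝ :=
  1 / 2 * (1 - x) * KJ a (2 * n) x y
    - 1 / 2 * ((1 - y) * deriv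
          (fun y' => ∫ t in (-1 : ℝ)..x, ((1 - t) / (1 - x)) ^ (A / 2) * KJ a (2 * n) t y') y
        - ∫ t in (-1 : ℝ)..x, ((1 - t) / (1 - x)) ^ (A / 2) * KJ a (2 * n) t y)
    + A / (4 * (1 - y)) * (∫ t in (-1 : ℝ)..x, ((1 - t) / (1 - x)) ^ (A / 2) *
        ∫ u in y..1, (KJ a (2 * n) u t - (1 - t) * deriv (fun t' => KJ a (2 * n) u t') t))
    + A / 4 * (2 / (1 - x)) ^ (A / 2) * ∫ u in (-1 : ℝ)..1, KJ a (2 * n) y u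

def f12J (n : ℕ) (a A x y : ℝ) : ℝ :=
  1 / 4 * opJ A (fun x' => opJ A (fun y' =>
    (1 - y') * (∫ t in x'..1, KJ a (2 * n) y' t)
      - (1 - x') * ∫ t in y'..1, KJ a (2 * n) x' t) y) x

def f21J (n : ℕ) (a A x y : ℝ) : ℝ :=
  -(((1 - x) / (1 - y)) ^ (-A * Real.sign (x - y) / 2) * Real.sign (x - y))
    - ((1 - x) * (∫ t in (-1 : ℝ)..y, ((1 - t) / (1 - y)) ^ (A / 2) * KJ a (2 * n) x t)
      - (1 - y) * ∫ t in (-1 : ℝ)..x, ((1 - t) / (1 - x)) ^ (A / 2) * KJ a (2 * n) y t)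

end

end DecimatedEnsemble

open DecimatedEnsemble

/-! Both ensembles are one model in a time variable `s` with `ds = dx / q(x)`, where `q = 1` or `q =
1 - x`. With `E = e^s` and `α = A / 2`, the kernel `ε(x, y)` is `(E x / E y)^α` for `y < x`,
extended antisymmetrically, and `q w` is a constant times `E^(-c/2)` with `c = 1` or `c = a + 1`.
The condition on `A` is `α < c / 2`, which makes all integrals converge.

Correlations: let `φ_j = w p_j`, let `ψ_j` be the `ε`-transforms, and `P` the transposed inverse of
the matrix of skew products. After multiplication by `Z`, the kernel matrix is the Gram matrix of
the vectors `(φ(x_i), 0)` and `(ψ(x_i), δ_{x_i})` under the antisymmetric form `-P ⊕ ε`, so `qdet`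
is an alternating function of these vectors (`pfForm`). Expansion along the last pair and the
reproducing property of `P` show that integrating out one of `k + 1` points multiplies the Pfaffian
of the remaining `k` by `2n - k` (`SkewSystem.integral_corrPf_snoc`). For `2n` ordered points `ε`
factorizes, the Gram matrix is realized by `4n` vectors in dimension `4n`, and the Pfaffian is a
constant times their determinant, which is the density (`corrPf_of_ordered`). Integrating out
everything identifies the constant as `1 / C`, so that `C > 0` follows without evaluating `C`.

Closed forms: let `D` be the matrix of `d/ds` on the weighted polynomials `C₀ E^(-c/2) p_j`,
orthonormal for `ds`, and `v` their values at the left end. Integration by parts gives `D + Dᵀ = -v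
vᵀ`. In even dimension this forces `v · D⁻¹ v = 0`, whence `(D⁻¹ - D⁻ᵀ) / 4` inverts `D - Dᵀ`
(`sub_transpose_mul_skewInv`). With `S = D + α`, the skew products form the matrix `S⁻ᵀ - S⁻¹`,
whose inverse is `Sᵀ (D - Dᵀ)⁻¹ S`; no skew-orthogonal polynomials are needed. Derivatives act as
`D`, tail integrals as `-D⁻¹`, and the forward integrals `χ` satisfy `D χ = φ - E^α v + α χ`, so the
stated entries follow by matrix algebra.

Orthogonality of the classical polynomials comes from finite differences of polynomials in the
summation index, and their norms from their values at the left end. -/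

namespace DecimatedEnsemble

noncomputable section

/-! ### The Pfaffian of a Gram matrix as an alternating map -/

section Pfaffian

variable {V : Type*} [AddCommGroup V] [Module ℝ V]

/-- The multilinear map `v ↦ ∏ l, B (v (l, 1)) (v (l, 0))`. -/
def pairProd (B : V →ₗ[ℝ] V →ₗ[ℝ] ℝ) (k : ℕ) :
    MultilinearMap ℝ (fun _ : Fin k × Fin 2 => V) ℝ where
  toFun v := ∏ l, B (v (l, 1)) (v (l, 0))
  map_update_add' := by
    intro inst v p y z
    -- The field quantifies over all decidability instances; the canonical one is substituted so
    -- that the two `Function.update`s agree.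
    obtain rfl : inst = instDecidableEqProd := Subsingleton.elim _ _
    obtain ⟨l, s⟩ := p
    -- Only the factor of block `l` contains the updated slot, which leaves the linearity of one
    -- bilinear factor.
    have key : ∀ w : V, ∏ i, B (Function.update v (l, s) w (i, 1))
        (Function.update v (l, s) w (i, 0)) =
        B (Function.update v (l, s) w (l, 1)) (Function.update v (l, s) w (l, 0)) *
          ∏ i ∈ Finset.univ.erase l, B (v (i, 1)) (v (i, 0)) := by
      intro w
      rw [← Finset.mul_prod_erase _ _ (Finset.mem_univ l)]
      congr 1
      refine Finset.prod_congr rfl fun i hi => ?_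
      have : i ≠ l := Finset.ne_of_mem_erase hi
      simp [this]
    rw [key, key, key, ← add_mul]
    congr 1
    fin_cases s <;> simp
  map_update_smul' := by
    intro inst v p c z
    obtain rfl : inst = instDecidableEqProd := Subsingleton.elim _ _
    obtain ⟨l, s⟩ := p
    have key : ∀ w : V, ∏ i, B (Function.update v (l, s) w (i, 1))
        (Function.update v (l, s) w (i, 0)) =
        B (Function.update v (l, s) w (l, 1)) (Function.update v (l, s) w (l, 0)) *
          ∏ i ∈ Finset.univ.erase l, B (v (i, 1)) (v (i, 0)) := by
      intro w
      rw [← Finset.mul_prod_erase _ _ (Finset.mem_univ l)]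
      congr 1
      refine Finset.prod_congr rfl fun i hi => ?_
      have : i ≠ l := Finset.ne_of_mem_erase hi
      simp [this]
    rw [key, key, smul_eq_mul, ← mul_assoc]
    congr 1
    fin_cases s <;> simp

theorem pairProd_apply (B : V →ₗ[ℝ] V →ₗ[ℝ] ℝ) (k : ℕ) (v : Fin k × Fin 2 → V) :
    pairProd B k v = ∏ l, B (v (l, 1)) (v (l, 0)) := rfl

/-- The Pfaffian of the Gram matrix of `2k` vectors, as an alternating map. -/
def pfForm (B : V →ₗ[ℝ] V →ₗ[ℝ] ℝ) (k : ℕ) : V [⋀^Fin k × Fin 2]→ₗ[ℝ] ℝ :=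
  (2 ^ k * (k.factorial : ℝ))⁻¹ • MultilinearMap.alternatization (pairProd B k)

theorem pfForm_apply (B : V →ₗ[ℝ] V →ₗ[ℝ] ℝ) (k : ℕ) (v : Fin k × Fin 2 → V) :
    pfForm B k v = (2 ^ k * (k.factorial : ℝ))⁻¹ *
      ∑ P : Equiv.Perm (Fin k × Fin 2), ((Equiv.Perm.sign P : ℤ) : ℝ) * pairProd B k (v ∘ P) := by
  simp [pfForm, MultilinearMap.alternatization_apply, Units.smul_def, pairProd_apply]

theorem pfaffian_gram (B : V →ₗ[ℝ] V →ₗ[ℝ] ℝ) (k : ℕ) (v : Fin k × Fin 2 → V)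
    (G : Matrix (Fin k × Fin 2) (Fin k × Fin 2) ℝ) (hG : ∀ p q, G p q = B (v p) (v q)) :
    pfaffian G = pfForm B k v := by
  rw [pfForm_apply, pfaffian, div_eq_inv_mul]
  simp [pairProd_apply, hG]

theorem pfForm_congr {V' : Type*} [AddCommGroup V'] [Module ℝ V'] (B : V →ₗ[ℝ] V →ₗ[ℝ] ℝ)
    (B' : V' →ₗ[ℝ] V' →ₗ[ℝ] ℝ) (k : ℕ) (v : Fin k × Fin 2 → V) (v' : Fin k × Fin 2 → V')
    (h : ∀ p q, B (v p) (v q) = B' (v' p) (v' q)) : pfForm B k v = pfForm B' k v' := by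
  simp [pfForm_apply, pairProd_apply, h]

/-- A permutation of whole pairs acts as `σ` on two copies, and its sign is a square. -/
theorem sign_blockPerm {k : ℕ} (σ : Equiv.Perm (Fin k)) :
    Equiv.Perm.sign (Equiv.prodCongrLeft fun _ : Fin 2 => σ) = 1 := by
  rw [Equiv.Perm.sign_prodCongrLeft]
  simp

theorem pfForm_comp_perm (B : V →ₗ[ℝ] V →ₗ[ℝ] ℝ) (k : ℕ) (v : Fin k × Fin 2 → V)
    (σ : Equiv.Perm (Fin k)) :
    pfForm B k (fun p => v (σ p.1, p.2)) = pfForm B k v := by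
  have h := (pfForm B k).map_perm v (Equiv.prodCongrLeft fun _ : Fin 2 => σ)
  rw [sign_blockPerm, one_smul] at h
  exact h

/-- The `2(k+1)` vectors obtained by adding `a` at `(last, 0)` and `b` at `(last, 1)`. -/
def extendPair {k : ℕ} (v : Fin k × Fin 2 → V) (a b : V) (p : Fin (k + 1) × Fin 2) : V :=
  Fin.lastCases (motive := fun _ => V) (![a, b] p.2) (fun i => v (i, p.2)) p.1

/-- The index set with its last pair split off. -/
def optionPairEquiv (k : ℕ) : Option (Option (Fin k × Fin 2)) ≃ Fin (k + 1) × Fin 2 where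
  toFun o := match o with
    | none => (Fin.last k, 1)
    | some none => (Fin.last k, 0)
    | some (some p) => (p.1.castSucc, p.2)
  invFun p := Fin.lastCases (motive := fun _ => Option (Option (Fin k × Fin 2)))
    (![some none, none] p.2) (fun i => some (some (i, p.2))) p.1
  left_inv o := by
    rcases o with _ | _ | p <;> simp
  right_inv p := by
    obtain ⟨i, s⟩ := p
    refine Fin.lastCases ?_ (fun i => ?_) i
    · fin_cases s <;> simp
    · simp

theorem pairProd_perm_flip (B : V →ₗ[ℝ] V →ₗ[ℝ] ℝ) (hB : ∀ u w, B u w = -B w u) (k : ℕ)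
    (v : Fin k × Fin 2 → V) (l : Fin k) :
    pairProd B k (v ∘ Equiv.swap (l, 0) (l, 1)) = -pairProd B k v := by
  rw [pairProd_apply, pairProd_apply, ← Finset.mul_prod_erase _ _ (Finset.mem_univ l),
    ← Finset.mul_prod_erase (a := l) _ (fun l => B (v (l, 1)) (v (l, 0))) (Finset.mem_univ l),
    ← neg_mul]
  congr 1
  · simp [← hB]
  · refine Finset.prod_congr rfl fun i hi => ?_
    have : i ≠ l := Finset.ne_of_mem_erase hi
    simp [Equiv.swap_apply_of_ne_of_ne, this]

/-- Every slot for the last vector contributes equally: an even swap of pairs moves the slot into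
the last pair, and a flip inside that pair changes the sign of both the permutation and the product.
-/
theorem sum_perm_fiber (B : V →ₗ[ℝ] V →ₗ[ℝ] ℝ) (hB : ∀ u w, B u w = -B w u) (k : ℕ)
    (v : Fin (k + 1) × Fin 2 → V) (c : Fin (k + 1) × Fin 2) :
    (∑ P : Equiv.Perm (Fin (k + 1) × Fin 2), if P c = (Fin.last k, 1) then
        ((Equiv.Perm.sign P : ℤ) : ℝ) * pairProd B (k + 1) (v ∘ P) else 0) =
      ∑ P : Equiv.Perm (Fin (k + 1) × Fin 2), if P (Fin.last k, 1) = (Fin.last k, 1) then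
        ((Equiv.Perm.sign P : ℤ) : ℝ) * pairProd B (k + 1) (v ∘ P) else 0 := by
  obtain ⟨l, s⟩ := c
  have hblock : ∀ P : Equiv.Perm (Fin (k + 1) × Fin 2),
      pairProd B (k + 1) 
        (v ∘ ⇑(P * Equiv.prodCongrLeft fun _ : Fin 2 => Equiv.swap l (Fin.last k)))
        = pairProd B (k + 1) (v ∘ P) := by
    intro P
    simp only [pairProd_apply, Function.comp_apply, Equiv.Perm.mul_apply,
      Equiv.prodCongrLeft_apply]
    exact Equiv.prod_comp (Equiv.swap l (Fin.last k))
      (fun l => B (v (P (l, 1))) (v (P (l, 0))))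
  have h1 : ∀ s, (∑ P : Equiv.Perm (Fin (k + 1) × Fin 2), if P (l, s) = (Fin.last k, 1) then
        ((Equiv.Perm.sign P : ℤ) : ℝ) * pairProd B (k + 1) (v ∘ P) else 0) =
      ∑ P : Equiv.Perm (Fin (k + 1) × Fin 2), if P (Fin.last k, s) = (Fin.last k, 1) then
        ((Equiv.Perm.sign P : ℤ) : ℝ) * pairProd B (k + 1) (v ∘ P) else 0 := by
    intro s
    rw [← Equiv.sum_comp
      (Equiv.mulRight (Equiv.prodCongrLeft fun _ : Fin 2 => Equiv.swap l (Fin.last k)))]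
    refine Finset.sum_congr rfl fun P _ => ?_
    simp only [Equiv.coe_mulRight]
    rw [hblock, Equiv.Perm.sign_mul, sign_blockPerm]
    simp
  rw [h1]
  fin_cases s
  · simp only [Fin.zero_eta]
    rw [← Equiv.sum_comp (Equiv.mulRight (Equiv.swap (Fin.last k, (0 : Fin 2)) (Fin.last k, 1)))]
    refine Finset.sum_congr rfl fun P _ => ?_
    have := pairProd_perm_flip B hB (k + 1) (v ∘ P) (Fin.last k)
    rw [Function.comp_assoc, ← Equiv.Perm.coe_mul] at this
    simp only [Equiv.coe_mulRight]
    rw [this, Equiv.Perm.sign_mul,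
      Equiv.Perm.sign_swap (by simp)]
    simp
  · rfl

/-- `decomposeOption` sorts the permutations by the image of `none`, and only one fibre survives. -/
theorem sum_perm_fixing {α : Type*} [DecidableEq α] [Fintype α]
    (t : Equiv.Perm (Option α) → ℝ) :
    (∑ P, if P none = none then t P else 0) = ∑ σ : Equiv.Perm α, t (Equiv.optionCongr σ) := by
  rw [← Equiv.sum_comp Equiv.Perm.decomposeOption.symm, Fintype.sum_prod_type,
    Fintype.sum_option]
  have : ∀ (x : α) (σ : Equiv.Perm α),
      Equiv.Perm.decomposeOption.symm (some x, σ) none ≠ none := by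
    intro x σ
    simp [Equiv.Perm.decomposeOption_symm_apply]
  simp only [this, if_false, Finset.sum_const_zero, add_zero]
  refine Finset.sum_congr rfl fun σ _ => ?_
  rw [if_pos (by simp)]
  congr 1
  simp [Equiv.Perm.decomposeOption_symm_apply, Equiv.Perm.one_def]

/-- Expansion of a Pfaffian along its last row. -/
theorem pfForm_succ (B : V →ₗ[ℝ] V →ₗ[ℝ] ℝ) (hB : ∀ u w, B u w = -B w u) (k : ℕ)
    (v : Fin k × Fin 2 → V) (a b : V) :
    pfForm B (k + 1) (extendPair v a b) =
      B b a * pfForm B k v - ∑ p, B b (v p) * pfForm B k (Function.update v p a) := by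
  set z := extendPair v a b with hz
  set t : Equiv.Perm (Fin (k + 1) × Fin 2) → ℝ := fun P =>
    ((Equiv.Perm.sign P : ℤ) : ℝ) * pairProd B (k + 1) (z ∘ P) with ht
  -- Pinning the last vector to its own slot costs the factor `2(k + 1)`, which is the ratio of the
  -- normalizations `2^(k+1) (k+1)!` and `2^k k!`.
  have hsum : ∑ P, t P = 2 * (k + 1) * ∑ P, if P (Fin.last k, 1) = (Fin.last k, 1) then
      t P else 0 := by
    have : ∀ P, t P = ∑ c, if P c = (Fin.last k, 1) then t P else 0 := by
      intro P
      have : ∀ c, (P c = (Fin.last k, 1)) ↔ (c = P.symm (Fin.last k, 1)) := fun c => by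
        rw [Equiv.eq_symm_apply]
      simp [this]
    rw [Finset.sum_congr rfl fun P _ => this P, Finset.sum_comm,
      Finset.sum_congr rfl fun c _ => sum_perm_fiber B hB k z c]
    simp only [Finset.sum_const, Finset.card_univ, Fintype.card_prod, Fintype.card_fin,
      nsmul_eq_mul, ht]
    push_cast
    ring
  have hfix : (∑ P, if P (Fin.last k, 1) = (Fin.last k, 1) then t P else 0) =
      ∑ σ : Equiv.Perm (Option (Fin k × Fin 2)),
        t ((optionPairEquiv k).permCongr (Equiv.optionCongr σ)) := by
    rw [← sum_perm_fixing fun P => t ((optionPairEquiv k).permCongr P),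
      ← Equiv.sum_comp (optionPairEquiv k).permCongr]
    refine Finset.sum_congr rfl fun P _ => ?_
    have : ((optionPairEquiv k).permCongr P (Fin.last k, 1) = (Fin.last k, 1)) ↔
        P none = none := by
      have h0 : (Fin.last k, (1 : Fin 2)) = optionPairEquiv k none := rfl
      rw [h0, Equiv.permCongr_apply, Equiv.symm_apply_apply, Equiv.apply_eq_iff_eq]
    simp only [this]
  have hz0 : ∀ o, z (optionPairEquiv k o) = match o with
      | none => b
      | some none => a
      | some (some p) => v p := by
    rintro (_ | _ | p) <;> simp [hz, extendPair, optionPairEquiv]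
  have hperm : ∀ (σ : Equiv.Perm (Option (Fin k × Fin 2))),
      t ((optionPairEquiv k).permCongr (Equiv.optionCongr σ)) =
      ((Equiv.Perm.sign σ : ℤ) : ℝ) * (B b (z (optionPairEquiv k (some (σ none)))) *
        ∏ l, B (z (optionPairEquiv k (some (σ (some (l, 1))))))
          (z (optionPairEquiv k (some (σ (some (l, 0))))))) := by
    intro σ
    have e1 : ∀ l : Fin k, ∀ s : Fin 2, (optionPairEquiv k).symm (l.castSucc, s) =
        some (some (l, s)) := by
      intro l s; rw [Equiv.symm_apply_eq]; rfl
    have e2 : (optionPairEquiv k).symm (Fin.last k, 1) = none := by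
      rw [Equiv.symm_apply_eq]; rfl
    have e3 : (optionPairEquiv k).symm (Fin.last k, 0) = some none := by
      rw [Equiv.symm_apply_eq]; rfl
    have e4 : z (optionPairEquiv k none) = b := hz0 none
    simp only [ht, Equiv.Perm.sign_permCongr, Equiv.optionCongr_sign, pairProd_apply,
      Fin.prod_univ_castSucc, Function.comp_apply, Equiv.permCongr_apply, e1, e2, e3,
      Equiv.optionCongr_apply, Option.map_some, Option.map_none, e4]
    ring
  -- The permutations are split by the partner of `b`: either it is `a`, or it is some `v p` and
  -- then `a` takes over the place of `v p`. The transposition involved in the second case gives the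
  -- minus sign.
  have hdec : (∑ σ : Equiv.Perm (Option (Fin k × Fin 2)),
        t ((optionPairEquiv k).permCongr (Equiv.optionCongr σ))) =
      ∑ τ : Equiv.Perm (Fin k × Fin 2), (((Equiv.Perm.sign τ : ℤ) : ℝ) *
        (B b a * pairProd B k (v ∘ τ)) - ∑ p, ((Equiv.Perm.sign τ : ℤ) : ℝ) *
          (B b (v p) * pairProd B k (Function.update v p a ∘ τ))) := by
    rw [← Equiv.sum_comp Equiv.Perm.decomposeOption.symm, Fintype.sum_prod_type,
      Fintype.sum_option, Finset.sum_sub_distrib, sub_eq_add_neg,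
      Finset.sum_comm (f := fun (τ : Equiv.Perm (Fin k × Fin 2)) p =>
        ((Equiv.Perm.sign τ : ℤ) : ℝ) * (B b (v p) * pairProd B k (Function.update v p a ∘ τ))),
      ← Finset.sum_neg_distrib]
    congr 1
    · refine Finset.sum_congr rfl fun τ _ => ?_
      rw [hperm]
      simp [hz0, pairProd_apply]
    · refine Finset.sum_congr rfl fun p _ => ?_
      rw [← Finset.sum_neg_distrib]
      refine Finset.sum_congr rfl fun τ _ => ?_
      have e5 : ∀ q, z (optionPairEquiv k (some (Equiv.swap none (some p) (some q)))) =
          Function.update v p a q := by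
        intro q
        by_cases hq : q = p
        · subst hq; simp [hz0]
        · rw [Equiv.swap_apply_of_ne_of_ne (by simp) (by simpa using hq)]
          simp [hz0, hq]
      rw [hperm]
      simp only [Equiv.Perm.decomposeOption_symm_apply, Equiv.Perm.sign_mul,
        Equiv.optionCongr_sign, Equiv.Perm.mul_apply, Equiv.optionCongr_apply, Option.map_some,
        Option.map_none, Equiv.swap_apply_left, e5]
      rw [Equiv.Perm.sign_swap (by simp)]
      simp [hz0, pairProd_apply]
  rw [pfForm_apply, show (∑ P, ((Equiv.Perm.sign P : ℤ) : ℝ) * pairProd B (k + 1) (z ∘ P)) =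
    ∑ P, t P from rfl, hsum, hfix, hdec, Finset.sum_sub_distrib, Finset.sum_comm]
  simp only [pfForm_apply, Finset.mul_sum, mul_sub]
  have hf : ((k + 1 : ℝ)) ≠ 0 := by positivity
  have hk : (k.factorial : ℝ) ≠ 0 := by positivity
  congr 1
  · refine Finset.sum_congr rfl fun τ _ => ?_
    rw [Nat.factorial_succ]; push_cast; field_simp
    try ring
  · refine Finset.sum_congr rfl fun p _ => Finset.sum_congr rfl fun τ _ => ?_
    rw [Nat.factorial_succ]; push_cast; field_simp
    try ring

end Pfaffian

/-! ### Integrating out variables of a Pfaffian point process -/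

section Correlations

open Matrix

/-- The bilinear extension of `ε` to formal combinations of points. -/
def pointForm (ε : ℝ → ℝ → ℝ) : (ℝ →₀ ℝ) →ₗ[ℝ] (ℝ →₀ ℝ) →ₗ[ℝ] ℝ :=
  Finsupp.linearCombination ℝ fun x => Finsupp.linearCombination ℝ fun y => ε x y

theorem pointForm_single (ε : ℝ → ℝ → ℝ) (x y : ℝ) :
    pointForm ε (Finsupp.single x 1) (Finsupp.single y 1) = ε x y := by
  simp [pointForm]

theorem pointForm_antisymm {ε : ℝ → ℝ → ℝ} (h : ∀ x y, ε x y = -ε y x) (s t : ℝ →₀ ℝ) :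
    pointForm ε s t = -pointForm ε t s := by
  induction s using Finsupp.induction_linear with
  | zero => simp
  | add f g hf hg => simp [hf, hg]; ring
  | single a c =>
    induction t using Finsupp.induction_linear with
    | zero => simp
    | add f g hf hg => simp [hf, hg]; ring
    | single b d => simp [pointForm, h a b]; ring

/-- The bilinear form `((u, s), (u', s')) ↦ -u · P u' + ε(s, s')`. -/
def kernelForm {N : ℕ} (ε : ℝ → ℝ → ℝ) (P : Matrix (Fin N) (Fin N) ℝ) :
    ((Fin N → ℝ) × (ℝ →₀ ℝ)) →ₗ[ℝ] ((Fin N → ℝ) × (ℝ →₀ ℝ)) →ₗ[ℝ] ℝ :=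
  -((Matrix.toLinearMap₂' ℝ P).compl₁₂ (LinearMap.fst ℝ _ _) (LinearMap.fst ℝ _ _)) +
    (pointForm ε).compl₁₂ (LinearMap.snd ℝ _ _) (LinearMap.snd ℝ _ _)

theorem kernelForm_apply {N : ℕ} (ε : ℝ → ℝ → ℝ) (P : Matrix (Fin N) (Fin N) ℝ)
    (p q : (Fin N → ℝ) × (ℝ →₀ ℝ)) :
    kernelForm ε P p q = -(∑ j, ∑ k, p.1 j * P j k * q.1 k) + pointForm ε p.2 q.2 := by
  simp [kernelForm, Matrix.toLinearMap₂'_apply, mul_comm, mul_left_comm, mul_assoc]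

/-- The vectors whose Gram matrix is the matrix of the quaternion kernel. -/
def kernelVec {N k : ℕ} (φ ψ : Fin N → ℝ → ℝ) (x : Fin k → ℝ) (p : Fin k × Fin 2) :
    (Fin N → ℝ) × (ℝ →₀ ℝ) :=
  ![(fun j => φ j (x p.1), 0), (fun j => ψ j (x p.1), Finsupp.single (x p.1) 1)] p.2

/-- The quaternion kernel of functions `φ`, their `ε`-transforms `ψ` and a matrix `P`. -/
def pfKernel {N : ℕ} (φ ψ : Fin N → ℝ → ℝ) (ε : ℝ → ℝ → ℝ) (P : Matrix (Fin N) (Fin N) ℝ)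
    (x y : ℝ) : Matrix (Fin 2) (Fin 2) ℝ :=
  !![∑ j, ∑ k, φ j x * P j k * ψ k y, -∑ j, ∑ k, φ j x * P j k * φ k y;
     -ε x y + ∑ j, ∑ k, ψ j x * P j k * ψ k y, -∑ j, ∑ k, ψ j x * P j k * φ k y]

/-- The Pfaffian `qdet [f(x_j, x_l)]` as a function of the points. -/
def corrPf {N : ℕ} (φ ψ : Fin N → ℝ → ℝ) (ε : ℝ → ℝ → ℝ) (P : Matrix (Fin N) (Fin N) ℝ) (k : ℕ)
    (x : Fin k → ℝ) : ℝ :=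
  pfForm (kernelForm ε P) k (kernelVec φ ψ x)

/-- Multiplication by `Z` exchanges the two columns of every block and negates one of them. -/
theorem mul_zMatrix_apply {k : ℕ} (G : Matrix (Fin k × Fin 2) (Fin k × Fin 2) ℝ)
    (p q : Fin k × Fin 2) : (G * zMatrix k) p q = ![G p (q.1, 1), -G p (q.1, 0)] q.2 := by
  obtain ⟨j, t⟩ := q
  rw [Matrix.mul_apply, Fintype.sum_prod_type,
    Finset.sum_eq_single j (fun i _ hi => by simp [zMatrix, hi]) (by simp)]
  fin_cases t <;> simp [zMatrix]

/-- After the column exchange, the four entries of a block are exactly the products under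
`kernelForm` of the two vectors at `x` with the two vectors at `y`. -/
theorem qdet_blockMatrix_pfKernel {N k : ℕ} (φ ψ : Fin N → ℝ → ℝ) (ε : ℝ → ℝ → ℝ)
    (P : Matrix (Fin N) (Fin N) ℝ) (x : Fin k → ℝ) :
    qdet (blockMatrix (pfKernel φ ψ ε P) x) = corrPf φ ψ ε P k x := by
  refine pfaffian_gram _ _ _ _ ?_
  rintro ⟨i, s⟩ ⟨j, t⟩
  rw [mul_zMatrix_apply, kernelForm_apply]
  fin_cases s <;> fin_cases t <;>
    simp [blockMatrix, pfKernel, kernelVec, pointForm_single]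

theorem kernelForm_antisymm {N : ℕ} {ε : ℝ → ℝ → ℝ} {P : Matrix (Fin N) (Fin N) ℝ}
    (hε : ∀ x y, ε x y = -ε y x) (hP : ∀ j k, P j k = -P k j)
    (p q : (Fin N → ℝ) × (ℝ →₀ ℝ)) : kernelForm ε P p q = -kernelForm ε P q p := by
  rw [kernelForm_apply, kernelForm_apply, pointForm_antisymm hε p.2, Finset.sum_comm, neg_add,
    ← Finset.sum_neg_distrib, neg_neg]
  congr 1
  refine Finset.sum_congr rfl fun k _ => ?_
  rw [← Finset.sum_neg_distrib]
  refine Finset.sum_congr rfl fun j _ => ?_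
  rw [hP j k]; ring

theorem corrPf_comp_perm {N k : ℕ} (φ ψ : Fin N → ℝ → ℝ) (ε : ℝ → ℝ → ℝ)
    (P : Matrix (Fin N) (Fin N) ℝ) (x : Fin k → ℝ) (σ : Equiv.Perm (Fin k)) :
    corrPf φ ψ ε P k (x ∘ σ) = corrPf φ ψ ε P k x := by
  exact pfForm_comp_perm _ _ (kernelVec φ ψ x) σ

/-- Coinciding points give equal arguments of an alternating map. -/
theorem corrPf_eq_zero {N k : ℕ} (φ ψ : Fin N → ℝ → ℝ) (ε : ℝ → ℝ → ℝ)
    (P : Matrix (Fin N) (Fin N) ℝ) (x : Fin k → ℝ) (hx : ¬Function.Injective x) :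
    corrPf φ ψ ε P k x = 0 := by
  simp only [Function.Injective, not_forall] at hx
  obtain ⟨i, j, hij, hne⟩ := hx
  refine AlternatingMap.map_eq_zero_of_eq _ _ (i := (i, 0)) (j := (j, 0)) ?_ (by simpa using hne)
  simp [kernelVec, hij]

/-- Functions `φ`, their transforms `ψ` under the antisymmetric kernel `ε` on the set `I`, and a
matrix `P` that is minus the inverse of the matrix of skew products `∫ φ_j ψ_k`, with bounds that
make all integrals converge. -/
structure SkewSystem (I : Set ℝ) {N : ℕ} (φ ψ : Fin N → ℝ → ℝ) (ε : ℝ → ℝ → ℝ)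
    (P : Matrix (Fin N) (Fin N) ℝ) (b m : ℝ → ℝ) : Prop where
  measurableSet : MeasurableSet I
  eps_antisymm : ∀ x y, ε x y = -ε y x
  mat_antisymm : ∀ j k, P j k = -P k j
  measurable_φ : ∀ j, Measurable (φ j)
  measurable_ψ : ∀ j, Measurable (ψ j)
  measurable_ε : Measurable (Function.uncurry ε)
  b_nonneg : ∀ x, 0 ≤ b x
  m_nonneg : ∀ x, 0 ≤ m x
  φ_bound : ∀ j, ∀ x ∈ I, |φ j x| ≤ b x
  ψ_bound : ∀ j, ∀ x ∈ I, |ψ j x| ≤ m x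
  ε_bound : ∀ x ∈ I, ∀ y ∈ I, |ε x y| ≤ m x * m y
  integrable_bm : IntegrableOn (fun x => b x * m x) I
  integral_φ_ε : ∀ j, ∀ y ∈ I, ∫ x in I, φ j x * ε x y = -ψ j y
  integral_φ_ψ : ∀ j l, ∑ k, (∫ x in I, φ j x * ψ k x) * P k l = if j = l then -1 else 0

namespace SkewSystem

variable {I : Set ℝ} {N : ℕ} {φ ψ : Fin N → ℝ → ℝ} {ε : ℝ → ℝ → ℝ}
  {P : Matrix (Fin N) (Fin N) ℝ} {b m : ℝ → ℝ}

theorem integrable_φ_ψ (h : SkewSystem I φ ψ ε P b m) (j k : Fin N) :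
    IntegrableOn (fun x => φ j x * ψ k x) I := by
  refine Integrable.mono' h.integrable_bm
    ((h.measurable_φ j).mul (h.measurable_ψ k)).aestronglyMeasurable ?_
  refine (ae_restrict_iff' h.measurableSet).2 (.of_forall fun x hx => ?_)
  rw [Real.norm_eq_abs, abs_mul]
  exact mul_le_mul (h.φ_bound j x hx) (h.ψ_bound k x hx) (abs_nonneg _) (h.b_nonneg x)

theorem integrable_φ_ε (h : SkewSystem I φ ψ ε P b m) (j : Fin N) {y : ℝ} (hy : y ∈ I) :
    IntegrableOn (fun x => φ j x * ε x y) I := by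
  refine Integrable.mono' (h.integrable_bm.mul_const (m y))
    ((h.measurable_φ j).mul
      (h.measurable_ε.comp (measurable_id.prodMk measurable_const))).aestronglyMeasurable ?_
  refine (ae_restrict_iff' h.measurableSet).2 (.of_forall fun x hx => ?_)
  rw [Real.norm_eq_abs, abs_mul, mul_assoc]
  exact mul_le_mul (h.φ_bound j x hx) (h.ε_bound x hx y hy) (abs_nonneg _) (h.b_nonneg x)

theorem kernelVec_snoc {k : ℕ} (φ ψ : Fin N → ℝ → ℝ) (x : Fin k → ℝ) (t : ℝ) :
    kernelVec φ ψ (Fin.snoc x t : Fin (k + 1) → ℝ) = extendPair (kernelVec φ ψ x)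
      (fun j => φ j t, 0) (fun j => ψ j t, Finsupp.single t 1) := by
  ext1 ⟨i, s⟩
  refine Fin.lastCases ?_ (fun i => ?_) i
  · fin_cases s <;> simp [kernelVec, extendPair]
  · fin_cases s <;> simp [kernelVec, extendPair]

/-- Linearity in one slot. It moves the dependence on an integration variable `t`, which enters
through `u = φ(t)`, out of the Pfaffian. -/
theorem pfForm_update_fst {k : ℕ} (B : ((Fin N → ℝ) × (ℝ →₀ ℝ)) →ₗ[ℝ]
    ((Fin N → ℝ) × (ℝ →₀ ℝ)) →ₗ[ℝ] ℝ) (v : Fin k × Fin 2 → (Fin N → ℝ) × (ℝ →₀ ℝ))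
    (p : Fin k × Fin 2) (u : Fin N → ℝ) :
    pfForm B k (Function.update v p (u, 0)) =
      ∑ j, u j * pfForm B k (Function.update v p (Pi.single j 1, 0)) := by
  have hu : ((u, 0) : (Fin N → ℝ) × (ℝ →₀ ℝ)) = ∑ j, u j • (Pi.single j 1, 0) := by
    ext i
    · simp [Prod.fst_sum, Finset.sum_apply, Pi.single_apply]
    · simp [Prod.snd_sum]
  rw [hu, (pfForm B k).map_update_sum]
  simp only [AlternatingMap.map_update_smul, smul_eq_mul]

/-- The reproducing property. As `P` is minus the inverse of `∫ φ_j ψ_k`, the first-kind vectors are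
reproduced; for the second kind, the reproduced `ψ_j` cancels against `∫ φ_j ε = -ψ_j`. -/
theorem integral_kernelForm_φ (h : SkewSystem I φ ψ ε P b m) {k : ℕ} {x : Fin k → ℝ}
    (hx : ∀ i, x i ∈ I) (p : Fin k × Fin 2) (j : Fin N) :
    IntegrableOn (fun t => kernelForm ε P (fun j => ψ j t, Finsupp.single t 1)
        (kernelVec φ ψ x p) * φ j t) I ∧
    ∫ t in I, kernelForm ε P (fun j => ψ j t, Finsupp.single t 1)
        (kernelVec φ ψ x p) * φ j t = ![φ j (x p.1), 0] p.2 := by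
  obtain ⟨i, s⟩ := p
  have hsum : ∀ u : Fin N → ℝ, IntegrableOn (fun t => ∑ k, ∑ l, (φ j t * ψ k t) *
      (P k l * u l)) I ∧ ∫ t in I, ∑ k, ∑ l, (φ j t * ψ k t) * (P k l * u l) = -u j := by
    intro u
    have hint : ∀ k l, Integrable (fun t => (φ j t * ψ k t) * (P k l * u l))
        (volume.restrict I) := fun k l => (h.integrable_φ_ψ j k).mul_const _
    refine ⟨integrable_finsetSum _ fun k _ => integrable_finsetSum _ fun l _ => hint k l, ?_⟩
    rw [integral_finsetSum _ fun k _ => integrable_finsetSum _ fun l _ => hint k l]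
    simp_rw [integral_finsetSum _ fun l _ => hint _ l, integral_mul_const]
    rw [Finset.sum_comm]
    have : ∀ l, ∑ k, (∫ t in I, φ j t * ψ k t) * (P k l * u l) =
        (if j = l then -1 else 0) * u l := by
      intro l
      rw [← h.integral_φ_ψ j l, Finset.sum_mul]
      simp only [mul_assoc]
    simp [this]
  fin_cases s
  · have e : (fun t => kernelForm ε P (fun j => ψ j t, Finsupp.single t 1)
        (kernelVec φ ψ x (i, 0)) * φ j t) =
        fun t => -∑ k, ∑ l, (φ j t * ψ k t) * (P k l * φ l (x i)) := by
      ext t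
      rw [kernelForm_apply]
      simp only [kernelVec, Matrix.cons_val_zero, map_zero, add_zero, neg_mul, Finset.sum_mul]
      congr 1
      refine Finset.sum_congr rfl fun k _ => Finset.sum_congr rfl fun l _ => ?_
      ring
    simp only [Fin.zero_eta, e]
    refine ⟨(hsum _).1.neg, ?_⟩
    rw [integral_neg, (hsum fun l => φ l (x i)).2]
    simp
  · have e : (fun t => kernelForm ε P (fun j => ψ j t, Finsupp.single t 1)
        (kernelVec φ ψ x (i, 1)) * φ j t) =
        fun t => φ j t * ε t (x i) - ∑ k, ∑ l, (φ j t * ψ k t) * (P k l * ψ l (x i)) := by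
      ext t
      rw [kernelForm_apply]
      simp only [kernelVec, Matrix.cons_val_one, Matrix.cons_val_zero, pointForm_single, add_mul,
        neg_mul, Finset.sum_mul]
      rw [add_comm, ← sub_eq_add_neg, mul_comm]
      congr 1
      refine Finset.sum_congr rfl fun k _ => Finset.sum_congr rfl fun l _ => ?_
      ring
    simp only [Fin.mk_one, e]
    refine ⟨(h.integrable_φ_ε j (hx i)).sub (hsum _).1, ?_⟩
    rw [integral_sub (h.integrable_φ_ε j (hx i)) (hsum _).1, (hsum fun l => ψ l (x i)).2,
      h.integral_φ_ε j _ (hx i)]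
    simp

/-- The integral is minus the trace of `(∫ φ_j ψ_k) P = -1`. -/
theorem integral_kernelForm_diag (h : SkewSystem I φ ψ ε P b m) :
    IntegrableOn (fun t => kernelForm ε P (fun j => ψ j t, Finsupp.single t 1)
        (fun j => φ j t, 0)) I ∧
    ∫ t in I, kernelForm ε P (fun j => ψ j t, Finsupp.single t 1) (fun j => φ j t, 0) = N := by
  have e : (fun t => kernelForm ε P (fun j => ψ j t, Finsupp.single t 1)
        (fun j => φ j t, 0)) = fun t => -∑ l, ∑ k, (φ l t * ψ k t) * P k l := by
    ext t
    rw [kernelForm_apply, Finset.sum_comm]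
    simp only [map_zero, add_zero]
    congr 1
    refine Finset.sum_congr rfl fun k _ => Finset.sum_congr rfl fun l _ => ?_
    ring
  have hint : ∀ l k, Integrable (fun t => (φ l t * ψ k t) * P k l) (volume.restrict I) :=
    fun l k => (h.integrable_φ_ψ l k).mul_const _
  rw [e]
  refine ⟨(integrable_finsetSum _ fun k _ => integrable_finsetSum _ fun l _ => hint k l).neg, ?_⟩
  rw [integral_neg,
    integral_finsetSum _ fun k _ => integrable_finsetSum _ fun l _ => hint k l]
  simp_rw [integral_finsetSum _ fun l _ => hint _ l, integral_mul_const, h.integral_φ_ψ]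
  simp

/-- In the expansion along the new pair, the diagonal term yields `N`. Each of the `k` first-kind
slots is refilled with its own vector and yields `-1`, and the second-kind slots yield nothing. -/
theorem integral_corrPf_snoc (h : SkewSystem I φ ψ ε P b m) {k : ℕ} {x : Fin k → ℝ}
    (hx : ∀ i, x i ∈ I) :
    ∫ t in I, corrPf φ ψ ε P (k + 1) (Fin.snoc x t : Fin (k + 1) → ℝ) =
      ((N : ℝ) - k) * corrPf φ ψ ε P k x := by
  set B := kernelForm ε P
  set v := kernelVec φ ψ x with hv
  have e : (fun t => corrPf φ ψ ε P (k + 1) (Fin.snoc x t : Fin (k + 1) → ℝ)) = fun t =>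
      B (fun j => ψ j t, Finsupp.single t 1) (fun j => φ j t, 0) * pfForm B k v -
        ∑ p, ∑ j, (B (fun j => ψ j t, Finsupp.single t 1) (v p) * φ j t) *
          pfForm B k (Function.update v p (Pi.single j 1, 0)) := by
    ext t
    rw [corrPf, kernelVec_snoc,
      pfForm_succ _ (kernelForm_antisymm h.eps_antisymm h.mat_antisymm)]
    congr 1
    refine Finset.sum_congr rfl fun p _ => ?_
    rw [pfForm_update_fst, Finset.mul_sum]
    refine Finset.sum_congr rfl fun j _ => ?_
    rw [mul_assoc]
  have hint : ∀ p j, Integrable (fun t => (B (fun j => ψ j t, Finsupp.single t 1) (v p) * φ j t) *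
      pfForm B k (Function.update v p (Pi.single j 1, 0))) (volume.restrict I) := fun p j =>
    (h.integral_kernelForm_φ hx p j).1.mul_const _
  rw [e, integral_sub (h.integral_kernelForm_diag.1.mul_const _)
    (integrable_finsetSum _ fun p _ => integrable_finsetSum _ fun j _ => hint p j),
    integral_mul_const, h.integral_kernelForm_diag.2,
    integral_finsetSum _ fun p _ => integrable_finsetSum _ fun j _ => hint p j]
  have hval : ∀ p j, ∫ t in I, B (fun j => ψ j t, Finsupp.single t 1) (v p) * φ j t =
      ![φ j (x p.1), 0] p.2 := fun p j => (h.integral_kernelForm_φ hx p j).2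
  simp_rw [integral_finsetSum _ fun j _ => hint _ j, integral_mul_const, hval]
  have hself : ∀ i, ∑ j, φ j (x i) *
      pfForm B k (Function.update v (i, 0) (Pi.single j 1, 0)) = pfForm B k v := by
    intro i
    rw [← pfForm_update_fst B v (i, 0) fun j => φ j (x i)]
    congr 1
    rw [Function.update_eq_self_iff]
    simp [hv, kernelVec]
  rw [Fintype.sum_prod_type]
  simp only [Fin.sum_univ_two, Matrix.cons_val_zero, Matrix.cons_val_one, zero_mul,
    Finset.sum_const_zero, add_zero, hself]
  simp [corrPf, B, v]
  ring

/-- The bound for the entries of the kernel by products of one-variable functions. -/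
theorem kernelForm_bound (h : SkewSystem I φ ψ ε P b m) {k : ℕ} {x : Fin k → ℝ}
    (hx : ∀ i, x i ∈ I) (p q : Fin k × Fin 2) :
    |kernelForm ε P (kernelVec φ ψ x p) (kernelVec φ ψ x q)| ≤
      (1 + ∑ j, ∑ k, |P j k|) * ((![b (x p.1), m (x p.1)] p.2) * (![b (x q.1), m (x q.1)] q.2)) := by
  have h1 : ∀ (p : Fin k × Fin 2) (j : Fin N), |(kernelVec φ ψ x p).1 j| ≤
      ![b (x p.1), m (x p.1)] p.2 := by
    rintro ⟨i, s⟩ j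
    fin_cases s
    · simpa [kernelVec] using h.φ_bound j _ (hx i)
    · simpa [kernelVec] using h.ψ_bound j _ (hx i)
  have h0 : ∀ (p : Fin k × Fin 2), 0 ≤ ![b (x p.1), m (x p.1)] p.2 := by
    rintro ⟨i, s⟩
    fin_cases s
    · simpa using h.b_nonneg _
    · simpa using h.m_nonneg _
  have h2 : |pointForm ε (kernelVec φ ψ x p).2 (kernelVec φ ψ x q).2| ≤
      (![b (x p.1), m (x p.1)] p.2) * (![b (x q.1), m (x q.1)] q.2) := by
    have := mul_nonneg (h0 p) (h0 q)
    obtain ⟨i, s⟩ := p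
    obtain ⟨i', s'⟩ := q
    fin_cases s <;> fin_cases s' <;> simp [kernelVec, pointForm_single] at this ⊢
    any_goals exact this
    exact h.ε_bound _ (hx i) _ (hx i')
  rw [kernelForm_apply, add_mul, one_mul, add_comm]
  refine (abs_add_le _ _).trans (add_le_add h2 ?_)
  rw [abs_neg, Finset.sum_mul]
  refine (Finset.abs_sum_le_sum_abs _ _).trans (Finset.sum_le_sum fun j _ => ?_)
  rw [Finset.sum_mul]
  refine (Finset.abs_sum_le_sum_abs _ _).trans (Finset.sum_le_sum fun l _ => ?_)
  rw [abs_mul, abs_mul, mul_comm |_| |P j l|, mul_assoc]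
  exact mul_le_mul_of_nonneg_left (mul_le_mul (h1 p j) (h1 q l) (abs_nonneg _) (h0 p))
    (abs_nonneg _)

/-- Every product in the Pfaffian uses each of the `2k` vectors once, so the entrywise bounds
multiply to one `b` and one `m` per point. -/
theorem corrPf_bound (h : SkewSystem I φ ψ ε P b m) (k : ℕ) :
    ∃ C, ∀ x : Fin k → ℝ, (∀ i, x i ∈ I) →
      |corrPf φ ψ ε P k x| ≤ C * ∏ i, (b (x i) * m (x i)) := by
  set c := 1 + ∑ j, ∑ k, |P j k|
  refine ⟨(2 ^ k * (k.factorial : ℝ))⁻¹ *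
    (Fintype.card (Equiv.Perm (Fin k × Fin 2)) * c ^ k), fun x hx => ?_⟩
  rw [corrPf, pfForm_apply, abs_mul, abs_of_nonneg (by positivity), mul_assoc]
  refine mul_le_mul_of_nonneg_left ?_ (by positivity)
  have hterm : ∀ Q : Equiv.Perm (Fin k × Fin 2), |((Equiv.Perm.sign Q : ℤ) : ℝ) *
      pairProd (kernelForm ε P) k (kernelVec φ ψ x ∘ Q)| ≤ c ^ k * ∏ i, (b (x i) * m (x i)) := by
    intro Q
    have hs : |((Equiv.Perm.sign Q : ℤ) : ℝ)| = 1 := by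
      rcases Int.units_eq_one_or (Equiv.Perm.sign Q) with hs | hs <;> simp [hs]
    rw [abs_mul, hs, one_mul, pairProd_apply, Finset.abs_prod]
    refine (Finset.prod_le_prod (fun _ _ => abs_nonneg _) fun l _ =>
      h.kernelForm_bound hx (Q (l, 1)) (Q (l, 0))).trans_eq ?_
    rw [Finset.prod_mul_distrib, Finset.prod_const, Finset.card_univ, Fintype.card_fin]
    congr 1
    set g : Fin k × Fin 2 → ℝ := fun p => ![b (x p.1), m (x p.1)] p.2
    -- The permutation `Q` only rearranges the product of the bounds over all `2k` vectors.
    have := Equiv.prod_comp Q g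
    rw [Fintype.prod_prod_type, Fintype.prod_prod_type] at this
    simp only [Fin.prod_univ_two] at this
    simp only [g, Matrix.cons_val_zero, Matrix.cons_val_one] at this
    rw [← this]
    exact Finset.prod_congr rfl fun l _ => mul_comm _ _
  refine (Finset.abs_sum_le_sum_abs _ _).trans ((Finset.sum_le_sum fun Q _ => hterm Q).trans_eq ?_)
  rw [Finset.sum_const, Finset.card_univ, nsmul_eq_mul, mul_assoc]

theorem measurable_corrPf (h : SkewSystem I φ ψ ε P b m) (k : ℕ) :
    Measurable (corrPf φ ψ ε P k) := by
  unfold corrPf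
  simp only [pfForm_apply, pairProd_apply]
  refine (Finset.measurable_sum _ fun Q _ => (Finset.measurable_prod _ fun l _ => ?_).const_mul
    _).const_mul _
  simp only [Function.comp_apply]
  generalize Q (l, 1) = p
  generalize Q (l, 0) = q
  obtain ⟨i, s⟩ := p
  obtain ⟨j, t⟩ := q
  have hφ := h.measurable_φ
  have hψ := h.measurable_ψ
  have hε : Measurable fun x : Fin k → ℝ => ε (x i) (x j) :=
    h.measurable_ε.comp
      (show Measurable fun x : Fin k → ℝ => (x i, x j) by fun_prop)
  simp only [kernelForm_apply]
  fin_cases s <;> fin_cases t <;> simp [kernelVec, pointForm_single]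
  any_goals fun_prop
  exact Measurable.add (by fun_prop) hε

theorem integrable_corrPf_append (h : SkewSystem I φ ψ ε P b m) {k : ℕ} {x : Fin k → ℝ}
    (hx : ∀ i, x i ∈ I) (r : ℕ) :
    Integrable (fun y : Fin r → ℝ => corrPf φ ψ ε P (k + r) (Fin.append x y))
      (Measure.pi fun _ => volume.restrict I) := by
  obtain ⟨C, hC⟩ := h.corrPf_bound (k + r)
  have hprod : Integrable (fun y : Fin r → ℝ => ∏ i, (b (y i) * m (y i)))
      (Measure.pi fun _ => volume.restrict I) :=
    Integrable.fintype_prod (fun _ => h.integrable_bm)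
  refine Integrable.mono' (hprod.const_mul (C * ∏ i, (b (x i) * m (x i)))) ?_ ?_
  · refine ((h.measurable_corrPf (k + r)).comp ?_).aestronglyMeasurable
    refine measurable_pi_lambda _ fun i => ?_
    refine Fin.addCases (fun i => ?_) (fun i => ?_) i
    · simp
    · simpa using measurable_pi_apply i
  · have hae : ∀ᵐ y : Fin r → ℝ ∂(Measure.pi fun _ => volume.restrict I), ∀ i, y i ∈ I := by
      rw [ae_all_iff]
      intro i
      exact Measure.tendsto_eval_ae_ae.eventually (ae_restrict_mem h.measurableSet)
    filter_upwards [hae] with y hy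
    refine (hC _ ?_).trans_eq ?_
    · intro i
      refine Fin.addCases (fun i => ?_) (fun i => ?_) i
      · simpa using hx i
      · simpa using hy i
    · rw [Fin.prod_univ_add]
      simp [mul_assoc]

/-- Fubini, the last variable being integrated first. -/
theorem integral_corrPf_append (h : SkewSystem I φ ψ ε P b m) {k : ℕ} {x : Fin k → ℝ}
    (hx : ∀ i, x i ∈ I) (r : ℕ) :
    ∫ y : Fin r → ℝ, corrPf φ ψ ε P (k + r) (Fin.append x y)
      ∂(Measure.pi fun _ => volume.restrict I) =
      (∏ i ∈ Finset.range r, ((N : ℝ) - (k + i))) * corrPf φ ψ ε P k x := by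
  induction r with
  | zero =>
    have : ∀ y : Fin 0 → ℝ, corrPf φ ψ ε P (k + 0) (Fin.append x y) = corrPf φ ψ ε P k x := by
      intro y
      have : Fin.append x y = x := by
        ext i
        exact Fin.append_left x y i
      exact congrArg _ this
    simp only [this, Finset.range_zero, Finset.prod_empty, one_mul]
    rw [integral_const, Measure.pi_of_empty _ 0]
    simp
  | succ r ih =>
    have hmp := (measurePreserving_piFinSuccAbove (fun _ : Fin (r + 1) => volume.restrict I)
      (Fin.last r)).symm
    rw [← hmp.integral_comp']
    have hint := h.integrable_corrPf_append hx (r + 1)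
    rw [← hmp.integrable_comp_emb (MeasurableEquiv.measurableEmbedding _)] at hint
    refine (integral_prod_symm _ hint).trans ?_
    simp only [Function.comp_apply]
    have hae : ∀ᵐ y : Fin r → ℝ ∂(Measure.pi fun _ => volume.restrict I), ∀ i, y i ∈ I := by
      rw [ae_all_iff]
      intro i
      exact Measure.tendsto_eval_ae_ae.eventually (ae_restrict_mem h.measurableSet)
    have hstep : ∀ᵐ y : Fin r → ℝ ∂(Measure.pi fun _ => volume.restrict I),
        ∫ t in I, corrPf φ ψ ε P (k + (r + 1)) (Fin.append x
          ((MeasurableEquiv.piFinSuccAbove (fun _ => ℝ) (Fin.last r)).symm (t, y))) =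
        ((N : ℝ) - (k + r)) * corrPf φ ψ ε P (k + r) (Fin.append x y) := by
      filter_upwards [hae] with y hy
      have := h.integral_corrPf_snoc (x := Fin.append x y) (by
        intro i
        refine Fin.addCases (fun i => ?_) (fun i => ?_) i
        · simpa using hx i
        · simpa using hy i)
      push_cast at this
      rw [← this]
      refine integral_congr_ae (.of_forall fun t => ?_)
      simp only [MeasurableEquiv.piFinSuccAbove_symm_apply]
      rw [← Fin.append_snoc]
      congr 2
      exact (Fin.insertNthEquiv_last _ _ ▸ rfl)
    refine (integral_congr_ae hstep).trans ?_
    rw [integral_const_mul, ih, Finset.prod_range_succ]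
    ring

end SkewSystem

end Correlations

/-! ### The Pfaffian with as many points as functions -/

section FullPfaffian

open Matrix

theorem prod_univ_two_mul {M : Type*} [CommMonoid M] (n : ℕ) (f : ℕ → M) :
    ∏ i : Fin (2 * n), f i = ∏ p : Fin n, (f (2 * p) * f (2 * p + 1)) := by
  rw [Fin.prod_univ_eq_prod_range, Fin.prod_univ_eq_prod_range (fun p => f (2 * p) * f (2 * p + 1))]
  induction n with
  | zero => simp
  | succ n ih =>
    rw [show 2 * (n + 1) = 2 * n + 1 + 1 by ring, Finset.prod_range_succ, Finset.prod_range_succ, ih,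
      Finset.prod_range_succ, mul_assoc]

/-- Vectors whose products under the standard symplectic form are `a i * b k` for `i < k`. -/
def sympVec (a b : ℕ → ℝ) (i j : ℕ) : ℝ :=
  if j / 2 < i / 2 then b i * (if j % 2 = 0 then -a (j + 1) / b (j + 1) else 1)
  else if i = j then (if i % 2 = 0 then a i else b i) else 0

/-- Only the block of `i` contributes. In earlier blocks both vectors are multiples of `(-a (2p+1) /
b (2p+1), 1)`, so their symplectic product vanishes; in later blocks the vector of `i` is zero. The
quotient is what makes the odd vector `(0, b i)` of a block pair correctly with later ones. -/
theorem sum_sympVec {a b : ℕ → ℝ} (hb : ∀ i, b i ≠ 0) {n i k : ℕ} (hik : i < k) (hk : k < 2 * n) :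
    ∑ p : Fin n, (sympVec a b i (2 * p) * sympVec a b k (2 * p + 1) -
      sympVec a b i (2 * p + 1) * sympVec a b k (2 * p)) = a i * b k := by
  rw [Fin.sum_univ_eq_sum_range (fun p => sympVec a b i (2 * p) * sympVec a b k (2 * p + 1) -
      sympVec a b i (2 * p + 1) * sympVec a b k (2 * p)),
    Finset.sum_eq_single (i / 2)]
  · have hbi := hb i
    rcases Nat.even_or_odd' i with ⟨c, rfl | rfl⟩
    · have h1 : 2 * c / 2 = c := by omega
      simp only [sympVec, h1, lt_irrefl, if_false, if_true, Nat.mul_mod_right]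
      by_cases h : k = 2 * c + 1
      · subst h
        have h2 : (2 * c + 1) / 2 = c := by omega
        have h3 : (2 * c + 1) % 2 = 1 := by omega
        simp [h2, h3]
      · have h2 : (2 * c + 1) / 2 = c := by omega
        have h3 : (2 * c + 1) % 2 = 1 := by omega
        have h4 : c < k / 2 := by omega
        simp [h2, h3, h4]
    · have h1 : (2 * c + 1) / 2 = c := by omega
      have h2 : 2 * c / 2 = c := by omega
      have h3 : (2 * c + 1) % 2 = 1 := by omega
      have h4 : c < k / 2 := by omega
      simp [sympVec, h1, h2, h3, h4]
      field_simp
  · intro p _ hp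
    have h1 : (2 * p + 1) / 2 = p := by omega
    have h2 : 2 * p / 2 = p := by omega
    have h3 : (2 * p + 1) % 2 = 1 := by omega
    rcases lt_or_gt_of_ne hp with h | h
    · have h4 : p < k / 2 := by omega
      simp [sympVec, h1, h2, h3, h4, h]
      ring
    · have h4 : ¬ p < i / 2 := by omega
      have h5 : i ≠ 2 * p := by omega
      have h6 : i ≠ 2 * p + 1 := by omega
      simp [sympVec, h1, h2, h4, h5, h6]
  · intro h
    simp at h
    omega

/-- The vectors form a lower triangular matrix with diagonal `a 0, b 1, a 2, b 3, …`. -/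
theorem det_sympVec (a b : ℕ → ℝ) (n : ℕ) :
    (Matrix.of fun i j : Fin (2 * n) => sympVec a b i j).det =
      ∏ p : Fin n, (a (2 * p) * b (2 * p + 1)) := by
  rw [Matrix.det_of_isLowerTriangular]
  · simp only [Matrix.of_apply]
    rw [prod_univ_two_mul n fun i => sympVec a b i i]
    refine Finset.prod_congr rfl fun p _ => ?_
    have h3 : (2 * (p : ℕ) + 1) % 2 = 1 := by omega
    simp [sympVec, h3]
  · intro i j hij
    have hij : (i : ℕ) < j := hij
    have h1 : ¬ ((j : ℕ) / 2 < i / 2) := by omega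
    have h2 : (i : ℕ) ≠ j := by omega
    simp [sympVec, h1, h2]

/-- The form `-P` on the first and the standard symplectic form on the second components. -/
def modelForm {n : ℕ} (P : Matrix (Fin (2 * n)) (Fin (2 * n)) ℝ) :
    (Fin (2 * n) × Fin 2 → ℝ) →ₗ[ℝ] (Fin (2 * n) × Fin 2 → ℝ) →ₗ[ℝ] ℝ :=
  -((Matrix.toLinearMap₂' ℝ P).compl₁₂ (LinearMap.funLeft ℝ ℝ fun j => (j, 0))
      (LinearMap.funLeft ℝ ℝ fun j => (j, 0))) +
    ∑ p : Fin n, ((LinearMap.proj (⟨2 * p, by omega⟩, 1)).smulRight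
        (LinearMap.proj (R := ℝ) (φ := fun _ : Fin (2 * n) × Fin 2 => ℝ) (⟨2 * p + 1, by omega⟩, 1)) -
      (LinearMap.proj (⟨2 * p + 1, by omega⟩, 1)).smulRight
        (LinearMap.proj (R := ℝ) (φ := fun _ : Fin (2 * n) × Fin 2 => ℝ) (⟨2 * p, by omega⟩, 1)))

theorem modelForm_apply {n : ℕ} (P : Matrix (Fin (2 * n)) (Fin (2 * n)) ℝ)
    (z z' : Fin (2 * n) × Fin 2 → ℝ) :
    modelForm P z z' = -(∑ j, ∑ k, z (j, 0) * P j k * z' (k, 0)) +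
      ∑ p : Fin n, (z (⟨2 * p, by omega⟩, 1) * z' (⟨2 * p + 1, by omega⟩, 1) -
        z (⟨2 * p + 1, by omega⟩, 1) * z' (⟨2 * p, by omega⟩, 1)) := by
  simp [modelForm, Matrix.toLinearMap₂'_apply, LinearMap.funLeft_apply, LinearMap.sum_apply,
    mul_comm, mul_left_comm, mul_assoc]

/-- The vectors `(φ(x_i), 0)` and `(ψ(x_i), d_i)`. -/
def modelVec {n : ℕ} (φ ψ : Fin (2 * n) → ℝ → ℝ) (a b : ℕ → ℝ) (x : Fin (2 * n) → ℝ)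
    (p q : Fin (2 * n) × Fin 2) : ℝ :=
  ![![φ q.1 (x p.1), 0] q.2, ![ψ q.1 (x p.1), sympVec a b p.1 q.1] q.2] p.2

/-- Sorting rows and columns by their second index makes the matrix block lower triangular, and `ψ`
drops out. -/
theorem det_modelVec {n : ℕ} (φ ψ : Fin (2 * n) → ℝ → ℝ) (a b : ℕ → ℝ) (x : Fin (2 * n) → ℝ) :
    (Matrix.of (modelVec φ ψ a b x)).det = (Matrix.of fun i j => φ j (x i)).det *
      ∏ p : Fin n, (a (2 * p) * b (2 * p + 1)) := by
  let e : Fin (2 * n) ⊕ Fin (2 * n) ≃ Fin (2 * n) × Fin 2 :=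
    { toFun := Sum.elim (fun i => (i, 0)) fun i => (i, 1)
      invFun := fun p => ![Sum.inl p.1, Sum.inr p.1] p.2
      left_inv := by rintro (i | i) <;> simp
      right_inv := by rintro ⟨i, s⟩; fin_cases s <;> simp }
  rw [← Matrix.det_submatrix_equiv_self e, ← det_sympVec, ← Matrix.det_fromBlocks_zero₁₂ _
    (Matrix.of fun i j => ψ j (x i))]
  congr 1
  ext (i | i) (j | j) <;> simp [e, modelVec]

/-- Where `ε` factorizes, the point masses can be replaced by `sympVec` without changing any
product. This leaves `4n` vectors in a space of dimension `4n`, on which an alternating form of top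
degree is a multiple of the determinant. The multiple does not depend on the points. -/
theorem corrPf_of_ordered {n : ℕ} (φ ψ : Fin (2 * n) → ℝ → ℝ) (ε : ℝ → ℝ → ℝ)
    (P : Matrix (Fin (2 * n)) (Fin (2 * n)) ℝ) (hε : ∀ x y, ε x y = -ε y x) :
    ∃ c : ℝ, ∀ (x : Fin (2 * n) → ℝ) (a b : ℕ → ℝ), (∀ i, b i ≠ 0) →
      (∀ i j, i < j → ε (x i) (x j) = a i * b j) →
      corrPf φ ψ ε P (2 * n) x = c * ((Matrix.of fun i j => φ j (x i)).det *
        ∏ p : Fin n, (a (2 * p) * b (2 * p + 1))) := by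
  refine ⟨pfForm (modelForm P) (2 * n) (Pi.basisFun ℝ (Fin (2 * n) × Fin 2)),
    fun x a b hb hx => ?_⟩
  rw [← det_modelVec φ ψ a b x]
  have h1 := congrArg (fun f => f (modelVec φ ψ a b x))
    ((pfForm (modelForm P) (2 * n)).eq_smul_basis_det (Pi.basisFun ℝ (Fin (2 * n) × Fin 2)))
  simp only [AlternatingMap.smul_apply, smul_eq_mul, Pi.basisFun_det_apply] at h1
  refine Eq.trans ?_ h1
  refine pfForm_congr _ _ _ _ _ ?_
  have hε0 : ∀ i j : Fin (2 * n), ε (x i) (x j) =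
      ∑ p : Fin n, (sympVec a b i (2 * p) * sympVec a b j (2 * p + 1) -
        sympVec a b i (2 * p + 1) * sympVec a b j (2 * p)) := by
    intro i j
    rcases lt_trichotomy i j with h | h | h
    · rw [sum_sympVec hb h j.2, hx i j h]
    · subst h
      have := hε (x i) (x i)
      rw [show ε (x i) (x i) = 0 by linarith]
      exact (Finset.sum_eq_zero fun p _ => by ring).symm
    · rw [hε, hx j i h, ← sum_sympVec hb h i.2, ← Finset.sum_neg_distrib]
      exact Finset.sum_congr rfl fun p _ => by ring
  rintro ⟨i, s⟩ ⟨j, t⟩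
  rw [kernelForm_apply, modelForm_apply]
  fin_cases s <;> fin_cases t <;>
    simp [kernelVec, modelVec, pointForm_single, hε0]

/-- Rows release the weights and columns the leading coefficients, leaving a Vandermonde
determinant. -/
theorem det_eval_polynomials {N : ℕ} (R : Fin N → ℝ[X])
    (hR : ∀ j, (R j).degree = ((j : ℕ) : WithBot ℕ)) (w : ℝ → ℝ) :
    ∃ c : ℝ, ∀ x : Fin N → ℝ, (Matrix.of fun i j : Fin N => w (x i) * (R j).eval (x i)).det =
      c * ((∏ j, w (x j)) * diffProd x) := by
  have hne : ∀ j, R j ≠ 0 := fun j h => by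
    have := hR j
    rw [h, Polynomial.degree_zero] at this
    exact absurd this.symm (WithBot.coe_ne_bot)
  -- The signs convert the Vandermonde factors `x_k - x_j` into the factors `x_j - x_k` of
  -- `diffProd`.
  refine ⟨(∏ j, (R j).leadingCoeff) * ∏ j : Fin N, ∏ _k ∈ Finset.Ioi j, (-1 : ℝ), fun x => ?_⟩
  have hm := Matrix.det_eval_matrixOfPolynomials_eq_det_vandermonde x
    (fun j => R j * Polynomial.C (R j).leadingCoeff⁻¹)
    (fun j => by
      rw [Polynomial.natDegree_mul_leadingCoeff_inv _ (hne j)]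
      exact Polynomial.natDegree_eq_of_degree_eq_some (hR j))
    (fun j => Polynomial.monic_mul_leadingCoeff_inv (hne j))
  have e : (Matrix.of fun i j : Fin N => w (x i) * (R j).eval (x i)) =
      Matrix.of fun i j => (R j).leadingCoeff * (Matrix.of fun i j => w (x i) *
        (Matrix.of fun i j => (R j * Polynomial.C (R j).leadingCoeff⁻¹).eval (x i)) i j) i j := by
    ext i j
    have : (R j).leadingCoeff ≠ 0 := Polynomial.leadingCoeff_ne_zero.2 (hne j)
    simp
    field_simp
  rw [e, Matrix.det_mul_row, Matrix.det_mul_column, ← hm, Matrix.det_vandermonde]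
  have : diffProd x = (∏ j : Fin N, ∏ _k ∈ Finset.Ioi j, (-1 : ℝ)) *
      ∏ i : Fin N, ∏ j ∈ Finset.Ioi i, (x j - x i) := by
    simp only [diffProd, ← Finset.prod_mul_distrib]
    exact Finset.prod_congr rfl fun i _ => Finset.prod_congr rfl fun j _ => by ring
  have h1 : (∏ j : Fin N, ∏ _k ∈ Finset.Ioi j, (-1 : ℝ)) *
      (∏ j : Fin N, ∏ _k ∈ Finset.Ioi j, (-1 : ℝ)) = 1 := by
    simp only [← Finset.prod_mul_distrib]
    simp
  rw [this]
  linear_combination (-(∏ j, (R j).leadingCoeff) * (∏ j, w (x j)) *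
    ∏ i : Fin N, ∏ j ∈ Finset.Ioi i, (x j - x i)) * h1

end FullPfaffian

/-! ### Correlation functions of an ordered density -/

section OrderedDensity

theorem corrPf_cast {N : ℕ} (φ ψ : Fin N → ℝ → ℝ) (ε : ℝ → ℝ → ℝ)
    (P : Matrix (Fin N) (Fin N) ℝ) {k k' : ℕ} (h : k = k') (x : Fin k' → ℝ) :
    corrPf φ ψ ε P k (fun i => x (Fin.cast h i)) = corrPf φ ψ ε P k' x := by
  subst h
  rfl

theorem integral_pi_cast {s r : ℕ} (hs : s = r) (μ : Measure ℝ) (g : (Fin r → ℝ) → ℝ) :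
    ∫ y : Fin s → ℝ, g (fun i => y (Fin.cast hs.symm i)) ∂(Measure.pi fun _ => μ) =
      ∫ y : Fin r → ℝ, g y ∂(Measure.pi fun _ => μ) := by
  subst hs
  rfl

theorem integral_glue {N k r : ℕ} (h : N = k + r) (μ : Measure ℝ) (f : (Fin N → ℝ) → ℝ)
    (x : Fin k → ℝ) :
    ∫ y : Fin (N - k) → ℝ, f (glue x y) ∂(Measure.pi fun _ => μ) =
      ∫ y : Fin r → ℝ, f (fun i => Fin.append x y (Fin.cast h i)) ∂(Measure.pi fun _ => μ) := by
  have hs : N - k = r := by omega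
  rw [← integral_pi_cast hs]
  refine integral_congr_ae (.of_forall fun y => ?_)
  simp only
  congr 1
  ext i
  rw [glue]
  split_ifs with hi
  · have : Fin.cast h i = Fin.castAdd r ⟨i, hi⟩ := by ext; simp
    rw [this, Fin.append_left]
  · have : Fin.cast h i = Fin.natAdd k ⟨i - k, by omega⟩ := by ext; simp; omega
    rw [this, Fin.append_right]
    rfl

theorem prod_range_sub (k r : ℕ) :
    ∏ i ∈ Finset.range r, (((k + r : ℕ) : ℝ) - (k + i)) = (r.factorial : ℝ) := by
  rw [← Finset.prod_range_reflect]
  rw [← Finset.prod_range_add_one_eq_factorial]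
  push_cast
  refine Finset.prod_congr rfl fun i hi => ?_
  have hi := Finset.mem_range.1 hi
  rw [Nat.sub_sub, Nat.cast_sub (by omega)]
  push_cast
  ring

theorem exists_strictAnti_comp {N : ℕ} {x : Fin N → ℝ} (hx : Function.Injective x) :
    ∃ σ : Equiv.Perm (Fin N), StrictAnti (x ∘ σ) := by
  refine ⟨Tuple.sort (fun i => -x i), ?_⟩
  have h1 := Tuple.monotone_sort (fun i => -x i)
  have h2 : Function.Injective ((fun i => -x i) ∘ Tuple.sort (fun i => -x i)) :=
    (neg_injective.comp hx).comp (Equiv.injective _)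
  intro i j hij
  have := h1.strictMono_of_injective h2 hij
  simpa using this

theorem strictAnti_perm_unique {N : ℕ} {x : Fin N → ℝ} {σ : Equiv.Perm (Fin N)}
    (hx : StrictAnti x) (hσ : StrictAnti (x ∘ σ)) : σ = 1 := by
  have hm : StrictMono σ := fun i j hij => hx.lt_iff_gt.1 (hσ hij)
  have : (hm.orderIsoOfSurjective _ σ.surjective) = OrderIso.refl _ := Subsingleton.elim _ _
  ext i
  have := congrArg (fun f => f i) this
  simpa using congrArg Fin.val this

/-- Only the identity keeps a decreasing vector decreasing. -/
theorem sum_perm_ordered {N : ℕ} {I : Set ℝ} {p : (Fin N → ℝ) → ℝ}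
    (hp : ∀ x, ¬(StrictAnti x ∧ ∀ j, x j ∈ I) → p x = 0) {x : Fin N → ℝ} (hx : StrictAnti x) :
    ∑ σ : Equiv.Perm (Fin N), p (x ∘ σ) = p x := by
  rw [Finset.sum_eq_single 1]
  · simp
  · intro σ _ hσ
    exact hp _ fun h => hσ (strictAnti_perm_unique hx h.1)
  · simp

theorem measurableSet_ordered {N : ℕ} {I : Set ℝ} (hI : MeasurableSet I) :
    MeasurableSet {x : Fin N → ℝ | StrictAnti x ∧ ∀ j, x j ∈ I} := by
  have : {x : Fin N → ℝ | StrictAnti x ∧ ∀ j, x j ∈ I} =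
      (⋂ i, ⋂ j, ⋂ _ : i < j, {x | x j < x i}) ∩ ⋂ j, {x | x j ∈ I} := by
    ext x
    simp [StrictAnti]
  rw [this]
  refine MeasurableSet.inter (.iInter fun i => .iInter fun j => .iInter fun _ =>
    measurableSet_lt (measurable_pi_apply _) (measurable_pi_apply _))
    (.iInter fun j => measurable_pi_apply j hI)

theorem integral_comp_perm {N : ℕ} (p : (Fin N → ℝ) → ℝ) (σ : Equiv.Perm (Fin N)) :
    ∫ x, p (x ∘ σ) = ∫ x, p x :=
  (volume_measurePreserving_piCongrLeft (fun _ : Fin N => ℝ) σ.symm).integral_comp' p ▸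
    integral_congr_ae (.of_forall fun x => by
      simp only
      congr 1
      ext i
      simp [MeasurableEquiv.piCongrLeft, Equiv.piCongrLeft_apply_eq_cast])

/-- The full Pfaffian is a constant `c` times `p` on ordered points, hence `c` times the
symmetrization of `p` everywhere on `I`. Integrating out variables gives all correlations up to `c`,
and the case `k = 0` fixes `c`. -/
theorem SkewSystem.correlation_eq {I : Set ℝ} {n : ℕ} {φ ψ : Fin (2 * n) → ℝ → ℝ}
    {ε : ℝ → ℝ → ℝ} {P : Matrix (Fin (2 * n)) (Fin (2 * n)) ℝ} {b m : ℝ → ℝ}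
    (h : SkewSystem I φ ψ ε P b m) {w u v : ℝ → ℝ} {R : Fin (2 * n) → ℝ[X]}
    (hR : ∀ j, (R j).degree = ((j : ℕ) : WithBot ℕ)) (hφ : ∀ j x, φ j x = w x * (R j).eval x)
    (hε : ∀ x ∈ I, ∀ y ∈ I, y < x → ε x y = u x * v y) (hv : ∀ x ∈ I, v x ≠ 0)
    {p : (Fin (2 * n) → ℝ) → ℝ} (hp0 : ∀ x, ¬(StrictAnti x ∧ ∀ j, x j ∈ I) → p x = 0)
    (hp : ∀ x, StrictAnti x → (∀ j, x j ∈ I) → p x = (∏ j, w (x j)) *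
      (∏ j : Fin n, ε (oddCoord x j) (evenCoord x j)) * diffProd x) (hpos : ∀ x, 0 ≤ p x) :
    0 < ∫ x, p x ∧ ∀ k : ℕ, k ≤ 2 * n → ∀ x : Fin k → ℝ, (∀ j, x j ∈ I) →
      correlation (fun x => (1 / ∫ x, p x) * p x) k x = corrPf φ ψ ε P k x := by
  obtain ⟨c₁, hc₁⟩ := corrPf_of_ordered φ ψ ε P h.eps_antisymm
  obtain ⟨c₂, hc₂⟩ := det_eval_polynomials R hR w
  set c := c₁ * c₂ with hc
  have hord : ∀ x, StrictAnti x → (∀ j, x j ∈ I) → corrPf φ ψ ε P (2 * n) x = c * p x := by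
    intro x hx hxI
    -- The sequences are indexed by `ℕ`; the default value `1` keeps the second one nonzero beyond
    -- the last point.
    have := hc₁ x (fun i => if hi : i < 2 * n then u (x ⟨i, hi⟩) else 1)
      (fun i => if hi : i < 2 * n then v (x ⟨i, hi⟩) else 1)
      (fun i => by
        split_ifs with hi
        · exact hv _ (hxI _)
        · exact one_ne_zero)
      (fun i j hij => by simpa using hε _ (hxI i) _ (hxI j) (hx hij))
    rw [this, hp x hx hxI]
    simp only [hφ, hc₂]
    have e : ∏ q : Fin n, ((if hi : 2 * (q : ℕ) < 2 * n then u (x ⟨2 * q, hi⟩) else 1) *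
        (if hi : 2 * (q : ℕ) + 1 < 2 * n then v (x ⟨2 * q + 1, hi⟩) else 1)) =
        ∏ j : Fin n, ε (oddCoord x j) (evenCoord x j) := by
      refine Finset.prod_congr rfl fun q _ => ?_
      rw [dif_pos (by omega), dif_pos (by omega), oddCoord, evenCoord, hε _ (hxI _) _ (hxI _)]
      exact hx (by simp)
    rw [e, hc]
    ring
  -- Distinct points can be sorted, as both sides are symmetric; for coinciding points both sides
  -- vanish.
  have hsym : ∀ x : Fin (2 * n) → ℝ, (∀ j, x j ∈ I) → corrPf φ ψ ε P (2 * n) x =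
      c * ∑ σ : Equiv.Perm (Fin (2 * n)), p (x ∘ σ) := by
    intro x hxI
    by_cases hx : Function.Injective x
    · obtain ⟨τ, hτ⟩ := exists_strictAnti_comp hx
      rw [← corrPf_comp_perm φ ψ ε P x τ, hord _ hτ fun j => hxI _,
        ← sum_perm_ordered hp0 hτ]
      congr 1
      rw [← Equiv.sum_comp (Equiv.mulLeft τ) fun σ => p (x ∘ σ)]
      rfl
    · rw [corrPf_eq_zero _ _ _ _ _ hx, Finset.sum_eq_zero, mul_zero]
      intro σ _
      refine hp0 _ fun hσ => hx ?_
      have := hσ.1.injective.comp (Equiv.injective σ⁻¹)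
      simpa [Function.comp_assoc] using this
  have hzero : ∀ x : Fin (2 * n) → ℝ, ¬(∀ j, x j ∈ I) →
      ∑ σ : Equiv.Perm (Fin (2 * n)), p (x ∘ σ) = 0 := by
    intro x hx
    refine Finset.sum_eq_zero fun σ _ => hp0 _ fun hσ => hx fun j => ?_
    simpa using hσ.2 (σ⁻¹ j)
  have hres : ∀ r, (Measure.pi fun _ : Fin r => volume.restrict I) =
      (volume : Measure (Fin r → ℝ)).restrict (Set.univ.pi fun _ => I) := by
    intro r
    rw [volume_pi, Measure.restrict_pi_pi]
  have hIr : ∀ r, MeasurableSet (Set.univ.pi fun _ : Fin r => I) := fun r =>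
    MeasurableSet.univ_pi fun _ => h.measurableSet
  -- integration over the remaining variables
  have hint : ∀ k : ℕ, k ≤ 2 * n → ∀ x : Fin k → ℝ, (∀ j, x j ∈ I) →
      c * ∫ y : Fin (2 * n - k) → ℝ, ∑ σ : Equiv.Perm (Fin (2 * n)), p (glue x y ∘ σ) =
        ((2 * n - k).factorial : ℝ) * corrPf φ ψ ε P k x := by
    intro k hk x hx
    obtain ⟨r, hr⟩ := Nat.exists_eq_add_of_le hk
    have hr' : 2 * n - k = r := by omega
    have h1 := h.integral_corrPf_append hx r
    have hN : ((2 * n : ℕ) : ℝ) = ((k + r : ℕ) : ℝ) := by rw [hr]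
    have hf : ((2 * n - k).factorial : ℝ) = r.factorial := by rw [hr']
    rw [hN, prod_range_sub] at h1
    rw [hf, ← h1, ← integral_const_mul, volume_pi,
      integral_glue hr volume (fun z => c * ∑ σ : Equiv.Perm (Fin (2 * n)), p (z ∘ σ)), hres,
      ← volume_pi, ← setIntegral_eq_integral_of_forall_compl_eq_zero
        (s := Set.univ.pi fun _ : Fin r => I)]
    · refine setIntegral_congr_fun (hIr r) fun y hy => ?_
      rw [← hsym, corrPf_cast]
      intro i
      generalize Fin.cast hr i = i
      refine Fin.addCases (fun i => ?_) (fun i => ?_) i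
      · simpa using hx i
      · simpa using hy i (Set.mem_univ i)
    · intro y hy
      rw [hzero, mul_zero]
      intro hall
      refine hy fun i _ => ?_
      have := hall (Fin.cast hr.symm (Fin.natAdd k i))
      simpa using this
  -- The empty Pfaffian is `1`, so `c` times the total integral of the symmetrized weight is
  -- `(2n)!`; in particular `c ≠ 0`.
  have hfull := hint 0 (Nat.zero_le _) Fin.elim0 (fun j => j.elim0)
  have hcorr0 : corrPf φ ψ ε P 0 Fin.elim0 = 1 := by
    rw [corrPf, pfForm_apply]
    simp [pairProd_apply]
  rw [hcorr0, mul_one] at hfull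
  have hc0 : c ≠ 0 := by
    rintro h0
    rw [h0, zero_mul] at hfull
    exact absurd hfull.symm (by positivity)
  have hglue0 : ∫ y : Fin (2 * n - 0) → ℝ, ∑ σ : Equiv.Perm (Fin (2 * n)),
      p (glue Fin.elim0 y ∘ σ) = ∫ x, ∑ σ : Equiv.Perm (Fin (2 * n)), p (x ∘ σ) := by
    refine integral_congr_ae (.of_forall fun y => ?_)
    simp only
    refine Finset.sum_congr rfl fun σ _ => ?_
    congr 1
  -- Integrability is inherited from the Pfaffian, as `p` is `c⁻¹` times it on the ordered chamber
  -- and zero elsewhere.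
  have hpint : Integrable p := by
    have h1 := h.integrable_corrPf_append (x := Fin.elim0) (fun j => j.elim0) (2 * n)
    rw [hres] at h1
    have h2 : IntegrableOn (fun x : Fin (2 * n) → ℝ => corrPf φ ψ ε P (2 * n) x)
        (Set.univ.pi fun _ => I) := by
      refine h1.congr (.of_forall fun y => ?_)
      simp only
      rw [← corrPf_cast φ ψ ε P (show 2 * n = 0 + 2 * n by omega)]
      congr 1
      ext i
      have : Fin.cast (show 2 * n = 0 + 2 * n by omega) i = Fin.natAdd 0 i := by
        ext; simp
      rw [this, Fin.append_right]
    have h3 : IntegrableOn (fun x : Fin (2 * n) → ℝ => c⁻¹ * corrPf φ ψ ε P (2 * n) x)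
        {x | StrictAnti x ∧ ∀ j, x j ∈ I} :=
      (h2.mono_set fun x hx i _ => hx.2 i).const_mul c⁻¹
    refine ((integrable_indicator_iff (measurableSet_ordered h.measurableSet)).2 h3).congr
      (.of_forall fun x => ?_)
    by_cases hx : StrictAnti x ∧ ∀ j, x j ∈ I
    · rw [Set.indicator_of_mem (by exact hx), hord x hx.1 hx.2, inv_mul_cancel_left₀ hc0]
    · rw [Set.indicator_of_notMem (by exact hx), hp0 x hx]
  have hsumint : ∫ x, ∑ σ : Equiv.Perm (Fin (2 * n)), p (x ∘ σ) =
      ((2 * n).factorial : ℝ) * ∫ x, p x := by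
    rw [integral_finsetSum]
    · simp [integral_comp_perm, Fintype.card_perm]
    · intro σ _
      have hmp := volume_measurePreserving_piCongrLeft (fun _ : Fin (2 * n) => ℝ) σ.symm
      have := (hmp.integrable_comp_emb (MeasurableEquiv.measurableEmbedding _)).2 hpint
      refine this.congr (.of_forall fun x => ?_)
      simp only [Function.comp_apply]
      congr 1
      ext i
      simp [MeasurableEquiv.piCongrLeft, Equiv.piCongrLeft_apply_eq_cast]
  have hfac : ((2 * n).factorial : ℝ) ≠ 0 := by positivity
  have hcC : c * ∫ x, p x = 1 := by
    rw [hglue0, hsumint, Nat.sub_zero] at hfull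
    have : ((2 * n).factorial : ℝ) * (c * ∫ x, p x) = ((2 * n).factorial : ℝ) * 1 := by
      rw [mul_one]; linear_combination hfull
    exact mul_left_cancel₀ hfac this
  have hC0 : ∫ x, p x ≠ 0 := right_ne_zero_of_mul_eq_one hcC
  refine ⟨lt_of_le_of_ne (integral_nonneg hpos) hC0.symm, fun k hk x hx => ?_⟩
  have hk1 := hint k hk x hx
  have e : ∀ y : Fin (2 * n - k) → ℝ, symmetrize (fun x => (1 / ∫ x, p x) * p x) (glue x y) =
      (1 / ∫ x, p x) / ((2 * n).factorial : ℝ) *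
        ∑ σ : Equiv.Perm (Fin (2 * n)), p (glue x y ∘ σ) := by
    intro y
    rw [symmetrize, ← Finset.mul_sum]
    ring
  rw [correlation, integral_congr_ae (.of_forall e), integral_const_mul,
    ← eq_one_div_of_mul_eq_one_left hcC]
  have hdf : ((2 * n).descFactorial k : ℝ) * ((2 * n - k).factorial : ℝ) = (2 * n).factorial := by
    rw [mul_comm]
    exact_mod_cast Nat.factorial_mul_descFactorial hk
  have h2 : ((2 * n).descFactorial k : ℝ) * (c / ((2 * n).factorial : ℝ) *
      ∫ y : Fin (2 * n - k) → ℝ, ∑ σ : Equiv.Perm (Fin (2 * n)), p (glue x y ∘ σ)) =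
      ((2 * n).descFactorial k : ℝ) * ((2 * n - k).factorial : ℝ) / ((2 * n).factorial : ℝ) *
        corrPf φ ψ ε P k x := by
    linear_combination ((2 * n).descFactorial k : ℝ) / ((2 * n).factorial : ℝ) * hk1
  rw [h2, hdf, div_self hfac, one_mul]

end OrderedDensity

/-! ### The matrix of a derivation in an orthonormal family of even size -/

section SkewDerivation

open Matrix

variable {N : ℕ} {D : Matrix (Fin N) (Fin N) ℝ} {v : Fin N → ℝ}

/-- Here the parity of `N` enters. Since `Dᵀ = -(D + v vᵀ)` and the sign disappears in even
dimension, the matrix determinant lemma gives `det D = det D (1 + v · D⁻¹ v)`. -/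
theorem dotProduct_inv_mulVec_eq_zero (hN : Even N) (hdet : IsUnit D.det)
    (hD : D + Dᵀ = -vecMulVec v v) : v ⬝ᵥ D⁻¹ *ᵥ v = 0 := by
  have h1 : Dᵀ = -(D + vecMulVec v v) := by
    rw [eq_sub_of_add_eq' hD]; abel
  have h2 : (D + vecMulVec v v).det = D.det * (1 + v ⬝ᵥ D⁻¹ *ᵥ v) := by
    rw [vecMulVec_eq (Fin 1), det_add_replicateCol_mul_replicateRow hdet]
    congr 1
    simp only [det_unique, Matrix.add_apply, Matrix.one_apply_eq, Matrix.mul_assoc]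
    congr 1
  have h3 := congrArg Matrix.det h1
  rw [det_transpose, det_neg, Fintype.card_fin, hN.neg_one_pow, one_mul, h2] at h3
  have h4 : D.det * (v ⬝ᵥ D⁻¹ *ᵥ v) = D.det * 0 := by linear_combination -h3
  exact mul_left_cancel₀ hdet.ne_zero h4

/-- Multiplying `D + Dᵀ` by `D⁻¹` on the left and `D⁻ᵀ` on the right shows that `D⁻¹ + D⁻ᵀ` has rank
at most one with column `D⁻¹ v`, which is orthogonal to `v`. -/
theorem vecMul_inv_add_transpose (hN : Even N) (hdet : IsUnit D.det)
    (hD : D + Dᵀ = -vecMulVec v v) : v ᵥ* (D⁻¹)ᵀ = -(v ᵥ* D⁻¹) := by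
  have h0 := dotProduct_inv_mulVec_eq_zero hN hdet hD
  have hdt : IsUnit Dᵀ.det := by rwa [det_transpose]
  have h1 : D⁻¹ + (D⁻¹)ᵀ = -(vecMulVec (D⁻¹ *ᵥ v) v * (D⁻¹)ᵀ) := by
    have : D⁻¹ * (D + Dᵀ) * (D⁻¹)ᵀ = D⁻¹ + (D⁻¹)ᵀ := by
      rw [Matrix.mul_add, nonsing_inv_mul _ hdet, Matrix.add_mul, Matrix.one_mul, Matrix.mul_assoc,
        transpose_nonsing_inv, mul_nonsing_inv _ hdt, Matrix.mul_one, add_comm]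
    rw [← this, hD, Matrix.mul_neg, Matrix.neg_mul, mul_vecMulVec]
  have h2 : v ᵥ* (D⁻¹ + (D⁻¹)ᵀ) = 0 := by
    rw [h1, vecMul_neg, ← vecMul_vecMul, vecMul_vecMulVec, h0]
    simp
  rw [vecMul_add] at h2
  exact eq_neg_of_add_eq_zero_right h2

/-- The inverse of `D - Dᵀ`. -/
def skewInv (D : Matrix (Fin N) (Fin N) ℝ) : Matrix (Fin N) (Fin N) ℝ :=
  (1 / 4 : ℝ) • (D⁻¹ - (D⁻¹)ᵀ)

theorem skewInv_transpose (D : Matrix (Fin N) (Fin N) ℝ) : (skewInv D)ᵀ = -skewInv D := by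
  simp [skewInv, ← smul_neg]

/-- In `(D - Dᵀ)(D⁻¹ - D⁻ᵀ)` the cross products `D D⁻ᵀ` and `Dᵀ D⁻¹` equal `-1` up to rank-one
terms, which cancel by `vecMul_inv_add_transpose`. The total is `4`. -/
theorem sub_transpose_mul_skewInv (hN : Even N) (hdet : IsUnit D.det)
    (hD : D + Dᵀ = -vecMulVec v v) : (D - Dᵀ) * skewInv D = 1 := by
  have hdt : IsUnit Dᵀ.det := by rwa [det_transpose]
  have h1 : D * (D⁻¹)ᵀ = -1 - vecMulVec v v * (D⁻¹)ᵀ := by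
    have : D = -Dᵀ - vecMulVec v v := (eq_sub_of_add_eq hD).trans (by abel)
    calc D * (D⁻¹)ᵀ = (-Dᵀ - vecMulVec v v) * (D⁻¹)ᵀ := by rw [← this]
      _ = _ := by rw [Matrix.sub_mul, Matrix.neg_mul, transpose_nonsing_inv, mul_nonsing_inv _ hdt]
  have h2 : Dᵀ * D⁻¹ = -1 - vecMulVec v v * D⁻¹ := by
    have : Dᵀ = -D - vecMulVec v v := (eq_sub_of_add_eq' hD).trans (by abel)
    rw [this, Matrix.sub_mul, Matrix.neg_mul, mul_nonsing_inv _ hdet]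
  have h3 : vecMulVec v v * (D⁻¹)ᵀ = -(vecMulVec v v * D⁻¹) := by
    rw [vecMulVec_mul, vecMulVec_mul, vecMul_inv_add_transpose hN hdet hD]
    ext i j
    simp [vecMulVec_apply]
  rw [skewInv, Matrix.mul_smul, Matrix.sub_mul, Matrix.mul_sub, Matrix.mul_sub, h1, h2, h3,
    transpose_nonsing_inv, mul_nonsing_inv _ hdet, mul_nonsing_inv _ hdt]
  ext i j
  simp
  ring

/-- The matrix of skew products. -/
def skewGram (D : Matrix (Fin N) (Fin N) ℝ) (α : ℝ) : Matrix (Fin N) (Fin N) ℝ :=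
  ((D + α • 1)⁻¹)ᵀ - (D + α • 1)⁻¹

theorem skewGram_transpose (D : Matrix (Fin N) (Fin N) ℝ) (α : ℝ) :
    (skewGram D α)ᵀ = -skewGram D α := by
  simp [skewGram]

/-- With `S = D + α` the scalar drops out of `S - Sᵀ = D - Dᵀ`, so `(S⁻ᵀ - S⁻¹) Sᵀ = S⁻¹ (D - Dᵀ)`.
-/
theorem skewGram_mul (hN : Even N) (hdet : IsUnit D.det) (hD : D + Dᵀ = -vecMulVec v v) {α : ℝ}
    (hS : IsUnit (D + α • 1).det) :
    skewGram D α * ((D + α • 1)ᵀ * skewInv D * (D + α • 1)) = 1 := by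
  set S := D + α • (1 : Matrix (Fin N) (Fin N) ℝ) with hSdef
  have hSt : IsUnit Sᵀ.det := by rwa [det_transpose]
  have e1 : skewGram D α * Sᵀ = S⁻¹ * (D - Dᵀ) := by
    have : D - Dᵀ = S - Sᵀ := by rw [hSdef]; simp
    rw [skewGram, this, Matrix.sub_mul, Matrix.mul_sub, transpose_nonsing_inv,
      nonsing_inv_mul _ hSt, nonsing_inv_mul _ hS]
  rw [← Matrix.mul_assoc, ← Matrix.mul_assoc, e1, Matrix.mul_assoc S⁻¹,
    sub_transpose_mul_skewInv hN hdet hD, Matrix.mul_one, nonsing_inv_mul _ hS]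

theorem isUnit_skewGram (hN : Even N) (hdet : IsUnit D.det) (hD : D + Dᵀ = -vecMulVec v v) {α : ℝ}
    (hS : IsUnit (D + α • 1).det) : IsUnit (skewGram D α) :=
  (Matrix.isUnit_iff_isUnit_det _).2 (isUnit_det_of_right_inverse (skewGram_mul hN hdet hD hS))

theorem skewGram_inv_transpose (hN : Even N) (hdet : IsUnit D.det)
    (hD : D + Dᵀ = -vecMulVec v v) {α : ℝ} (hS : IsUnit (D + α • 1).det) :
    ((skewGram D α)⁻¹)ᵀ = -((D + α • 1)ᵀ * skewInv D * (D + α • 1)) := by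
  rw [inv_eq_right_inv (skewGram_mul hN hdet hD hS), transpose_mul, transpose_mul,
    skewInv_transpose, transpose_transpose, Matrix.mul_assoc]
  simp

theorem vecMul_skewInv_mul (hN : Even N) (hdet : IsUnit D.det) (hD : D + Dᵀ = -vecMulVec v v) :
    v ᵥ* skewInv D = (1 / 2 : ℝ) • (v ᵥ* D⁻¹) := by
  rw [skewInv, vecMul_smul, vecMul_sub, vecMul_inv_add_transpose hN hdet hD]
  ext i
  simp
  ring

variable {α ex ey : ℝ} {fx fy cx cy : Fin N → ℝ}

theorem dotProduct_skewGram_inv (hN : Even N) (hdet : IsUnit D.det)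
    (hD : D + Dᵀ = -vecMulVec v v) (hS : IsUnit (D + α • 1).det) (a b : Fin N → ℝ) :
    a ⬝ᵥ ((skewGram D α)⁻¹)ᵀ *ᵥ b =
      -(((D + α • 1) *ᵥ a) ⬝ᵥ skewInv D *ᵥ ((D + α • 1) *ᵥ b)) := by
  rw [skewGram_inv_transpose hN hdet hD hS, neg_mulVec, dotProduct_neg, Matrix.mul_assoc,
    ← mulVec_mulVec, ← mulVec_mulVec, dotProduct_mulVec, vecMul_transpose]

/-- `S (χ + S⁻¹ φ) = 2 D χ + e v`. -/
theorem add_smul_one_mulVec_transform (hS : IsUnit (D + α • 1).det)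
    (hx : D *ᵥ cx = fx - ex • v + α • cx) :
    (D + α • 1) *ᵥ (cx + (D + α • 1)⁻¹ *ᵥ fx) = (2 : ℝ) • (D *ᵥ cx) + ex • v := by
  rw [mulVec_add, mulVec_mulVec, mul_nonsing_inv _ hS, one_mulVec, add_mulVec, smul_mulVec,
    one_mulVec, two_smul]
  conv_rhs => enter [1, 2]; rw [hx]
  abel

/-- The hypothesis `hx` is the integrated differential equation of the forward integrals `cx`. It
turns `S` applied to the `ε`-transform into `2 D cx + ex v`, and both `Dᵀ` and `v` simplify against
`skewInv D`. -/
theorem dotProduct_kernel_offdiag (hN : Even N) (hdet : IsUnit D.det)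
    (hD : D + Dᵀ = -vecMulVec v v) (hS : IsUnit (D + α • 1).det)
    (hx : D *ᵥ cx = fx - ex • v + α • cx) :
    -((cx + (D + α • 1)⁻¹ *ᵥ fx) ⬝ᵥ ((skewGram D α)⁻¹)ᵀ *ᵥ fy) =
      1 / 2 * (fx ⬝ᵥ fy) - 1 / 2 * (cx ⬝ᵥ D *ᵥ fy) + α / 2 * ((D⁻¹ *ᵥ fy) ⬝ᵥ D *ᵥ cx)
        - α / 2 * (ex * (fy ⬝ᵥ D⁻¹ *ᵥ v)) := by
  have hfx : fx = D *ᵥ cx + ex • v - α • cx := by rw [hx]; abel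
  have e1 : Dᵀ * skewInv D = (1 / 4 : ℝ) • (Dᵀ * D⁻¹ - 1) := by
    have hdt : IsUnit Dᵀ.det := by rwa [det_transpose]
    rw [skewInv, Matrix.mul_smul, Matrix.mul_sub, transpose_nonsing_inv, mul_nonsing_inv _ hdt]
  have e2 : ∀ z, (D *ᵥ cx) ⬝ᵥ skewInv D *ᵥ z =
      1 / 4 * ((D *ᵥ cx) ⬝ᵥ D⁻¹ *ᵥ z - cx ⬝ᵥ z) := by
    intro z
    rw [← vecMul_transpose, ← dotProduct_mulVec, mulVec_mulVec, e1, smul_mulVec, sub_mulVec,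
      ← dotProduct_mulVec, mulVec_mulVec, one_mulVec]
    simp
  have e3 : ∀ z, v ⬝ᵥ skewInv D *ᵥ z = 1 / 2 * (v ⬝ᵥ D⁻¹ *ᵥ z) := by
    intro z
    rw [dotProduct_mulVec, vecMul_skewInv_mul hN hdet hD, smul_dotProduct, ← dotProduct_mulVec]
    simp
  have e4 : v ⬝ᵥ D⁻¹ *ᵥ fy = -(fy ⬝ᵥ D⁻¹ *ᵥ v) := by
    have := congrArg (fun z => z ⬝ᵥ fy) (vecMul_inv_add_transpose hN hdet hD)
    simp only [neg_dotProduct] at this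
    rw [dotProduct_mulVec, ← neg_eq_iff_eq_neg.2 this, vecMul_transpose, dotProduct_comm]
  have e5 : D⁻¹ *ᵥ ((D + α • 1) *ᵥ fy) = fy + α • (D⁻¹ *ᵥ fy) := by
    rw [add_mulVec, mulVec_add, mulVec_mulVec, nonsing_inv_mul _ hdet, one_mulVec, smul_mulVec,
      one_mulVec, mulVec_smul]
  have e6 : (D + α • 1) *ᵥ fy = D *ᵥ fy + α • fy := by
    rw [add_mulVec, smul_mulVec, one_mulVec]
  rw [dotProduct_skewGram_inv hN hdet hD hS, neg_neg, add_smul_one_mulVec_transform hS hx,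
    add_dotProduct, smul_dotProduct, smul_dotProduct, e2, e3, e5, e6, hfx]
  simp only [dotProduct_add, add_dotProduct, sub_dotProduct, smul_dotProduct, dotProduct_smul,
    smul_eq_mul, e4, dotProduct_comm (D⁻¹ *ᵥ fy) (D *ᵥ cx)]
  ring

/-- The same substitution in both arguments. Now `Dᵀ (skewInv D) D = (Dᵀ - D) / 4` removes all
inverses, and the term in `v` twice vanishes by antisymmetry. -/
theorem dotProduct_kernel_lower (hN : Even N) (hdet : IsUnit D.det)
    (hD : D + Dᵀ = -vecMulVec v v) (hS : IsUnit (D + α • 1).det)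
    (hx : D *ᵥ cx = fx - ex • v + α • cx) (hy : D *ᵥ cy = fy - ey • v + α • cy) :
    (cx + (D + α • 1)⁻¹ *ᵥ fx) ⬝ᵥ ((skewGram D α)⁻¹)ᵀ *ᵥ (cy + (D + α • 1)⁻¹ *ᵥ fy) =
      -(fx ⬝ᵥ cy - fy ⬝ᵥ cx) := by
  have hfx : fx = D *ᵥ cx + ex • v - α • cx := by rw [hx]; abel
  have hfy : fy = D *ᵥ cy + ey • v - α • cy := by rw [hy]; abel
  have hdt : IsUnit Dᵀ.det := by rwa [det_transpose]
  have e1 : (D *ᵥ cx) ⬝ᵥ skewInv D *ᵥ (D *ᵥ cy) =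
      1 / 4 * ((D *ᵥ cx) ⬝ᵥ cy - (D *ᵥ cy) ⬝ᵥ cx) := by
    have : Dᵀ * skewInv D * D = (1 / 4 : ℝ) • (Dᵀ - D) := by
      rw [skewInv, Matrix.mul_smul, Matrix.smul_mul, Matrix.mul_sub, Matrix.sub_mul,
        transpose_nonsing_inv, mul_nonsing_inv _ hdt, Matrix.mul_assoc, nonsing_inv_mul _ hdet,
        Matrix.mul_one, Matrix.one_mul]
    rw [← vecMul_transpose, ← dotProduct_mulVec, mulVec_mulVec, mulVec_mulVec, this, smul_mulVec,
      sub_mulVec, dotProduct_smul, dotProduct_sub, ← dotProduct_mulVec, dotProduct_comm cx (D *ᵥ cy)]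
    simp
  have e2 : ∀ z, v ⬝ᵥ skewInv D *ᵥ (D *ᵥ z) = 1 / 2 * (v ⬝ᵥ z) := by
    intro z
    rw [dotProduct_mulVec, vecMul_skewInv_mul hN hdet hD, smul_dotProduct, ← dotProduct_mulVec,
      mulVec_mulVec, nonsing_inv_mul _ hdet, one_mulVec]
    simp
  have hanti : ∀ a b : Fin N → ℝ, a ⬝ᵥ skewInv D *ᵥ b = -(b ⬝ᵥ skewInv D *ᵥ a) := by
    intro a b
    rw [dotProduct_mulVec, ← mulVec_transpose, skewInv_transpose, neg_mulVec, neg_dotProduct,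
      dotProduct_comm]
  have e3 : (D *ᵥ cx) ⬝ᵥ skewInv D *ᵥ v = -(1 / 2 * (v ⬝ᵥ cx)) := by rw [hanti, e2]
  have e4 : v ⬝ᵥ skewInv D *ᵥ v = 0 := by linarith [hanti v v]
  rw [dotProduct_skewGram_inv hN hdet hD hS, add_smul_one_mulVec_transform hS hx,
    add_smul_one_mulVec_transform hS hy, hfx, hfy]
  simp only [mulVec_add, mulVec_smul, dotProduct_add, add_dotProduct, sub_dotProduct,
    smul_dotProduct, dotProduct_smul, smul_eq_mul, e1, e2, e3, e4, dotProduct_comm cx cy]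
  ring

end SkewDerivation

/-! ### Weighted polynomials in exponential time

The Laguerre and Jacobi cases are treated together: `E` is the exponential of a time variable `s`
with `ds = dx / q(x)`, the weight is a power of `E`, and the interval starts at time `0`. -/

section ExpTime

open Matrix Set Filter Topology

/-- The exponential `E` of a time variable with `ds = dx / q(x)` on the open interval `J`, which
starts at the point `l`; the filter `L` is the right end of `J`. -/
structure ExpTime (J : Set ℝ) (l : ℝ) (q : ℝ[X]) (E : ℝ → ℝ) (L : Filter ℝ) : Prop where
  isOpen : IsOpen J
  ordConnected : J.OrdConnected
  l_mem : l ∈ J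
  q_pos : ∀ x ∈ J, 0 < q.eval x
  q_natDegree : q.natDegree ≤ 1
  E_pos : ∀ x ∈ J, 0 < E x
  E_l : E l = 1
  E_mono : MonotoneOn E J
  hasDerivAt_E : ∀ x ∈ J, HasDerivAt E (E x / q.eval x) x
  integrable_E : ∀ δ : ℝ, 0 < δ → ∀ f : ℝ[X], ∀ x ∈ J,
    IntegrableOn (fun t => E t ^ (-δ) * f.eval t / q.eval t) (J ∩ Ioi x)
  tendsto_E : ∀ δ : ℝ, 0 < δ → ∀ f : ℝ[X], Tendsto (fun t => E t ^ (-δ) * f.eval t) L (𝓝 0)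
  integral_deriv : ∀ x ∈ J, ∀ f f' : ℝ → ℝ, (∀ t ∈ J, HasDerivAt f (f' t) t) →
    IntegrableOn f' (J ∩ Ioi x) → Tendsto f L (𝓝 0) → ∫ t in J ∩ Ioi x, f' t = -f x
  eventually_mem : ∀ᶠ t in L, t ∈ J ∧ l < t

/-- The function `C₀ E^{-c/2} f` with a polynomial `f`. -/
def wPoly (E : ℝ → ℝ) (c C₀ : ℝ) (f : ℝ[X]) (x : ℝ) : ℝ := C₀ * E x ^ (-(c / 2)) * f.eval x

/-- The polynomial part of the time derivative of `wPoly`. -/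
def timeDeriv (c : ℝ) (q f : ℝ[X]) : ℝ[X] := -(Polynomial.C (c / 2) * f) + q * f.derivative

/-- The solution of `q g' = α g + f` that vanishes at `l`. -/
def forwardInt (l : ℝ) (q : ℝ[X]) (E : ℝ → ℝ) (α : ℝ) (f : ℝ → ℝ) (x : ℝ) : ℝ :=
  ∫ t in l..x, (E x / E t) ^ α * (f t / q.eval t)

namespace ExpTime

variable {J : Set ℝ} {l : ℝ} {q : ℝ[X]} {E : ℝ → ℝ} {L : Filter ℝ}

theorem measurableSet_tail (h : ExpTime J l q E L) (x : ℝ) : MeasurableSet (J ∩ Ioi x) :=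
  h.isOpen.measurableSet.inter measurableSet_Ioi

theorem uIcc_subset (h : ExpTime J l q E L) {x : ℝ} (hx : x ∈ J) : uIcc l x ⊆ J :=
  h.ordConnected.uIcc_subset h.l_mem hx

theorem one_le_E (h : ExpTime J l q E L) {x : ℝ} (hx : x ∈ J) (hl : l ≤ x) : 1 ≤ E x := by
  rw [← h.E_l]
  exact h.E_mono h.l_mem hx hl

theorem hasDerivAt_E_rpow (h : ExpTime J l q E L) (s : ℝ) {x : ℝ} (hx : x ∈ J) :
    HasDerivAt (fun t => E t ^ s) (s * E x ^ s / q.eval x) x := by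
  convert (h.hasDerivAt_E x hx).rpow_const (p := s) (Or.inl (h.E_pos x hx).ne') using 1
  rw [Real.rpow_sub_one (h.E_pos x hx).ne']
  have := (h.E_pos x hx).ne'
  have := (h.q_pos x hx).ne'
  field_simp

theorem hasDerivAt_wPoly (h : ExpTime J l q E L) (c C₀ : ℝ) (f : ℝ[X]) {x : ℝ} (hx : x ∈ J) :
    HasDerivAt (wPoly E c C₀ f) (wPoly E c C₀ (timeDeriv c q f) x / q.eval x) x := by
  have h1 := ((h.hasDerivAt_E_rpow (-(c / 2)) hx).const_mul C₀).mul (f.hasDerivAt x)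
  refine h1.congr_deriv ?_
  have := (h.q_pos x hx).ne'
  simp [wPoly, timeDeriv]
  field_simp

theorem continuousOn_wPoly (h : ExpTime J l q E L) (c C₀ : ℝ) (f : ℝ[X]) :
    ContinuousOn (wPoly E c C₀ f) J := fun _ hx =>
  (h.hasDerivAt_wPoly c C₀ f hx).continuousAt.continuousWithinAt

theorem continuousOn_E_rpow (h : ExpTime J l q E L) (s : ℝ) :
    ContinuousOn (fun t => E t ^ s) J := fun _ hx =>
  (h.hasDerivAt_E_rpow s hx).continuousAt.continuousWithinAt

theorem continuousOn_div_q (h : ExpTime J l q E L) {f : ℝ → ℝ} (hf : ContinuousOn f J) :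
    ContinuousOn (fun t => f t / q.eval t) J :=
  hf.div q.continuous.continuousOn fun x hx => (h.q_pos x hx).ne'

theorem E_rpow_mul_wPoly (h : ExpTime J l q E L) (β c C₀ : ℝ) (f : ℝ[X]) {t : ℝ} (ht : t ∈ J) :
    E t ^ β * wPoly E c C₀ f t = C₀ * (E t ^ (-(c / 2 - β)) * f.eval t) := by
  have : E t ^ (-(c / 2 - β)) = E t ^ β * E t ^ (-(c / 2)) := by
    rw [← Real.rpow_add (h.E_pos t ht)]
    ring_nf
  rw [this, wPoly]
  ring

theorem wPoly_mul_wPoly (h : ExpTime J l q E L) (c C₀ : ℝ) (f g : ℝ[X]) {t : ℝ} (ht : t ∈ J) :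
    wPoly E c C₀ f t * wPoly E c C₀ g t = C₀ ^ 2 * (E t ^ (-c) * (f * g).eval t) := by
  have : E t ^ (-c) = E t ^ (-(c / 2)) * E t ^ (-(c / 2)) := by
    rw [← Real.rpow_add (h.E_pos t ht)]
    ring_nf
  rw [this, wPoly, wPoly, Polynomial.eval_mul]
  ring

theorem integrableOn_E_rpow_mul (h : ExpTime J l q E L) {β c : ℝ} (hβ : β < c / 2) (C₀ : ℝ)
    (f : ℝ[X]) {x : ℝ} (hx : x ∈ J) :
    IntegrableOn (fun t => E t ^ β * wPoly E c C₀ f t / q.eval t) (J ∩ Ioi x) := by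
  refine IntegrableOn.congr_fun ((h.integrable_E (c / 2 - β) (by linarith) f x hx).const_mul C₀)
    (fun t ht => ?_) (h.measurableSet_tail x)
  rw [h.E_rpow_mul_wPoly β c C₀ f ht.1]
  ring

theorem integrableOn_wPoly (h : ExpTime J l q E L) {c : ℝ} (hc : 0 < c) (C₀ : ℝ)
    (f : ℝ[X]) {x : ℝ} (hx : x ∈ J) :
    IntegrableOn (fun t => wPoly E c C₀ f t / q.eval t) (J ∩ Ioi x) := by
  simpa using h.integrableOn_E_rpow_mul (β := 0) (by linarith) C₀ f hx

theorem integrableOn_wPoly_mul (h : ExpTime J l q E L) {c : ℝ} (hc : 0 < c) (C₀ : ℝ)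
    (f g : ℝ[X]) {x : ℝ} (hx : x ∈ J) :
    IntegrableOn (fun t => wPoly E c C₀ f t * wPoly E c C₀ g t / q.eval t) (J ∩ Ioi x) := by
  refine IntegrableOn.congr_fun ((h.integrable_E c hc (f * g) x hx).const_mul (C₀ ^ 2))
    (fun t ht => ?_) (h.measurableSet_tail x)
  rw [h.wPoly_mul_wPoly c C₀ f g ht.1]
  ring

theorem tendsto_E_rpow_mul (h : ExpTime J l q E L) {β c : ℝ} (hβ : β < c / 2) (C₀ : ℝ)
    (f : ℝ[X]) : Tendsto (fun t => E t ^ β * wPoly E c C₀ f t) L (𝓝 0) := by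
  have := (h.tendsto_E (c / 2 - β) (by linarith) f).const_mul C₀
  rw [mul_zero] at this
  refine this.congr' ?_
  filter_upwards [h.eventually_mem] with t ht
  rw [h.E_rpow_mul_wPoly β c C₀ f ht.1]

theorem tendsto_wPoly_mul (h : ExpTime J l q E L) {c : ℝ} (hc : 0 < c) (C₀ : ℝ) (f g : ℝ[X]) :
    Tendsto (fun t => wPoly E c C₀ f t * wPoly E c C₀ g t) L (𝓝 0) := by
  have := (h.tendsto_E c hc (f * g)).const_mul (C₀ ^ 2)
  rw [mul_zero] at this
  refine this.congr' ?_
  filter_upwards [h.eventually_mem] with t ht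
  rw [h.wPoly_mul_wPoly c C₀ f g ht.1]

theorem forwardInt_eq (h : ExpTime J l q E L) (α : ℝ) (f : ℝ → ℝ) {x : ℝ} (hx : x ∈ J) :
    forwardInt l q E α f x = E x ^ α * ∫ t in l..x, E t ^ (-α) * f t / q.eval t := by
  rw [forwardInt, ← intervalIntegral.integral_const_mul]
  refine intervalIntegral.integral_congr fun t ht => ?_
  have hE := h.E_pos t (h.uIcc_subset hx ht)
  rw [Real.div_rpow (h.E_pos x hx).le hE.le, Real.rpow_neg hE.le]
  ring

theorem continuousOn_integrand (h : ExpTime J l q E L) (α : ℝ) {f : ℝ → ℝ}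
    (hf : ContinuousOn f J) : ContinuousOn (fun t => E t ^ (-α) * f t / q.eval t) J :=
  h.continuousOn_div_q ((h.continuousOn_E_rpow _).mul hf)

theorem intervalIntegrable_integrand (h : ExpTime J l q E L) (α : ℝ) {f : ℝ → ℝ}
    (hf : ContinuousOn f J) {x : ℝ} (hx : x ∈ J) :
    IntervalIntegrable (fun t => E t ^ (-α) * f t / q.eval t) volume l x :=
  ((h.continuousOn_integrand α hf).mono (h.uIcc_subset hx)).intervalIntegrable

theorem forwardInt_self (l : ℝ) (q : ℝ[X]) (E : ℝ → ℝ) (α : ℝ) (f : ℝ → ℝ) :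
    forwardInt l q E α f l = 0 := intervalIntegral.integral_same

theorem hasDerivAt_forwardInt (h : ExpTime J l q E L) (α : ℝ) {f : ℝ → ℝ}
    (hf : ContinuousOn f J) {x : ℝ} (hx : x ∈ J) :
    HasDerivAt (forwardInt l q E α f) ((α * forwardInt l q E α f x + f x) / q.eval x) x := by
  have hJ : J ∈ 𝓝 x := h.isOpen.mem_nhds hx
  have hcont := (h.continuousOn_integrand α hf)
  have h1 : HasDerivAt (fun u => ∫ t in l..u, E t ^ (-α) * f t / q.eval t)
      (E x ^ (-α) * f x / q.eval x) x := by
    refine intervalIntegral.integral_hasDerivAt_right (h.intervalIntegrable_integrand α hf hx) ?_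
      (hcont.continuousAt hJ)
    exact hcont.stronglyMeasurableAtFilter h.isOpen x hx
  have h2 := (h.hasDerivAt_E_rpow α hx).mul h1
  refine (h2.congr_of_eventuallyEq ?_).congr_deriv ?_
  · filter_upwards [hJ] with y hy
    exact h.forwardInt_eq α f hy
  · rw [h.forwardInt_eq α f hx, Real.rpow_neg (h.E_pos x hx).le]
    have := (Real.rpow_pos_of_pos (h.E_pos x hx) α).ne'
    field_simp

theorem forwardInt_finset_sum (h : ExpTime J l q E L) (α : ℝ) {N : ℕ} (a : Fin N → ℝ)
    {f : Fin N → ℝ → ℝ} (hf : ∀ j, ContinuousOn (f j) J) {x : ℝ} (hx : x ∈ J) :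
    forwardInt l q E α (fun t => ∑ j, a j * f j t) x =
      ∑ j, a j * forwardInt l q E α (f j) x := by
  simp only [h.forwardInt_eq α _ hx]
  have : ∀ t, E t ^ (-α) * (∑ j, a j * f j t) / q.eval t =
      ∑ j, a j * (E t ^ (-α) * f j t / q.eval t) := by
    intro t
    rw [Finset.mul_sum, Finset.sum_div]
    exact Finset.sum_congr rfl fun j _ => by ring
  simp only [this]
  rw [intervalIntegral.integral_finsetSum fun j _ =>
    (h.intervalIntegrable_integrand α (hf j) hx).const_mul (a j), Finset.mul_sum]
  refine Finset.sum_congr rfl fun j _ => ?_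
  rw [intervalIntegral.integral_const_mul]
  ring

/-- Both `E t` and `E x / E t` are at least `1`. The exponent `max α 0` covers both signs of `α` and
stays below `c / 2` in the applications. -/
theorem ratio_rpow_le (h : ExpTime J l q E L) (α : ℝ) {x t : ℝ} (hx : x ∈ J) (ht : t ∈ J)
    (hl : l ≤ t) (htx : t ≤ x) : (E x / E t) ^ α ≤ E x ^ (max α 0) := by
  have h1 : 1 ≤ E t := h.one_le_E ht hl
  have h2 : 1 ≤ E x / E t := by
    rw [one_le_div (h.E_pos t ht)]
    exact h.E_mono ht hx htx
  refine (Real.rpow_le_rpow_of_exponent_le h2 (le_max_left α 0)).trans ?_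
  refine Real.rpow_le_rpow (zero_le_one.trans h2) ?_ (le_max_right α 0)
  exact div_le_self (h.E_pos x hx).le h1

theorem abs_forwardInt_le (h : ExpTime J l q E L) (α : ℝ) {f : ℝ → ℝ}
    (hf : IntegrableOn (fun t => f t / q.eval t) (J ∩ Ioi l)) {x : ℝ} (hx : x ∈ J) (hl : l ≤ x) :
    |forwardInt l q E α f x| ≤ E x ^ (max α 0) * ∫ t in J ∩ Ioi l, |f t / q.eval t| := by
  have hsub : Ioc l x ⊆ J ∩ Ioi l := fun t ht =>
    ⟨h.ordConnected.out h.l_mem hx ⟨ht.1.le, ht.2⟩, ht.1⟩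
  rw [forwardInt, intervalIntegral.integral_of_le hl]
  refine abs_integral_le_integral_abs.trans ?_
  have h1 : ∫ t in Ioc l x, |(E x / E t) ^ α * (f t / q.eval t)| ≤
      ∫ t in Ioc l x, E x ^ (max α 0) * |f t / q.eval t| := by
    refine integral_mono_of_nonneg (.of_forall fun t => abs_nonneg _)
      ((hf.mono_set hsub).abs.const_mul _) ?_
    refine (ae_restrict_iff' measurableSet_Ioc).2 (.of_forall fun t ht => ?_)
    simp only
    have htJ := (hsub ht).1
    rw [abs_mul, abs_of_nonneg (Real.rpow_nonneg (div_nonneg (h.E_pos x hx).le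
      (h.E_pos t htJ).le) _)]
    exact mul_le_mul_of_nonneg_right (h.ratio_rpow_le α hx htJ ht.1.le ht.2) (abs_nonneg _)
  refine h1.trans ?_
  rw [integral_const_mul]
  refine mul_le_mul_of_nonneg_left ?_ (Real.rpow_nonneg (h.E_pos x hx).le _)
  exact setIntegral_mono_set hf.abs (.of_forall fun t => abs_nonneg _) (.of_forall hsub)

end ExpTime

end ExpTime

/-! ### Orthonormal weighted polynomials and the matrix of the time derivative -/

section ExpTimeFamily

open Matrix Set Filter Topology

/-- Polynomials `p` that are orthonormal for the squared weight, and the matrix `D` of the time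
derivative in the corresponding weighted polynomials. -/
structure ExpTimeFamily (J : Set ℝ) (l : ℝ) (q : ℝ[X]) (E : ℝ → ℝ) (L : Filter ℝ) (c C₀ : ℝ)
    {N : ℕ} (p : Fin N → ℝ[X]) (D : Matrix (Fin N) (Fin N) ℝ) : Prop
    extends ExpTime J l q E L where
  c_pos : 0 < c
  timeDeriv_eq : ∀ j, timeDeriv c q (p j) = ∑ k, Polynomial.C (D j k) * p k
  orthonormal : ∀ j k, ∫ t in J ∩ Ioi l,
    wPoly E c C₀ (p j) t * wPoly E c C₀ (p k) t / q.eval t = if j = k then 1 else 0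

/-- The vector of the weighted polynomials at a point. -/
def wVec (E : ℝ → ℝ) (c C₀ : ℝ) {N : ℕ} (p : Fin N → ℝ[X]) (x : ℝ) (j : Fin N) : ℝ :=
  wPoly E c C₀ (p j) x

/-- The vector of the forward integrals of the weighted polynomials. -/
def forwardVec (l : ℝ) (q : ℝ[X]) (E : ℝ → ℝ) (α c C₀ : ℝ) {N : ℕ} (p : Fin N → ℝ[X]) (x : ℝ)
    (j : Fin N) : ℝ :=
  forwardInt l q E α (wPoly E c C₀ (p j)) x

namespace ExpTimeFamily

variable {J : Set ℝ} {l : ℝ} {q : ℝ[X]} {E : ℝ → ℝ} {L : Filter ℝ} {c C₀ : ℝ} {N : ℕ}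
  {p : Fin N → ℝ[X]} {D : Matrix (Fin N) (Fin N) ℝ}

theorem wPoly_timeDeriv (h : ExpTimeFamily J l q E L c C₀ p D) (j : Fin N) (x : ℝ) :
    wPoly E c C₀ (timeDeriv c q (p j)) x = (D *ᵥ wVec E c C₀ p x) j := by
  rw [h.timeDeriv_eq, wPoly, Polynomial.eval_finsetSum, Finset.mul_sum]
  simp only [mulVec, dotProduct, wVec, wPoly, Polynomial.eval_mul, Polynomial.eval_C]
  exact Finset.sum_congr rfl fun k _ => by ring

theorem hasDerivAt_wVec (h : ExpTimeFamily J l q E L c C₀ p D) (j : Fin N) {x : ℝ} (hx : x ∈ J) :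
    HasDerivAt (wPoly E c C₀ (p j)) ((D *ᵥ wVec E c C₀ p x) j / q.eval x) x := by
  rw [← h.wPoly_timeDeriv]
  exact h.hasDerivAt_wPoly c C₀ (p j) hx

theorem integral_sum_mul (h : ExpTimeFamily J l q E L c C₀ p D) (a : Fin N → ℝ) (k : Fin N) :
    ∫ t in J ∩ Ioi l, (∑ i, a i * wPoly E c C₀ (p i) t) * wPoly E c C₀ (p k) t / q.eval t =
      a k := by
  have : ∀ t, (∑ i, a i * wPoly E c C₀ (p i) t) * wPoly E c C₀ (p k) t / q.eval t =
      ∑ i, a i * (wPoly E c C₀ (p i) t * wPoly E c C₀ (p k) t / q.eval t) := by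
    intro t
    rw [Finset.sum_mul, Finset.sum_div]
    exact Finset.sum_congr rfl fun i _ => by ring
  simp only [this]
  rw [integral_finsetSum _ fun i _ =>
    (h.integrableOn_wPoly_mul h.c_pos C₀ (p i) (p k) h.l_mem).const_mul (a i)]
  simp [integral_const_mul, h.orthonormal]

theorem integrableOn_sum_mul (h : ExpTimeFamily J l q E L c C₀ p D) (a : Fin N → ℝ) (k : Fin N) :
    IntegrableOn (fun t => (∑ i, a i * wPoly E c C₀ (p i) t) * wPoly E c C₀ (p k) t / q.eval t)
      (J ∩ Ioi l) := by
  have : ∀ t, (∑ i, a i * wPoly E c C₀ (p i) t) * wPoly E c C₀ (p k) t / q.eval t =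
      ∑ i, a i * (wPoly E c C₀ (p i) t * wPoly E c C₀ (p k) t / q.eval t) := by
    intro t
    rw [Finset.sum_mul, Finset.sum_div]
    exact Finset.sum_congr rfl fun i _ => by ring
  simp only [this]
  exact integrable_finsetSum _ fun i _ =>
    (h.integrableOn_wPoly_mul h.c_pos C₀ (p i) (p k) h.l_mem).const_mul (a i)

/-- The derivative of a product of two weighted polynomials is integrated over the interval.
Orthonormality produces `D` and `Dᵀ`, and only the boundary term at `l` survives. -/
theorem add_transpose (h : ExpTimeFamily J l q E L c C₀ p D) :
    D + Dᵀ = -vecMulVec (wVec E c C₀ p l) (wVec E c C₀ p l) := by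
  ext j k
  have hd : ∀ t ∈ J, HasDerivAt (fun t => wPoly E c C₀ (p j) t * wPoly E c C₀ (p k) t)
      ((∑ i, D j i * wPoly E c C₀ (p i) t) * wPoly E c C₀ (p k) t / q.eval t +
        (∑ i, D k i * wPoly E c C₀ (p i) t) * wPoly E c C₀ (p j) t / q.eval t) t := by
    intro t ht
    refine ((h.hasDerivAt_wVec j ht).mul (h.hasDerivAt_wVec k ht)).congr_deriv ?_
    simp only [mulVec, dotProduct, wVec]
    ring
  have h1 := h.integral_deriv l h.l_mem _ _ hd
    ((h.integrableOn_sum_mul _ k).add (h.integrableOn_sum_mul _ j))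
    (h.tendsto_wPoly_mul h.c_pos C₀ (p j) (p k))
  rw [integral_add (h.integrableOn_sum_mul _ k) (h.integrableOn_sum_mul _ j),
    h.integral_sum_mul, h.integral_sum_mul] at h1
  simpa [vecMulVec_apply, wVec] using h1

theorem mulVec_integral_tail (h : ExpTimeFamily J l q E L c C₀ p D) {β : ℝ} (hβ : β < c / 2)
    {x : ℝ} (hx : x ∈ J) :
    (D + β • 1) *ᵥ (fun j => ∫ t in J ∩ Ioi x, E t ^ β * wPoly E c C₀ (p j) t / q.eval t) =
      -(E x ^ β • wVec E c C₀ p x) := by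
  ext j
  have hd : ∀ t ∈ J, HasDerivAt (fun t => E t ^ β * wPoly E c C₀ (p j) t)
      (∑ k, (D + β • 1) j k * (E t ^ β * wPoly E c C₀ (p k) t / q.eval t)) t := by
    intro t ht
    refine ((h.hasDerivAt_E_rpow β ht).mul (h.hasDerivAt_wVec j ht)).congr_deriv ?_
    simp only [Matrix.add_apply, add_mul, Finset.sum_add_distrib, Matrix.smul_apply,
      Matrix.one_apply, smul_eq_mul, mul_ite, mul_one, mul_zero, ite_mul, zero_mul,
      Finset.sum_ite_eq, Finset.mem_univ, if_true, mulVec, dotProduct, wVec]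
    rw [add_comm, Finset.sum_div, Finset.mul_sum]
    congr 1
    · exact Finset.sum_congr rfl fun k _ => by ring
    · ring
  have hint : ∀ k, Integrable (fun t => (D + β • 1) j k *
      (E t ^ β * wPoly E c C₀ (p k) t / q.eval t)) (volume.restrict (J ∩ Ioi x)) := fun k =>
    (h.integrableOn_E_rpow_mul hβ C₀ (p k) hx).const_mul _
  have h1 := h.integral_deriv x hx _ _ hd (integrable_finsetSum _ fun k _ => hint k)
    (h.tendsto_E_rpow_mul hβ C₀ (p j))
  rw [integral_finsetSum _ fun k _ => hint k] at h1
  simp only [integral_const_mul] at h1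
  simpa [mulVec, dotProduct, wVec] using h1

/-- By `mulVec_integral_tail`, a left null vector would be a linear relation between the weighted
polynomials, which orthonormality excludes. -/
theorem isUnit_det_add (h : ExpTimeFamily J l q E L c C₀ p D) {β : ℝ} (hβ : β < c / 2) :
    IsUnit (D + β • 1).det := by
  rw [isUnit_iff_ne_zero]
  intro h0
  obtain ⟨a, ha, ha0⟩ := Matrix.exists_vecMul_eq_zero_iff.2 h0
  apply ha
  have hz : ∀ x ∈ J, ∑ i, a i * wPoly E c C₀ (p i) x = 0 := by
    intro x hx
    have h1 := congrArg (fun z => a ⬝ᵥ z) (h.mulVec_integral_tail hβ hx)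
    simp only [dotProduct_mulVec, ha0, zero_dotProduct, dotProduct_neg, dotProduct_smul,
      smul_eq_mul] at h1
    have := (Real.rpow_pos_of_pos (h.E_pos x hx) β).ne'
    have h2 : a ⬝ᵥ wVec E c C₀ p x = 0 := by
      rcases mul_eq_zero.1 (neg_eq_zero.1 h1.symm) with h3 | h3
      · exact absurd h3 this
      · exact h3
    exact h2
  ext k
  rw [← h.integral_sum_mul a k, setIntegral_congr_fun (g := fun _ => 0) (h.measurableSet_tail l)]
  · simp
  · intro t ht
    simp [hz t ht.1]

theorem isUnit_det (h : ExpTimeFamily J l q E L c C₀ p D) : IsUnit D.det := by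
  have := h.isUnit_det_add (β := 0) (by linarith [h.c_pos])
  simpa using this

theorem integral_E_rpow_tail (h : ExpTimeFamily J l q E L c C₀ p D) {β : ℝ} (hβ : β < c / 2)
    {x : ℝ} (hx : x ∈ J) (j : Fin N) :
    ∫ t in J ∩ Ioi x, E t ^ β * wPoly E c C₀ (p j) t / q.eval t =
      -(E x ^ β * ((D + β • 1)⁻¹ *ᵥ wVec E c C₀ p x) j) := by
  have h1 := congrArg (fun z => ((D + β • 1)⁻¹ *ᵥ z) j) (h.mulVec_integral_tail hβ hx)
  simp only [mulVec_mulVec, nonsing_inv_mul _ (h.isUnit_det_add hβ), one_mulVec, mulVec_neg,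
    mulVec_smul] at h1
  simpa using h1

theorem integral_tail (h : ExpTimeFamily J l q E L c C₀ p D) {x : ℝ} (hx : x ∈ J) (j : Fin N) :
    ∫ t in J ∩ Ioi x, wPoly E c C₀ (p j) t / q.eval t = -(D⁻¹ *ᵥ wVec E c C₀ p x) j := by
  have := h.integral_E_rpow_tail (β := 0) (by linarith [h.c_pos]) hx j
  simpa using this

/-- The derivative of `E^(-α)` times a weighted polynomial is integrated from `l` to `x`; the
boundary value at `l`, where `E = 1`, gives the term with `E x ^ α`. -/
theorem mulVec_forwardVec (h : ExpTimeFamily J l q E L c C₀ p D) (α : ℝ) {x : ℝ} (hx : x ∈ J) :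
    D *ᵥ forwardVec l q E α c C₀ p x =
      wVec E c C₀ p x - E x ^ α • wVec E c C₀ p l + α • forwardVec l q E α c C₀ p x := by
  ext j
  have hcont : ∀ k, ContinuousOn (wPoly E c C₀ (p k)) J := fun k =>
    h.continuousOn_wPoly c C₀ (p k)
  have hint := fun k => h.intervalIntegrable_integrand α (hcont k) hx
  have hd : ∀ t ∈ uIcc l x, HasDerivAt (fun t => E t ^ (-α) * wPoly E c C₀ (p j) t)
      (∑ k, D j k * (E t ^ (-α) * wPoly E c C₀ (p k) t / q.eval t) -
        α * (E t ^ (-α) * wPoly E c C₀ (p j) t / q.eval t)) t := by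
    intro t ht
    have ht := h.uIcc_subset hx ht
    refine ((h.hasDerivAt_E_rpow (-α) ht).mul (h.hasDerivAt_wVec j ht)).congr_deriv ?_
    simp only [mulVec, dotProduct, wVec]
    rw [add_comm, Finset.sum_div, Finset.mul_sum, sub_eq_add_neg]
    congr 1
    · exact Finset.sum_congr rfl fun k _ => by ring
    · ring
  have hsum := IntervalIntegrable.sum Finset.univ fun k (_ : k ∈ Finset.univ) =>
    (hint k).const_mul (D j k)
  have hsum' : IntervalIntegrable (fun t => ∑ k, D j k *
      (E t ^ (-α) * wPoly E c C₀ (p k) t / q.eval t)) volume l x := by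
    have e : (fun t => ∑ k, D j k * (E t ^ (-α) * wPoly E c C₀ (p k) t / q.eval t)) =
        ∑ k, fun t => D j k * (E t ^ (-α) * wPoly E c C₀ (p k) t / q.eval t) := by
      ext t
      simp
    rw [e]
    exact hsum
  have h1 := intervalIntegral.integral_eq_sub_of_hasDerivAt hd
    (hsum'.sub ((hint j).const_mul α))
  rw [intervalIntegral.integral_sub hsum' ((hint j).const_mul α),
    intervalIntegral.integral_finsetSum fun k _ => (hint k).const_mul (D j k)] at h1
  simp only [intervalIntegral.integral_const_mul, h.E_l, Real.one_rpow, one_mul] at h1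
  simp only [mulVec, dotProduct, forwardVec, h.forwardInt_eq α _ hx, Pi.add_apply, Pi.sub_apply,
    Pi.smul_apply, smul_eq_mul, wVec]
  have hE : E x ^ α * E x ^ (-α) = 1 := by
    rw [← Real.rpow_add (h.E_pos x hx), add_neg_cancel, Real.rpow_zero]
  have h2 : ∑ k, D j k * (E x ^ α * ∫ t in l..x, E t ^ (-α) * wPoly E c C₀ (p k) t / q.eval t) =
      E x ^ α * ∑ k, D j k * ∫ t in l..x, E t ^ (-α) * wPoly E c C₀ (p k) t / q.eval t := by
    rw [Finset.mul_sum]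
    exact Finset.sum_congr rfl fun k _ => by ring
  rw [h2]
  linear_combination E x ^ α * h1 + wPoly E c C₀ (p j) x * hE

theorem continuousOn_forwardVec (h : ExpTimeFamily J l q E L c C₀ p D) (α : ℝ) (k : Fin N) :
    ContinuousOn (fun x => forwardVec l q E α c C₀ p x k) J := fun _ hx =>
  (h.hasDerivAt_forwardInt α (h.continuousOn_wPoly c C₀ (p k)) hx).continuousAt.continuousWithinAt

theorem exists_forwardVec_bound (h : ExpTimeFamily J l q E L c C₀ p D) (α : ℝ) :
    ∃ B, 0 ≤ B ∧ ∀ k, ∀ x ∈ J, l ≤ x →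
      |forwardVec l q E α c C₀ p x k| ≤ E x ^ (max α 0) * B := by
  refine ⟨∑ k, ∫ t in J ∩ Ioi l, |wPoly E c C₀ (p k) t / q.eval t|,
    Finset.sum_nonneg fun k _ => integral_nonneg fun t => abs_nonneg _, fun k x hx hl => ?_⟩
  refine (h.abs_forwardInt_le α (h.integrableOn_wPoly h.c_pos C₀ (p k) h.l_mem) hx hl).trans ?_
  refine mul_le_mul_of_nonneg_left ?_ (Real.rpow_nonneg (h.E_pos x hx).le _)
  exact Finset.single_le_sum (f := fun k => ∫ t in J ∩ Ioi l, |wPoly E c C₀ (p k) t / q.eval t|)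
    (fun k _ => integral_nonneg fun t => abs_nonneg _) (Finset.mem_univ k)

theorem max_lt_half (h : ExpTimeFamily J l q E L c C₀ p D) {α : ℝ} (hα : α < c / 2) :
    max α 0 < c / 2 := max_lt hα (by linarith [h.c_pos])

theorem integrableOn_mul_forwardVec (h : ExpTimeFamily J l q E L c C₀ p D) {α : ℝ}
    (hα : α < c / 2) (j k : Fin N) :
    IntegrableOn (fun t => wPoly E c C₀ (p j) t * forwardVec l q E α c C₀ p t k / q.eval t)
      (J ∩ Ioi l) := by
  obtain ⟨B, hB0, hB⟩ := h.exists_forwardVec_bound α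
  refine Integrable.mono' ((h.integrableOn_E_rpow_mul (h.max_lt_half hα) C₀ (p j)
    h.l_mem).abs.mul_const B) ?_ ?_
  · exact ((h.continuousOn_div_q ((h.continuousOn_wPoly c C₀ (p j)).mul
      (h.continuousOn_forwardVec α k))).mono inter_subset_left).aestronglyMeasurable
      (h.measurableSet_tail l)
  · refine (ae_restrict_iff' (h.measurableSet_tail l)).2 (.of_forall fun t ht => ?_)
    rw [Real.norm_eq_abs, abs_div, abs_mul, abs_div, abs_mul,
      abs_of_pos (Real.rpow_pos_of_pos (h.E_pos t ht.1) _), div_mul_eq_mul_div]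
    refine div_le_div_of_nonneg_right ?_ (abs_nonneg _)
    have := mul_le_mul_of_nonneg_left (hB k t ht.1 (le_of_lt ht.2))
      (abs_nonneg (wPoly E c C₀ (p j) t))
    linarith

theorem tendsto_mul_forwardVec (h : ExpTimeFamily J l q E L c C₀ p D) {α : ℝ}
    (hα : α < c / 2) (j k : Fin N) :
    Tendsto (fun t => wPoly E c C₀ (p j) t * forwardVec l q E α c C₀ p t k) L (𝓝 0) := by
  obtain ⟨B, hB0, hB⟩ := h.exists_forwardVec_bound α
  have h1 := (h.tendsto_E_rpow_mul (h.max_lt_half hα) C₀ (p j)).abs.mul_const B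
  rw [abs_zero, zero_mul] at h1
  refine squeeze_zero_norm' ?_ h1
  filter_upwards [h.eventually_mem] with t ht
  rw [Real.norm_eq_abs, abs_mul, abs_mul, abs_of_pos (Real.rpow_pos_of_pos (h.E_pos t ht.1) _)]
  have := mul_le_mul_of_nonneg_left (hB k t ht.1 ht.2.le) (abs_nonneg (wPoly E c C₀ (p j) t))
  linarith

/-- The derivative of a weighted polynomial times a forward integral has no boundary terms, as
forward integrals vanish at `l`. In matrix form this says `(D + α) Y = -1` for the matrix `Y` of the
integrals. -/
theorem integral_mul_forwardVec (h : ExpTimeFamily J l q E L c C₀ p D) {α : ℝ}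
    (hα : α < c / 2) (j k : Fin N) :
    ∫ t in J ∩ Ioi l, wPoly E c C₀ (p j) t * forwardVec l q E α c C₀ p t k / q.eval t =
      -((D + α • 1)⁻¹ j k) := by
  set Y : Matrix (Fin N) (Fin N) ℝ := Matrix.of fun j k =>
    ∫ t in J ∩ Ioi l, wPoly E c C₀ (p j) t * forwardVec l q E α c C₀ p t k / q.eval t with hY
  have hSY : (D + α • 1) * Y = -1 := by
    ext j k
    have hd : ∀ t ∈ J, HasDerivAt
        (fun t => wPoly E c C₀ (p j) t * forwardVec l q E α c C₀ p t k)
        ((∑ i, (D + α • 1) j i *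
            (wPoly E c C₀ (p i) t * forwardVec l q E α c C₀ p t k / q.eval t)) +
          wPoly E c C₀ (p j) t * wPoly E c C₀ (p k) t / q.eval t) t := by
      intro t ht
      refine ((h.hasDerivAt_wVec j ht).mul
        (h.hasDerivAt_forwardInt α (h.continuousOn_wPoly c C₀ (p k)) ht)).congr_deriv ?_
      simp only [Matrix.add_apply, add_mul, Finset.sum_add_distrib, Matrix.smul_apply,
        Matrix.one_apply, smul_eq_mul, mul_ite, mul_one, mul_zero, ite_mul, zero_mul,
        Finset.sum_ite_eq, Finset.mem_univ, if_true, mulVec, dotProduct, wVec, forwardVec]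
      rw [Finset.sum_div, Finset.sum_mul]
      have : ∀ i, D j i * wPoly E c C₀ (p i) t / q.eval t *
          forwardInt l q E α (wPoly E c C₀ (p k)) t = D j i * (wPoly E c C₀ (p i) t *
            forwardInt l q E α (wPoly E c C₀ (p k)) t / q.eval t) := fun i => by ring
      rw [Finset.sum_congr rfl fun i _ => this i]
      ring
    have hint : ∀ i, Integrable (fun t => (D + α • 1) j i *
        (wPoly E c C₀ (p i) t * forwardVec l q E α c C₀ p t k / q.eval t))
        (volume.restrict (J ∩ Ioi l)) := fun i =>
      (h.integrableOn_mul_forwardVec hα i k).const_mul _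
    have hsum := integrable_finsetSum Finset.univ fun i (_ : i ∈ Finset.univ) => hint i
    have h1 := h.integral_deriv l h.l_mem _ _ hd
      (hsum.add (h.integrableOn_wPoly_mul h.c_pos C₀ (p j) (p k) h.l_mem))
      (h.tendsto_mul_forwardVec hα j k)
    rw [integral_add hsum (h.integrableOn_wPoly_mul h.c_pos C₀ (p j) (p k) h.l_mem),
      integral_finsetSum _ fun i _ => hint i, h.orthonormal] at h1
    simp only [integral_const_mul, forwardVec, ExpTime.forwardInt_self, mul_zero, neg_zero] at h1
    rw [Matrix.mul_apply, Matrix.neg_apply, Matrix.one_apply]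
    simp only [hY, Matrix.of_apply, forwardVec]
    linarith
  have hS := h.isUnit_det_add hα
  have h2 : Y = -(D + α • 1)⁻¹ := by
    have := congrArg (fun Z => (D + α • 1)⁻¹ * Z) hSY
    simpa [← Matrix.mul_assoc, nonsing_inv_mul _ hS] using this
  have h3 := congrFun (congrFun h2 j) k
  simpa [hY] using h3

end ExpTimeFamily

end ExpTimeFamily

/-! ### Skew products, `ε`-transforms and the quaternion kernel in exponential time -/

section ExpTimeKernel

open Matrix Set Filter Topology

/-- `κ(x, y) = (E x / E y)^α` for `y < x`. -/
def expKappa (E : ℝ → ℝ) (α x y : ℝ) : ℝ := if y < x then (E x / E y) ^ α else 0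

/-- The antisymmetrization of `expKappa`. -/
def expEps (E : ℝ → ℝ) (α x y : ℝ) : ℝ := expKappa E α x y - expKappa E α y x

theorem expEps_antisymm (E : ℝ → ℝ) (α x y : ℝ) : expEps E α x y = -expEps E α y x := by
  simp [expEps]

theorem measurable_expKappa {E : ℝ → ℝ} (hE : Measurable E) (α : ℝ) :
    Measurable (Function.uncurry (expKappa E α)) := by
  refine Measurable.ite (measurableSet_lt measurable_snd measurable_fst) ?_ measurable_const
  exact ((hE.comp measurable_fst).div (hE.comp measurable_snd)).pow_const α

theorem measurable_expEps {E : ℝ → ℝ} (hE : Measurable E) (α : ℝ) :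
    Measurable (Function.uncurry (expEps E α)) :=
  (measurable_expKappa hE α).sub ((measurable_expKappa hE α).comp measurable_swap)

/-- The `ε`-transforms of the weighted polynomials. -/
def epsVec (l : ℝ) (q : ℝ[X]) (E : ℝ → ℝ) (α c C₀ : ℝ) {N : ℕ} (p : Fin N → ℝ[X])
    (D : Matrix (Fin N) (Fin N) ℝ) (x : ℝ) : Fin N → ℝ :=
  forwardVec l q E α c C₀ p x + (D + α • 1)⁻¹ *ᵥ wVec E c C₀ p x

/-- The domain `I` of an ensemble, up to its left end, and its weight function. -/
structure WeightOn (I J : Set ℝ) (l : ℝ) (q : ℝ[X]) (E : ℝ → ℝ) (c C₀ : ℝ) (w : ℝ → ℝ) : Prop where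
  measurableSet : MeasurableSet I
  subset : I ⊆ J ∩ Ici l
  superset : J ∩ Ioi l ⊆ I
  measurable_w : Measurable w
  measurable_E : Measurable E
  weight_eq : ∀ x ∈ J, w x * q.eval x = C₀ * E x ^ (-(c / 2))

namespace ExpTimeFamily

variable {I J : Set ℝ} {l : ℝ} {q : ℝ[X]} {E : ℝ → ℝ} {L : Filter ℝ} {c C₀ : ℝ} {N : ℕ}
  {p : Fin N → ℝ[X]} {D : Matrix (Fin N) (Fin N) ℝ} {w : ℝ → ℝ} {α : ℝ}

/-- The two sets differ at most by the point `l`, which allows for both `[0, ∞)` and `(-1, 1)`. -/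
theorem restrict_eq (hI : WeightOn I J l q E c C₀ w) :
    volume.restrict I = volume.restrict (J ∩ Ioi l) := by
  refine Measure.restrict_congr_set ?_
  have hsub : I \ (J ∩ Ioi l) ⊆ {l} := by
    intro x hx
    have h1 := hI.subset hx.1
    by_contra hne
    exact hx.2 ⟨h1.1, lt_of_le_of_ne h1.2 (Ne.symm hne)⟩
  refine (ae_eq_set).2 ⟨measure_mono_null hsub (by simp), ?_⟩
  rw [sdiff_eq_empty.2 hI.superset, measure_empty]

theorem weight_mul (h : ExpTimeFamily J l q E L c C₀ p D) (hI : WeightOn I J l q E c C₀ w)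
    (f : ℝ[X]) {x : ℝ} (hx : x ∈ J) : w x * f.eval x = wPoly E c C₀ f x / q.eval x := by
  have := (h.q_pos x hx).ne'
  rw [wPoly, ← hI.weight_eq x hx]
  field_simp

theorem Ioc_subset (h : ExpTimeFamily J l q E L c C₀ p D) {x : ℝ} (hx : x ∈ J) :
    Ioc l x ⊆ J ∩ Ioi l := fun _ ht =>
  ⟨h.ordConnected.out h.l_mem hx ⟨ht.1.le, ht.2⟩, ht.1⟩

theorem integral_expKappa_left (h : ExpTimeFamily J l q E L c C₀ p D)
    (hI : WeightOn I J l q E c C₀ w) (f : ℝ[X]) {x : ℝ} (hx : x ∈ I) :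
    IntegrableOn (fun y => w y * f.eval y * expKappa E α x y) I ∧
    ∫ y in I, w y * f.eval y * expKappa E α x y =
      forwardInt l q E α (wPoly E c C₀ f) x := by
  have hxJ := (hI.subset hx).1
  have hlx : l ≤ x := (hI.subset hx).2
  rw [IntegrableOn, restrict_eq hI]
  have e : EqOn (fun y => w y * f.eval y * expKappa E α x y)
      ((Iio x).indicator fun y => (E x / E y) ^ α * (wPoly E c C₀ f y / q.eval y))
      (J ∩ Ioi l) := by
    intro y hy
    simp only [expKappa, indicator, mem_Iio]
    rw [h.weight_mul hI f hy.1]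
    split_ifs <;> ring
  have hset : Iio x ∩ (J ∩ Ioi l) = Ioo l x := by
    ext y
    simp only [mem_inter_iff, mem_Iio, mem_Ioi, mem_Ioo]
    exact ⟨fun hy => ⟨hy.2.2, hy.1⟩, fun hy => ⟨hy.2, h.Ioc_subset hxJ ⟨hy.1, hy.2.le⟩⟩⟩
  constructor
  · rw [← IntegrableOn, integrableOn_congr_fun e (h.measurableSet_tail l), IntegrableOn,
      integrable_indicator_iff measurableSet_Iio, IntegrableOn,
      Measure.restrict_restrict measurableSet_Iio, hset]
    have h1 := (h.intervalIntegrable_integrand α (h.continuousOn_wPoly c C₀ f) hxJ).const_mul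
      (E x ^ α)
    rw [intervalIntegrable_iff_integrableOn_Ioo_of_le hlx] at h1
    refine IntegrableOn.congr_fun h1 (fun t ht => ?_) measurableSet_Ioo
    have hE := h.E_pos t (h.Ioc_subset hxJ ⟨ht.1, ht.2.le⟩).1
    rw [Real.div_rpow (h.E_pos x hxJ).le hE.le, Real.rpow_neg hE.le]
    ring
  · rw [setIntegral_congr_fun (h.measurableSet_tail l) e, integral_indicator measurableSet_Iio,
      Measure.restrict_restrict measurableSet_Iio, hset, forwardInt,
      intervalIntegral.integral_of_le hlx, integral_Ioc_eq_integral_Ioo]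

theorem integral_expKappa_right (h : ExpTimeFamily J l q E L c C₀ p D)
    (hI : WeightOn I J l q E c C₀ w) (hα : α < c / 2) (f : ℝ[X]) {x : ℝ} (hx : x ∈ I) :
    IntegrableOn (fun y => w y * f.eval y * expKappa E α y x) I ∧
    ∫ y in I, w y * f.eval y * expKappa E α y x =
      E x ^ (-α) * ∫ t in J ∩ Ioi x, E t ^ α * wPoly E c C₀ f t / q.eval t := by
  have hxJ := (hI.subset hx).1
  have hlx : l ≤ x := (hI.subset hx).2
  rw [IntegrableOn, restrict_eq hI]
  have e : EqOn (fun y => w y * f.eval y * expKappa E α y x)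
      ((Ioi x).indicator fun y => E x ^ (-α) * (E y ^ α * wPoly E c C₀ f y / q.eval y))
      (J ∩ Ioi l) := by
    intro y hy
    simp only [expKappa, indicator, mem_Ioi]
    rw [h.weight_mul hI f hy.1, Real.div_rpow (h.E_pos y hy.1).le (h.E_pos x hxJ).le,
      Real.rpow_neg (h.E_pos x hxJ).le]
    split_ifs <;> ring
  have hset : Ioi x ∩ (J ∩ Ioi l) = J ∩ Ioi x := by
    ext y
    simp only [mem_inter_iff, mem_Ioi]
    exact ⟨fun hy => ⟨hy.2.1, hy.1⟩, fun hy => ⟨hy.2, hy.1, hlx.trans_lt hy.2⟩⟩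
  constructor
  · rw [← IntegrableOn, integrableOn_congr_fun e (h.measurableSet_tail l), IntegrableOn,
      integrable_indicator_iff measurableSet_Ioi, IntegrableOn,
      Measure.restrict_restrict measurableSet_Ioi, hset]
    exact (h.integrableOn_E_rpow_mul hα C₀ f hxJ).const_mul _
  · rw [setIntegral_congr_fun (h.measurableSet_tail l) e, integral_indicator measurableSet_Ioi,
      Measure.restrict_restrict measurableSet_Ioi, hset, integral_const_mul]

/-- The part `y < x` is the forward integral. The part `y > x` is a tail integral, equal to `-(D +
α)⁻¹` applied to the weighted polynomials, and it enters with a minus sign. -/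
theorem integral_expEps (h : ExpTimeFamily J l q E L c C₀ p D)
    (hI : WeightOn I J l q E c C₀ w) (hα : α < c / 2) (j : Fin N) {x : ℝ} (hx : x ∈ I) :
    IntegrableOn (fun y => w y * (p j).eval y * expEps E α x y) I ∧
    ∫ y in I, w y * (p j).eval y * expEps E α x y = epsVec l q E α c C₀ p D x j := by
  have h1 := h.integral_expKappa_left (α := α) hI (p j) hx
  have h2 := h.integral_expKappa_right hI hα (p j) hx
  have hxJ := (hI.subset hx).1
  simp only [expEps, mul_sub]
  refine ⟨h1.1.sub h2.1, ?_⟩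
  rw [integral_sub h1.1 h2.1, h1.2, h2.2, h.integral_E_rpow_tail hα hxJ]
  have hE : E x ^ (-α) * E x ^ α = 1 := by
    rw [← Real.rpow_add (h.E_pos x hxJ), neg_add_cancel, Real.rpow_zero]
  simp only [epsVec, Pi.add_apply, forwardVec]
  linear_combination ((D + α • 1)⁻¹ *ᵥ wVec E c C₀ p x) j * hE

theorem epsDot_sum (h : ExpTimeFamily J l q E L c C₀ p D) (hI : WeightOn I J l q E c C₀ w)
    (hα : α < c / 2) {ε : ℝ → ℝ → ℝ} (hε : ∀ x ∈ I, ∀ y ∈ I, ε x y = expEps E α x y)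
    (a : Fin N → ℝ) {x : ℝ} (hx : x ∈ I) :
    epsDot I w ε (∑ k, Polynomial.C (a k) * p k) x = a ⬝ᵥ epsVec l q E α c C₀ p D x := by
  have e : EqOn (fun y => w y * ε x y * (∑ k, Polynomial.C (a k) * p k).eval y)
      (fun y => ∑ k, a k * (w y * (p k).eval y * expEps E α x y)) I := by
    intro y hy
    simp only [Polynomial.eval_finsetSum, Polynomial.eval_mul, Polynomial.eval_C, Finset.mul_sum,
      hε x hx y hy]
    exact Finset.sum_congr rfl fun k _ => by ring
  rw [epsDot, setIntegral_congr_fun hI.measurableSet e,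
    integral_finsetSum _ fun k _ => (h.integral_expEps hI hα k hx).1.const_mul (a k)]
  simp only [integral_const_mul, (h.integral_expEps hI hα _ hx).2, dotProduct]

theorem forwardInt_sum (h : ExpTimeFamily J l q E L c C₀ p D) (a : Fin N → ℝ) {x : ℝ}
    (hx : x ∈ J) : forwardInt l q E α (wPoly E c C₀ (∑ k, Polynomial.C (a k) * p k)) x =
      ∑ k, a k * forwardVec l q E α c C₀ p x k := by
  have : wPoly E c C₀ (∑ k, Polynomial.C (a k) * p k) =
      fun t => ∑ k, a k * wPoly E c C₀ (p k) t := by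
    ext t
    simp only [wPoly, Polynomial.eval_finsetSum, Polynomial.eval_mul, Polynomial.eval_C,
      Finset.mul_sum]
    exact Finset.sum_congr rfl fun k _ => by ring
  rw [this, h.forwardInt_finset_sum α a (fun k => h.continuousOn_wPoly c C₀ (p k)) hx]
  rfl

/-- The inner integral is a forward integral, so the outer one is given by
`integral_mul_forwardVec`, antisymmetrized. -/
theorem skewProduct_sum (h : ExpTimeFamily J l q E L c C₀ p D) (hI : WeightOn I J l q E c C₀ w)
    (hα : α < c / 2) {κ : ℝ → ℝ → ℝ} (hκ : ∀ x ∈ I, ∀ y ∈ I, κ x y = expKappa E α x y)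
    (a b : Fin N → ℝ) :
    (∫ x in I, w x * ∫ y in I, w y *
      ((∑ k, Polynomial.C (a k) * p k).eval x * (∑ k, Polynomial.C (b k) * p k).eval y -
        (∑ k, Polynomial.C (b k) * p k).eval x * (∑ k, Polynomial.C (a k) * p k).eval y) *
          κ x y) = a ⬝ᵥ skewGram D α *ᵥ b := by
  set f := ∑ k, Polynomial.C (a k) * p k with hf
  set g := ∑ k, Polynomial.C (b k) * p k with hg
  have hinner : ∀ x ∈ I, ∫ y in I, w y * (f.eval x * g.eval y - g.eval x * f.eval y) * κ x y =
      f.eval x * forwardInt l q E α (wPoly E c C₀ g) x -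
        g.eval x * forwardInt l q E α (wPoly E c C₀ f) x := by
    intro x hx
    have h1 := h.integral_expKappa_left (α := α) hI f hx
    have h2 := h.integral_expKappa_left (α := α) hI g hx
    have e : EqOn (fun y => w y * (f.eval x * g.eval y - g.eval x * f.eval y) * κ x y)
        (fun y => f.eval x * (w y * g.eval y * expKappa E α x y) -
          g.eval x * (w y * f.eval y * expKappa E α x y)) I := by
      intro y hy
      simp only [hκ x hx y hy]
      ring
    rw [setIntegral_congr_fun hI.measurableSet e,
      integral_sub (h2.1.const_mul _) (h1.1.const_mul _), integral_const_mul, integral_const_mul,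
      h1.2, h2.2]
  have hev : ∀ (a : Fin N → ℝ) (x : ℝ), x ∈ J → w x * (∑ k, Polynomial.C (a k) * p k).eval x =
      ∑ j, a j * (wPoly E c C₀ (p j) x / q.eval x) := by
    intro a x hx
    simp only [Polynomial.eval_finsetSum, Polynomial.eval_mul, Polynomial.eval_C, Finset.mul_sum]
    refine Finset.sum_congr rfl fun k _ => ?_
    rw [← h.weight_mul hI (p k) hx]
    ring
  have houter : EqOn (fun x => w x * ∫ y in I,
      w y * (f.eval x * g.eval y - g.eval x * f.eval y) * κ x y)
      (fun x => ∑ j, ∑ k, (a j * b k - b j * a k) *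
        (wPoly E c C₀ (p j) x * forwardVec l q E α c C₀ p x k / q.eval x)) I := by
    intro x hx
    have hxJ := (hI.subset hx).1
    simp only
    rw [hinner x hx, mul_sub, ← mul_assoc, ← mul_assoc, hf, hg, hev a x hxJ, hev b x hxJ,
      h.forwardInt_sum a hxJ, h.forwardInt_sum b hxJ, Finset.sum_mul_sum, Finset.sum_mul_sum,
      ← Finset.sum_sub_distrib]
    refine Finset.sum_congr rfl fun j _ => ?_
    rw [← Finset.sum_sub_distrib]
    exact Finset.sum_congr rfl fun k _ => by ring
  have hint : ∀ j k, Integrable (fun x => (a j * b k - b j * a k) *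
      (wPoly E c C₀ (p j) x * forwardVec l q E α c C₀ p x k / q.eval x))
      (volume.restrict I) := by
    intro j k
    rw [restrict_eq hI]
    exact (h.integrableOn_mul_forwardVec hα j k).const_mul _
  rw [setIntegral_congr_fun hI.measurableSet houter,
    integral_finsetSum _ fun j _ => integrable_finsetSum _ fun k _ => hint j k]
  simp_rw [integral_finsetSum _ fun k _ => hint _ k, integral_const_mul, restrict_eq hI,
    h.integral_mul_forwardVec hα]
  simp only [skewGram, sub_mulVec, dotProduct_sub]
  simp only [dotProduct, mulVec, Finset.mul_sum, transpose_apply]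
  rw [Finset.sum_comm (f := fun x i => a x * ((D + α • 1)⁻¹ i x * b i)),
    ← Finset.sum_sub_distrib]
  refine Finset.sum_congr rfl fun j _ => ?_
  rw [← Finset.sum_sub_distrib]
  exact Finset.sum_congr rfl fun k _ => by ring

theorem skewMatrix_eq (h : ExpTimeFamily J l q E L c C₀ p D) (hI : WeightOn I J l q E c C₀ w)
    (hα : α < c / 2) {κ : ℝ → ℝ → ℝ} (hκ : ∀ x ∈ I, ∀ y ∈ I, κ x y = expKappa E α x y)
    {R : Fin N → ℝ[X]} {T : Matrix (Fin N) (Fin N) ℝ}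
    (hR : ∀ j, R j = ∑ k, Polynomial.C (T j k) * p k) :
    skewMatrix I w κ R = T * skewGram D α * Tᵀ := by
  ext j k
  rw [skewMatrix, Matrix.of_apply, hR j, hR k, h.skewProduct_sum hI hα hκ (T j) (T k),
    dotProduct_mulVec, Matrix.mul_apply]
  rfl

theorem isUnit_skewMatrix (h : ExpTimeFamily J l q E L c C₀ p D) (hI : WeightOn I J l q E c C₀ w)
    (hN : Even N) (hα : α < c / 2) {κ : ℝ → ℝ → ℝ}
    (hκ : ∀ x ∈ I, ∀ y ∈ I, κ x y = expKappa E α x y)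
    {R : Fin N → ℝ[X]} {T : Matrix (Fin N) (Fin N) ℝ} (hT : IsUnit T)
    (hR : ∀ j, R j = ∑ k, Polynomial.C (T j k) * p k) : IsUnit (skewMatrix I w κ R) := by
  rw [h.skewMatrix_eq hI hα hκ hR]
  exact (hT.mul (isUnit_skewGram hN h.isUnit_det h.add_transpose (h.isUnit_det_add hα))).mul
    ((Matrix.isUnit_transpose _).2 hT)

/-- A change of polynomials `T` acts on the matrix of skew products by congruence, and its inverse
cancels the two factors `T` on the vectors. -/
theorem sum_mul_congr_inv (G T : Matrix (Fin N) (Fin N) ℝ) (hT : IsUnit T) (a b : Fin N → ℝ) :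
    ∑ j, ∑ k, (T *ᵥ a) j * (((T * G * Tᵀ)⁻¹)ᵀ) j k * (T *ᵥ b) k = a ⬝ᵥ (G⁻¹)ᵀ *ᵥ b := by
  have hTd := (Matrix.isUnit_iff_isUnit_det _).1 hT
  have hTt : IsUnit (Tᵀ).det := by rwa [det_transpose]
  have e : Tᵀ * (((T * G * Tᵀ)⁻¹)ᵀ * T) = (G⁻¹)ᵀ := by
    rw [Matrix.mul_inv_rev, Matrix.mul_inv_rev, transpose_mul, transpose_mul,
      transpose_nonsing_inv T, transpose_nonsing_inv (Tᵀ), transpose_transpose, Matrix.mul_assoc,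
      Matrix.mul_assoc, nonsing_inv_mul _ hTd, Matrix.mul_one, ← Matrix.mul_assoc,
      mul_nonsing_inv _ hTt, Matrix.one_mul]
  rw [← e, ← mulVec_mulVec, ← mulVec_mulVec, dotProduct_mulVec, vecMul_transpose]
  simp only [dotProduct, mulVec, Finset.mul_sum, mul_assoc]

/-- The quaternion kernel does not depend on the choice of the polynomials. -/
theorem quatKernel_eq (h : ExpTimeFamily J l q E L c C₀ p D) (hI : WeightOn I J l q E c C₀ w)
    (hα : α < c / 2) {κ ε : ℝ → ℝ → ℝ}
    (hκ : ∀ x ∈ I, ∀ y ∈ I, κ x y = expKappa E α x y)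
    (hε : ∀ x ∈ I, ∀ y ∈ I, ε x y = expEps E α x y)
    {R : Fin N → ℝ[X]} {T : Matrix (Fin N) (Fin N) ℝ} (hT : IsUnit T)
    (hR : ∀ j, R j = ∑ k, Polynomial.C (T j k) * p k) {x y : ℝ} (hx : x ∈ I) (hy : y ∈ I) :
    quatKernel I w ε κ R x y =
      !![(wVec E c C₀ p x ⬝ᵥ ((skewGram D α)⁻¹)ᵀ *ᵥ epsVec l q E α c C₀ p D y) / q.eval x,
        -((wVec E c C₀ p x ⬝ᵥ ((skewGram D α)⁻¹)ᵀ *ᵥ wVec E c C₀ p y) / (q.eval x * q.eval y));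
        -expEps E α x y +
          epsVec l q E α c C₀ p D x ⬝ᵥ ((skewGram D α)⁻¹)ᵀ *ᵥ epsVec l q E α c C₀ p D y,
        -((epsVec l q E α c C₀ p D x ⬝ᵥ ((skewGram D α)⁻¹)ᵀ *ᵥ wVec E c C₀ p y) / q.eval y)] := by
  have hw : ∀ z ∈ I, ∀ j, w z * (R j).eval z = (T *ᵥ wVec E c C₀ p z) j / q.eval z := by
    intro z hz j
    rw [hR j]
    simp only [Polynomial.eval_finsetSum, Polynomial.eval_mul, Polynomial.eval_C, Finset.mul_sum,
      mulVec, dotProduct, Finset.sum_div]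
    refine Finset.sum_congr rfl fun k _ => ?_
    have := h.weight_mul hI (p k) (hI.subset hz).1
    rw [wVec, mul_div_assoc, ← this]
    ring
  have hd : ∀ z ∈ I, ∀ j, epsDot I w ε (R j) z = (T *ᵥ epsVec l q E α c C₀ p D z) j := by
    intro z hz j
    rw [hR j, h.epsDot_sum hI hα hε (T j) hz]
    rfl
  have hdiv1 : ∀ (F G : Fin N → ℝ) (M : Matrix (Fin N) (Fin N) ℝ) (r s : ℝ),
      ∑ j, ∑ k, F j / r * M j k * (G k / s) = (∑ j, ∑ k, F j * M j k * G k) / (r * s) := by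
    intro F G M r s
    simp only [Finset.sum_div]
    refine Finset.sum_congr rfl fun j _ => Finset.sum_congr rfl fun k _ => ?_
    rw [mul_comm r s, div_mul_eq_mul_div, div_mul_div_comm, mul_comm s r]
  have s11 := hdiv1 (T *ᵥ wVec E c C₀ p x) (T *ᵥ epsVec l q E α c C₀ p D y)
    (((T * skewGram D α * Tᵀ)⁻¹)ᵀ) (q.eval x) 1
  have s12 := hdiv1 (T *ᵥ wVec E c C₀ p x) (T *ᵥ wVec E c C₀ p y)
    (((T * skewGram D α * Tᵀ)⁻¹)ᵀ) (q.eval x) (q.eval y)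
  have s22 := hdiv1 (T *ᵥ epsVec l q E α c C₀ p D x) (T *ᵥ wVec E c C₀ p y)
    (((T * skewGram D α * Tᵀ)⁻¹)ᵀ) 1 (q.eval y)
  rw [sum_mul_congr_inv _ _ hT] at s11 s12 s22
  simp only [div_one, mul_one, one_mul] at s11 s22
  simp only [quatKernel, h.skewMatrix_eq hI hα hκ hR, hd x hx, hd y hy, hw x hx, hw y hy, s11, s12,
    s22, sum_mul_congr_inv _ _ hT, hε x hx y hy]

/-- By independence of the choice, the kernel can be computed with the family `p` itself, for which
`T = 1`. The indicator of `J` makes the transforms measurable on the whole line and changes nothing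
on `I`. -/
theorem quatKernel_eq_pfKernel (h : ExpTimeFamily J l q E L c C₀ p D)
    (hI : WeightOn I J l q E c C₀ w) (hα : α < c / 2) {κ ε : ℝ → ℝ → ℝ}
    (hκ : ∀ x ∈ I, ∀ y ∈ I, κ x y = expKappa E α x y)
    (hε : ∀ x ∈ I, ∀ y ∈ I, ε x y = expEps E α x y)
    {R : Fin N → ℝ[X]} {T : Matrix (Fin N) (Fin N) ℝ} (hT : IsUnit T)
    (hR : ∀ j, R j = ∑ k, Polynomial.C (T j k) * p k) {x y : ℝ} (hx : x ∈ I) (hy : y ∈ I) :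
    quatKernel I w ε κ R x y = pfKernel (fun j x => w x * (p j).eval x)
      (fun j => J.indicator fun x => epsVec l q E α c C₀ p D x j) (expEps E α)
      ((skewGram D α)⁻¹)ᵀ x y := by
  have hp : ∀ j, p j = ∑ k, Polynomial.C ((1 : Matrix (Fin N) (Fin N) ℝ) j k) * p k := by
    intro j
    simp [Matrix.one_apply]
  have hsm : skewMatrix I w κ p = skewGram D α := by
    rw [h.skewMatrix_eq hI hα hκ hp]
    simp
  have hd : ∀ z ∈ I, ∀ j, epsDot I w ε (p j) z = epsVec l q E α c C₀ p D z j := by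
    intro z hz j
    rw [hp j, h.epsDot_sum hI hα hε _ hz]
    simp [dotProduct, Matrix.one_apply]
  rw [h.quatKernel_eq hI hα hκ hε hT hR hx hy, ← h.quatKernel_eq hI hα hκ hε isUnit_one hp hx hy]
  simp only [quatKernel, pfKernel, hsm, hd x hx, hd y hy, hε x hx y hy,
    indicator_of_mem (hI.subset hx).1, indicator_of_mem (hI.subset hy).1]

theorem abs_expEps_le (h : ExpTimeFamily J l q E L c C₀ p D) (hI : WeightOn I J l q E c C₀ w)
    {x y : ℝ} (hx : x ∈ I) (hy : y ∈ I) :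
    |expEps E α x y| ≤ E x ^ (max α 0) * E y ^ (max α 0) := by
  have key : ∀ x ∈ I, ∀ y ∈ I, y < x → |(E x / E y) ^ α| ≤ E x ^ (max α 0) * E y ^ (max α 0) := by
    intro x hx y hy hyx
    have hxJ := hI.subset hx
    have hyJ := hI.subset hy
    rw [abs_of_nonneg (Real.rpow_nonneg (div_nonneg (h.E_pos x hxJ.1).le (h.E_pos y hyJ.1).le) _)]
    refine (h.ratio_rpow_le α hxJ.1 hyJ.1 hyJ.2 hyx.le).trans ?_
    exact le_mul_of_one_le_right (Real.rpow_nonneg (h.E_pos x hxJ.1).le _)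
      (Real.one_le_rpow (h.one_le_E hyJ.1 hyJ.2) (le_max_right _ _))
  rcases lt_trichotomy x y with hxy | hxy | hxy
  · rw [expEps, expKappa, expKappa, if_neg hxy.not_gt, if_pos hxy, zero_sub, abs_neg, mul_comm]
    exact key y hy x hx hxy
  · subst hxy
    rw [expEps, sub_self, abs_zero]
    have := (Real.rpow_nonneg (h.E_pos x (hI.subset hx).1).le (max α 0))
    positivity
  · rw [expEps, expKappa, expKappa, if_pos hxy, if_neg hxy.not_gt, sub_zero]
    exact key x hx y hy hxy

/-- The bounds are `b = ∑ |w p_j|` and a multiple of `E^(max α 0)` for `m`; their product is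
integrable because `max α 0 < c / 2`. -/
theorem skewSystem (h : ExpTimeFamily J l q E L c C₀ p D) (hI : WeightOn I J l q E c C₀ w)
    (hN : Even N) (hα : α < c / 2) : ∃ b m : ℝ → ℝ,
    SkewSystem I (fun j x => w x * (p j).eval x)
      (fun j => J.indicator fun x => epsVec l q E α c C₀ p D x j) (expEps E α)
      ((skewGram D α)⁻¹)ᵀ b m := by
  have hint : ∀ j, IntegrableOn (fun y => |w y * (p j).eval y| * |E y| ^ (max α 0)) I := by
    intro j
    rw [IntegrableOn, restrict_eq hI, ← IntegrableOn]
    refine IntegrableOn.congr_fun (h.integrableOn_E_rpow_mul (h.max_lt_half hα) C₀ (p j)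
      h.l_mem).abs (fun t ht => ?_) (h.measurableSet_tail l)
    rw [h.weight_mul hI (p j) ht.1, abs_of_pos (h.E_pos t ht.1), mul_div_assoc, abs_mul,
      abs_of_pos (Real.rpow_pos_of_pos (h.E_pos t ht.1) _), mul_comm]
  -- The sum dominates every `ε`-transform; the summand `1` ensures `1 ≤ B * B`, so that the same
  -- `m` also bounds `ε`.
  set B : ℝ := 1 + ∑ j, ∫ y in I, |w y * (p j).eval y| * |E y| ^ (max α 0) with hB
  have hBj : ∀ j, 0 ≤ ∫ y in I, |w y * (p j).eval y| * |E y| ^ (max α 0) := fun j =>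
    integral_nonneg fun y => by positivity
  have hB1 : 1 ≤ B := le_add_of_nonneg_right (Finset.sum_nonneg fun j _ => hBj j)
  refine ⟨fun x => ∑ j, |w x * (p j).eval x|, fun x => |E x| ^ (max α 0) * B, ?_⟩
  have hεb : ∀ x ∈ I, ∀ y ∈ I, |expEps E α x y| ≤ |E x| ^ (max α 0) * |E y| ^ (max α 0) := by
    intro x hx y hy
    rw [abs_of_pos (h.E_pos x (hI.subset hx).1), abs_of_pos (h.E_pos y (hI.subset hy).1)]
    exact h.abs_expEps_le hI hx hy
  have hψ : ∀ j, ∀ x ∈ I, (J.indicator fun x => epsVec l q E α c C₀ p D x j) x =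
      ∫ y in I, w y * (p j).eval y * expEps E α x y := by
    intro j x hx
    rw [indicator_of_mem (hI.subset hx).1, (h.integral_expEps hI hα j hx).2]
  refine
    { measurableSet := hI.measurableSet
      eps_antisymm := expEps_antisymm E α
      mat_antisymm := ?_
      measurable_φ := fun j => hI.measurable_w.mul (p j).continuous.measurable
      measurable_ψ := ?_
      measurable_ε := measurable_expEps hI.measurable_E α
      b_nonneg := fun x => Finset.sum_nonneg fun j _ => abs_nonneg _
      m_nonneg := fun x => by positivity
      φ_bound := fun j x _ => Finset.single_le_sum (f := fun j => |w x * (p j).eval x|)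
        (fun j _ => abs_nonneg _) (Finset.mem_univ j)
      ψ_bound := ?_
      ε_bound := ?_
      integrable_bm := ?_
      integral_φ_ε := ?_
      integral_φ_ψ := ?_ }
  · intro j k
    have h1 : (((skewGram D α)⁻¹)ᵀ)ᵀ = -((skewGram D α)⁻¹)ᵀ := by
      rw [skewGram_inv_transpose hN h.isUnit_det h.add_transpose (h.isUnit_det_add hα)]
      simp [skewInv_transpose, Matrix.mul_assoc]
    have := congrFun (congrFun h1 k) j
    simpa using this
  · intro j
    have hc : ContinuousOn (fun x => epsVec l q E α c C₀ p D x j) J := by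
      simp only [epsVec, Pi.add_apply]
      refine (h.continuousOn_forwardVec α j).add ?_
      simp only [mulVec, dotProduct, wVec]
      exact continuousOn_finsetSum _ fun k _ =>
        continuousOn_const.mul (h.continuousOn_wPoly c C₀ (p k))
    classical
    have := hc.measurable_piecewise (g := 0) continuousOn_const h.isOpen.measurableSet
    rwa [piecewise_eq_indicator] at this
  · intro j x hx
    rw [hψ j x hx]
    refine abs_integral_le_integral_abs.trans ?_
    have h1 : ∫ y in I, |w y * (p j).eval y * expEps E α x y| ≤
        ∫ y in I, |E x| ^ (max α 0) * (|w y * (p j).eval y| * |E y| ^ (max α 0)) := by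
      refine integral_mono_of_nonneg (.of_forall fun y => abs_nonneg _)
        ((hint j).const_mul _) ?_
      refine (ae_restrict_iff' hI.measurableSet).2 (.of_forall fun y hy => ?_)
      simp only
      rw [abs_mul]
      have := mul_le_mul_of_nonneg_left (hεb x hx y hy) (abs_nonneg (w y * (p j).eval y))
      linarith
    refine h1.trans ?_
    rw [integral_const_mul]
    refine mul_le_mul_of_nonneg_left ?_ (by positivity)
    have := Finset.single_le_sum (f := fun j => ∫ y in I, |w y * (p j).eval y| *
      |E y| ^ (max α 0)) (fun j _ => hBj j) (Finset.mem_univ j)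
    linarith
  · intro x hx y hy
    refine (hεb x hx y hy).trans ?_
    have : 0 ≤ |E x| ^ (max α 0) * |E y| ^ (max α 0) := by positivity
    nlinarith [mul_le_mul hB1 hB1 zero_le_one (zero_le_one.trans hB1)]
  · simp only [Finset.sum_mul]
    refine integrable_finsetSum _ fun j _ => ?_
    refine ((hint j).mul_const B).congr (.of_forall fun x => ?_)
    simp only
    ring
  · intro j y hy
    rw [hψ j y hy, ← integral_neg]
    refine integral_congr_ae (.of_forall fun x => ?_)
    simp only
    rw [expEps_antisymm E α x y]
    ring
  · intro j m
    -- The forward part of the transform contributes `-(D + α)⁻¹` and the tail part, by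
    -- orthonormality, its transpose.
    have hG : ∀ k, ∫ x in I, w x * (p j).eval x *
        (J.indicator fun x => epsVec l q E α c C₀ p D x k) x = skewGram D α j k := by
      intro k
      have e : EqOn (fun x => w x * (p j).eval x *
          (J.indicator fun x => epsVec l q E α c C₀ p D x k) x)
          (fun x => wPoly E c C₀ (p j) x * forwardVec l q E α c C₀ p x k / q.eval x +
            (∑ i, (D + α • 1)⁻¹ k i * wPoly E c C₀ (p i) x) * wPoly E c C₀ (p j) x / q.eval x)
          (J ∩ Ioi l) := by
        intro x hx
        simp only
        rw [indicator_of_mem hx.1, h.weight_mul hI (p j) hx.1]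
        simp only [epsVec, Pi.add_apply, mulVec, dotProduct, wVec]
        ring
      rw [restrict_eq hI, setIntegral_congr_fun (h.measurableSet_tail l) e,
        integral_add (h.integrableOn_mul_forwardVec hα j k) (h.integrableOn_sum_mul _ j),
        h.integral_mul_forwardVec hα, h.integral_sum_mul, skewGram, Matrix.sub_apply,
        transpose_apply]
      ring
    simp only [hG]
    have hu := isUnit_skewGram hN h.isUnit_det h.add_transpose (h.isUnit_det_add hα)
    have hud := (Matrix.isUnit_iff_isUnit_det _).1 hu
    have h1 : skewGram D α * ((skewGram D α)⁻¹)ᵀ = -1 := by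
      have : skewGram D α = -(skewGram D α)ᵀ := by rw [skewGram_transpose, neg_neg]
      conv_lhs => enter [1]; rw [this]
      rw [Matrix.neg_mul, ← transpose_mul, nonsing_inv_mul _ hud, transpose_one]
    rw [← Matrix.mul_apply, h1, Matrix.neg_apply, Matrix.one_apply]
    split_ifs <;> simp

end ExpTimeFamily

end ExpTimeKernel

/-! ### The kernel entries in terms of the Christoffel-Darboux kernel -/

section ClosedForms

open Matrix Set Filter Topology

variable (J : Set ℝ) (l : ℝ) (q : ℝ[X]) (E : ℝ → ℝ) (α : ℝ) (K : ℝ → ℝ → ℝ)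

/-- The operator `α / q + d/dx`. -/
def timeOp (g : ℝ → ℝ) (x : ℝ) : ℝ := α / q.eval x * g x + deriv g x

/-- The diagonal entry of the kernel in terms of the Christoffel-Darboux kernel `K`. -/
def closedDiag (x y : ℝ) : ℝ :=
  1 / 2 * q.eval x * K x y
    - 1 / 2 * (q.eval y * deriv (fun y' => ∫ t in l..x, (E x / E t) ^ α * K t y') y
        + q.derivative.eval y * ∫ t in l..x, (E x / E t) ^ α * K t y)
    - α / (2 * q.eval y) * (∫ t in l..x, (E x / E t) ^ α *
        ∫ u in J ∩ Ioi y, (q.eval t * deriv (fun t' => K u t') t + q.derivative.eval t * K u t))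
    + α / 2 * E x ^ α * ∫ u in J ∩ Ioi l, K y u

/-- The upper entry of the kernel in terms of the Christoffel-Darboux kernel `K`. -/
def closedUpper (x y : ℝ) : ℝ :=
  1 / 4 * timeOp q α (fun x' => timeOp q α (fun y' =>
    q.eval y' * (∫ t in J ∩ Ioi x', K y' t) - q.eval x' * ∫ t in J ∩ Ioi y', K x' t) y) x

/-- The lower entry of the kernel in terms of the Christoffel-Darboux kernel `K`. -/
def closedLower (x y : ℝ) : ℝ :=
  -expEps E α x y
    - (q.eval x * (∫ t in l..y, (E y / E t) ^ α * K x t)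
      - q.eval y * ∫ t in l..x, (E x / E t) ^ α * K y t)

variable {J l q E α K} {I : Set ℝ} {L : Filter ℝ} {c C₀ : ℝ} {N : ℕ}
  {p : Fin N → ℝ[X]} {D : Matrix (Fin N) (Fin N) ℝ} {w : ℝ → ℝ}

namespace ExpTimeFamily

theorem hasDerivAt_dotProduct_wVec (h : ExpTimeFamily J l q E L c C₀ p D) (z : Fin N → ℝ) {x : ℝ}
    (hx : x ∈ J) : HasDerivAt (fun x => z ⬝ᵥ wVec E c C₀ p x)
      ((z ⬝ᵥ D *ᵥ wVec E c C₀ p x) / q.eval x) x := by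
  have h1 := HasDerivAt.fun_sum (u := Finset.univ) fun j _ =>
    (h.hasDerivAt_wVec j hx).const_mul (z j)
  refine h1.congr_deriv ?_
  rw [dotProduct, Finset.sum_div]
  exact Finset.sum_congr rfl fun j _ => by ring

theorem timeOp_dotProduct (h : ExpTimeFamily J l q E L c C₀ p D) (z : Fin N → ℝ) {g : ℝ → ℝ}
    (hg : ∀ x ∈ J, g x = z ⬝ᵥ wVec E c C₀ p x) {x : ℝ} (hx : x ∈ J) :
    timeOp q α g x = (z ⬝ᵥ (D + α • 1) *ᵥ wVec E c C₀ p x) / q.eval x := by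
  have h1 : HasDerivAt g ((z ⬝ᵥ D *ᵥ wVec E c C₀ p x) / q.eval x) x := by
    refine (h.hasDerivAt_dotProduct_wVec z hx).congr_of_eventuallyEq ?_
    filter_upwards [h.isOpen.mem_nhds hx] with y hy using hg y hy
  rw [timeOp, h1.deriv, hg x hx, add_mulVec, smul_mulVec, one_mulVec, dotProduct_add,
    dotProduct_smul, smul_eq_mul]
  ring

theorem integral_dotProduct_tail (h : ExpTimeFamily J l q E L c C₀ p D) (z : Fin N → ℝ) {x : ℝ}
    (hx : x ∈ J) : ∫ t in J ∩ Ioi x, (z ⬝ᵥ wVec E c C₀ p t) / q.eval t =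
      -(z ⬝ᵥ D⁻¹ *ᵥ wVec E c C₀ p x) := by
  have e : ∀ t, (z ⬝ᵥ wVec E c C₀ p t) / q.eval t =
      ∑ j, z j * (wPoly E c C₀ (p j) t / q.eval t) := by
    intro t
    rw [dotProduct, Finset.sum_div]
    exact Finset.sum_congr rfl fun j _ => by rw [wVec]; ring
  simp only [e]
  rw [integral_finsetSum _ fun j _ => (h.integrableOn_wPoly h.c_pos C₀ (p j) hx).const_mul (z j)]
  simp only [integral_const_mul, h.integral_tail hx, dotProduct, mul_neg, Finset.sum_neg_distrib]

theorem integral_dotProduct_forward (h : ExpTimeFamily J l q E L c C₀ p D) (z : Fin N → ℝ) {x : ℝ}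
    (hx : x ∈ J) : ∫ t in l..x, (E x / E t) ^ α * ((z ⬝ᵥ wVec E c C₀ p t) / q.eval t) =
      z ⬝ᵥ forwardVec l q E α c C₀ p x :=
  h.forwardInt_finset_sum α z (fun k => h.continuousOn_wPoly c C₀ (p k)) hx

/-- `(q d/dy + q') (g / q) = D g / q` for combinations `g` of the weighted polynomials. -/
theorem mul_deriv_add (h : ExpTimeFamily J l q E L c C₀ p D) (z : Fin N → ℝ) {g : ℝ → ℝ} (r : ℝ)
    (hg : ∀ y ∈ J, g y = (z ⬝ᵥ wVec E c C₀ p y) / (r * q.eval y)) {y : ℝ} (hy : y ∈ J) :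
    q.eval y * deriv g y + q.derivative.eval y * g y =
      (z ⬝ᵥ D *ᵥ wVec E c C₀ p y) / (r * q.eval y) := by
  have hq := (h.q_pos y hy).ne'
  by_cases hr : r = 0
  · have h0 : HasDerivAt g 0 y := by
      refine (hasDerivAt_const y (0 : ℝ)).congr_of_eventuallyEq ?_
      filter_upwards [h.isOpen.mem_nhds hy] with t ht
      rw [hg t ht, hr]
      simp
    rw [h0.deriv, hg y hy, hr]
    simp
  have h1 : HasDerivAt g (((z ⬝ᵥ D *ᵥ wVec E c C₀ p y) / q.eval y * (r * q.eval y) -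
      (z ⬝ᵥ wVec E c C₀ p y) * (r * q.derivative.eval y)) / (r * q.eval y) ^ 2) y := by
    refine ((h.hasDerivAt_dotProduct_wVec z hy).div ((q.hasDerivAt y).const_mul r)
      (mul_ne_zero hr hq)).congr_of_eventuallyEq ?_
    filter_upwards [h.isOpen.mem_nhds hy] with t ht using hg t ht
  rw [h1.deriv, hg y hy]
  field_simp
  ring

theorem integral_kernel_forward
    (hK : ∀ x ∈ J, ∀ y ∈ J,
      K x y = (wVec E c C₀ p x ⬝ᵥ wVec E c C₀ p y) / (q.eval x * q.eval y))
    (h : ExpTimeFamily J l q E L c C₀ p D) {x y : ℝ} (hx : x ∈ J)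
    (hy : y ∈ J) : ∫ t in l..x, (E x / E t) ^ α * K t y =
      (forwardVec l q E α c C₀ p x ⬝ᵥ wVec E c C₀ p y) / q.eval y := by
  rw [dotProduct_comm, ← h.integral_dotProduct_forward (wVec E c C₀ p y) hx,
    ← intervalIntegral.integral_div]
  refine intervalIntegral.integral_congr fun t ht => ?_
  rw [hK t (h.uIcc_subset hx ht) y hy, dotProduct_comm, mul_div_assoc, div_div]

theorem kernel_comm
    (hK : ∀ x ∈ J, ∀ y ∈ J,
      K x y = (wVec E c C₀ p x ⬝ᵥ wVec E c C₀ p y) / (q.eval x * q.eval y))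
    {x y : ℝ} (hx : x ∈ J) (hy : y ∈ J) : K x y = K y x := by
  rw [hK x hx y hy, hK y hy x hx, dotProduct_comm, mul_comm (q.eval x)]

theorem integral_kernel_forward'
    (hK : ∀ x ∈ J, ∀ y ∈ J,
      K x y = (wVec E c C₀ p x ⬝ᵥ wVec E c C₀ p y) / (q.eval x * q.eval y))
    (h : ExpTimeFamily J l q E L c C₀ p D) {x y : ℝ} (hx : x ∈ J)
    (hy : y ∈ J) : ∫ t in l..x, (E x / E t) ^ α * K y t =
      (forwardVec l q E α c C₀ p x ⬝ᵥ wVec E c C₀ p y) / q.eval y := by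
  rw [← h.integral_kernel_forward hK hx hy]
  refine intervalIntegral.integral_congr fun t ht => ?_
  rw [kernel_comm hK hy (h.uIcc_subset hx ht)]

theorem integral_kernel_tail
    (hK : ∀ x ∈ J, ∀ y ∈ J,
      K x y = (wVec E c C₀ p x ⬝ᵥ wVec E c C₀ p y) / (q.eval x * q.eval y))
    (h : ExpTimeFamily J l q E L c C₀ p D) {x y : ℝ} (hx : x ∈ J)
    (hy : y ∈ J) : ∫ t in J ∩ Ioi x, K y t =
      -(wVec E c C₀ p y ⬝ᵥ D⁻¹ *ᵥ wVec E c C₀ p x) / q.eval y := by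
  rw [← h.integral_dotProduct_tail _ hx, ← integral_div]
  refine setIntegral_congr_fun (h.measurableSet_tail x) fun t ht => ?_
  rw [hK y hy t ht.1, div_div, mul_comm]

/-- Each term is translated into vectors: `q d/dy + q'` becomes `D` because `K` carries a factor `1
/ q` in each variable, tail integrals become `-D⁻¹`, and integrals from `l` become forward vectors.
The result is the right side of `dotProduct_kernel_offdiag`. -/
theorem closedDiag_eq
    (hK : ∀ x ∈ J, ∀ y ∈ J,
      K x y = (wVec E c C₀ p x ⬝ᵥ wVec E c C₀ p y) / (q.eval x * q.eval y))
    (h : ExpTimeFamily J l q E L c C₀ p D) (hN : Even N) (hα : α < c / 2)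
    {x y : ℝ} (hx : x ∈ J) (hy : y ∈ J) :
    closedDiag J l q E α K x y =
      -((epsVec l q E α c C₀ p D x ⬝ᵥ ((skewGram D α)⁻¹)ᵀ *ᵥ wVec E c C₀ p y) / q.eval y) := by
  have hqx := (h.q_pos x hx).ne'
  have hqy := (h.q_pos y hy).ne'
  have e1 := h.mul_deriv_add (forwardVec l q E α c C₀ p x)
    (g := fun y' => ∫ t in l..x, (E x / E t) ^ α * K t y') 1
    (fun y' hy' => by rw [h.integral_kernel_forward hK hx hy', one_mul]) hy
  rw [one_mul] at e1
  have e2 : ∫ t in l..x, (E x / E t) ^ α * ∫ u in J ∩ Ioi y,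
      (q.eval t * deriv (fun t' => K u t') t + q.derivative.eval t * K u t) =
      -((D⁻¹ *ᵥ wVec E c C₀ p y) ⬝ᵥ D *ᵥ forwardVec l q E α c C₀ p x) := by
    have e3 : ∀ t ∈ J, ∫ u in J ∩ Ioi y,
        (q.eval t * deriv (fun t' => K u t') t + q.derivative.eval t * K u t) =
        -(((D⁻¹ *ᵥ wVec E c C₀ p y) ᵥ* D) ⬝ᵥ wVec E c C₀ p t) / q.eval t := by
      intro t ht
      have e4 : EqOn (fun u => q.eval t * deriv (fun t' => K u t') t + q.derivative.eval t * K u t)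
          (fun u => ((D *ᵥ wVec E c C₀ p t) ⬝ᵥ wVec E c C₀ p u) / q.eval u / q.eval t)
          (J ∩ Ioi y) := by
        intro u hu
        simp only
        rw [h.mul_deriv_add (wVec E c C₀ p u) (g := fun t' => K u t') (q.eval u)
          (fun t' ht' => hK u hu.1 t' ht') ht, div_div, dotProduct_comm]
      rw [setIntegral_congr_fun (h.measurableSet_tail y) e4, integral_div,
        h.integral_dotProduct_tail _ hy, ← dotProduct_mulVec, dotProduct_comm]
    have e5 : ∫ t in l..x, (E x / E t) ^ α * ∫ u in J ∩ Ioi y,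
        (q.eval t * deriv (fun t' => K u t') t + q.derivative.eval t * K u t) =
        ∫ t in l..x, (E x / E t) ^ α *
          ((-((D⁻¹ *ᵥ wVec E c C₀ p y) ᵥ* D) ⬝ᵥ wVec E c C₀ p t) / q.eval t) := by
      refine intervalIntegral.integral_congr fun t ht => ?_
      rw [e3 t (h.uIcc_subset hx ht), neg_dotProduct]
    rw [e5, h.integral_dotProduct_forward _ hx, neg_dotProduct, dotProduct_mulVec]
  have e6 := dotProduct_kernel_offdiag (fy := wVec E c C₀ p y) hN h.isUnit_det h.add_transpose
    (h.isUnit_det_add hα) (h.mulVec_forwardVec α hx)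
  rw [closedDiag, e1, e2, h.integral_kernel_tail hK h.l_mem hy, hK x hx y hy, epsVec,
    ← neg_div, e6]
  field_simp
  ring

/-- The difference of the two tail integrals is the bilinear form of `4 skewInv D`, and `timeOp`
applies `(D + α) / q` in each variable. -/
theorem closedUpper_eq
    (hK : ∀ x ∈ J, ∀ y ∈ J,
      K x y = (wVec E c C₀ p x ⬝ᵥ wVec E c C₀ p y) / (q.eval x * q.eval y))
    (h : ExpTimeFamily J l q E L c C₀ p D) (hN : Even N) (hα : α < c / 2)
    {x y : ℝ} (hx : x ∈ J) (hy : y ∈ J) :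
    closedUpper J q α K x y =
      -((wVec E c C₀ p x ⬝ᵥ ((skewGram D α)⁻¹)ᵀ *ᵥ wVec E c C₀ p y) /
        (q.eval x * q.eval y)) := by
  have e0 : ∀ x' ∈ J, ∀ y' ∈ J, q.eval y' * (∫ t in J ∩ Ioi x', K y' t) -
      q.eval x' * ∫ t in J ∩ Ioi y', K x' t =
      ((4 : ℝ) • (wVec E c C₀ p x' ᵥ* skewInv D)) ⬝ᵥ wVec E c C₀ p y' := by
    intro x' hx' y' hy'
    have h1 := (h.q_pos x' hx').ne'
    have h2 := (h.q_pos y' hy').ne'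
    rw [h.integral_kernel_tail hK hx' hy', h.integral_kernel_tail hK hy' hx',
      mul_div_cancel₀ _ h2, mul_div_cancel₀ _ h1, smul_dotProduct, ← dotProduct_mulVec, skewInv,
      smul_mulVec, sub_mulVec, dotProduct_smul, dotProduct_sub,
      dotProduct_mulVec _ (D⁻¹)ᵀ, vecMul_transpose, dotProduct_comm (D⁻¹ *ᵥ wVec E c C₀ p x')]
    simp only [smul_eq_mul]
    ring
  have e1 : ∀ x' ∈ J, timeOp q α (fun y' =>
      q.eval y' * (∫ t in J ∩ Ioi x', K y' t) - q.eval x' * ∫ t in J ∩ Ioi y', K x' t) y =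
      ((-4 / q.eval y) • (skewInv D *ᵥ ((D + α • 1) *ᵥ wVec E c C₀ p y))) ⬝ᵥ
        (-wVec E c C₀ p x') := by
    intro x' hx'
    rw [h.timeOp_dotProduct _ (e0 x' hx') hy, smul_dotProduct, ← dotProduct_mulVec,
      smul_dotProduct, dotProduct_neg, dotProduct_comm _ (wVec E c C₀ p x')]
    simp only [smul_eq_mul]
    ring
  rw [closedUpper, h.timeOp_dotProduct
    ((4 / q.eval y) • (skewInv D *ᵥ ((D + α • 1) *ᵥ wVec E c C₀ p y)))
    (fun x' hx' => by
      rw [e1 x' hx', smul_dotProduct, smul_dotProduct, dotProduct_neg]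
      simp only [smul_eq_mul]
      ring) hx,
    dotProduct_skewGram_inv hN h.isUnit_det h.add_transpose (h.isUnit_det_add hα),
    smul_dotProduct, dotProduct_comm]
  have := (h.q_pos x hx).ne'
  have := (h.q_pos y hy).ne'
  simp only [smul_eq_mul]
  field_simp

theorem closedLower_eq
    (hK : ∀ x ∈ J, ∀ y ∈ J,
      K x y = (wVec E c C₀ p x ⬝ᵥ wVec E c C₀ p y) / (q.eval x * q.eval y))
    (h : ExpTimeFamily J l q E L c C₀ p D) (hN : Even N) (hα : α < c / 2)
    {x y : ℝ} (hx : x ∈ J) (hy : y ∈ J) :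
    closedLower l q E α K x y = -expEps E α x y +
      epsVec l q E α c C₀ p D x ⬝ᵥ ((skewGram D α)⁻¹)ᵀ *ᵥ epsVec l q E α c C₀ p D y := by
  have e6 := dotProduct_kernel_lower hN h.isUnit_det h.add_transpose
    (h.isUnit_det_add hα) (h.mulVec_forwardVec α hx) (h.mulVec_forwardVec α hy)
  rw [closedLower, h.integral_kernel_forward' hK hy hx, h.integral_kernel_forward' hK hx hy,
    mul_div_cancel₀ _ (h.q_pos x hx).ne', mul_div_cancel₀ _ (h.q_pos y hy).ne', epsVec, epsVec, e6,
    dotProduct_comm (forwardVec l q E α c C₀ p y), dotProduct_comm (forwardVec l q E α c C₀ p x)]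
  ring

/-- The two diagonal entries are exchanged with their arguments because the inverse matrix of skew
products is antisymmetric. -/
theorem quatKernel_eq_closed
    (hK : ∀ x ∈ J, ∀ y ∈ J,
      K x y = (wVec E c C₀ p x ⬝ᵥ wVec E c C₀ p y) / (q.eval x * q.eval y))
    (h : ExpTimeFamily J l q E L c C₀ p D)
    (hI : WeightOn I J l q E c C₀ w) (hN : Even N)
    (hα : α < c / 2) {κ ε : ℝ → ℝ → ℝ}
    (hκ : ∀ x ∈ I, ∀ y ∈ I, κ x y = expKappa E α x y)
    (hε : ∀ x ∈ I, ∀ y ∈ I, ε x y = expEps E α x y)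
    {R : Fin N → ℝ[X]} {T : Matrix (Fin N) (Fin N) ℝ} (hT : IsUnit T)
    (hR : ∀ j, R j = ∑ k, Polynomial.C (T j k) * p k) {x y : ℝ} (hx : x ∈ I) (hy : y ∈ I) :
    quatKernel I w ε κ R x y =
      !![closedDiag J l q E α K y x, closedUpper J q α K x y;
        closedLower l q E α K x y, closedDiag J l q E α K x y] := by
  have hxJ := (hI.subset hx).1
  have hyJ := (hI.subset hy).1
  have hanti : ∀ a b : Fin N → ℝ, a ⬝ᵥ ((skewGram D α)⁻¹)ᵀ *ᵥ b =
      -(b ⬝ᵥ ((skewGram D α)⁻¹)ᵀ *ᵥ a) := by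
    intro a b
    have h1 : (((skewGram D α)⁻¹)ᵀ)ᵀ = -((skewGram D α)⁻¹)ᵀ := by
      rw [skewGram_inv_transpose hN h.isUnit_det h.add_transpose (h.isUnit_det_add hα)]
      simp [skewInv_transpose, Matrix.mul_assoc]
    rw [dotProduct_mulVec, ← mulVec_transpose, h1, neg_mulVec, neg_dotProduct, dotProduct_comm]
  rw [h.quatKernel_eq hI hα hκ hε hT hR hx hy, h.closedDiag_eq hK hN hα hxJ hyJ,
    h.closedDiag_eq hK hN hα hyJ hxJ, h.closedUpper_eq hK hN hα hxJ hyJ,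
    h.closedLower_eq hK hN hα hxJ hyJ, hanti (epsVec l q E α c C₀ p D y), neg_div, neg_neg]

end ExpTimeFamily

end ClosedForms

/-! ### Expansions in polynomials of degrees `0, …, N - 1` -/

section Expansion

open Matrix Set Filter Topology

/-- Polynomials of degrees `0, …, N - 1` span the polynomials of degree less than `N`. -/
theorem exists_expansion {N : ℕ} {p : Fin N → ℝ[X]}
    (hp : ∀ j, (p j).degree = ((j : ℕ) : WithBot ℕ)) (f : ℝ[X]) (hf : f.degree < N) :
    ∃ a : Fin N → ℝ, f = ∑ k, Polynomial.C (a k) * p k := by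
  suffices H : ∀ m ≤ N, ∀ f : ℝ[X], f.degree < m → ∃ a : Fin N → ℝ,
      f = ∑ k, Polynomial.C (a k) * p k from H N le_rfl f hf
  intro m
  induction m with
  | zero =>
    intro _ f hf
    refine ⟨0, ?_⟩
    have : f = 0 := by
      rw [← Polynomial.degree_eq_bot]
      exact WithBot.lt_coe_bot.1 (by simpa using hf)
    simp [this]
  | succ m ih =>
    intro hm f hf
    set j : Fin N := ⟨m, hm⟩
    have hj : (p j).degree = (m : WithBot ℕ) := hp j
    have hcoeff : (p j).coeff m ≠ 0 := Polynomial.coeff_ne_zero_of_eq_degree hj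
    set s := f.coeff m / (p j).coeff m
    -- The factor `s` is chosen to cancel the coefficient of degree `m`.
    obtain ⟨a, ha⟩ := ih (by omega) (f - Polynomial.C s * p j) (by
      rw [Polynomial.degree_lt_iff_coeff_zero]
      intro i hi
      rcases hi.eq_or_lt with rfl | hi
      · simp [s, hcoeff]
      · rw [Polynomial.coeff_sub, Polynomial.coeff_C_mul,
          Polynomial.coeff_eq_zero_of_degree_lt (hf.trans_le (by exact_mod_cast hi)),
          Polynomial.coeff_eq_zero_of_degree_lt (hj ▸ (by exact_mod_cast hi))]
        simp)
    refine ⟨fun k => a k + if k = j then s else 0, ?_⟩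
    simp only [map_add, add_mul, Finset.sum_add_distrib, ← ha]
    rw [Finset.sum_eq_single j (fun k _ hk => by simp [hk]) (by simp)]
    simp

theorem exists_matrix_expansion {N : ℕ} {p : Fin N → ℝ[X]}
    (hp : ∀ j, (p j).degree = ((j : ℕ) : WithBot ℕ)) (f : Fin N → ℝ[X])
    (hf : ∀ j, (f j).degree < N) :
    ∃ T : Matrix (Fin N) (Fin N) ℝ, ∀ j, f j = ∑ k, Polynomial.C (T j k) * p k := by
  choose T hT using fun j => exists_expansion hp (f j) (hf j)
  exact ⟨T, hT⟩

theorem det_coeff_ne_zero {N : ℕ} {p : Fin N → ℝ[X]}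
    (hp : ∀ j, (p j).degree = ((j : ℕ) : WithBot ℕ)) :
    (Matrix.of fun j i : Fin N => (p j).coeff i).det ≠ 0 := by
  have ht : (Matrix.of fun j i : Fin N => (p j).coeff i).IsLowerTriangular := fun j i hij =>
    Polynomial.coeff_eq_zero_of_degree_lt (by
      rw [hp]
      exact_mod_cast hij)
  rw [det_of_isLowerTriangular _ ht]
  exact Finset.prod_ne_zero_iff.2 fun j _ => Polynomial.coeff_ne_zero_of_eq_degree (hp j)

/-- The coefficient matrices of both families are triangular with nonzero diagonal, and `T` carries
one to the other. -/
theorem exists_unit_expansion {N : ℕ} {p R : Fin N → ℝ[X]}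
    (hp : ∀ j, (p j).degree = ((j : ℕ) : WithBot ℕ))
    (hR : ∀ j, (R j).degree = ((j : ℕ) : WithBot ℕ)) :
    ∃ T : Matrix (Fin N) (Fin N) ℝ, IsUnit T ∧ ∀ j, R j = ∑ k, Polynomial.C (T j k) * p k := by
  obtain ⟨T, hT⟩ := exists_matrix_expansion hp R fun j => by
    rw [hR]
    exact_mod_cast j.2
  refine ⟨T, ?_, hT⟩
  have e : (Matrix.of fun j i : Fin N => (R j).coeff i) =
      T * Matrix.of fun j i : Fin N => (p j).coeff i := by
    ext j i
    rw [of_apply, hT j]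
    simp [Matrix.mul_apply]
  have hd := det_coeff_ne_zero hR
  rw [e, det_mul] at hd
  exact (Matrix.isUnit_iff_isUnit_det _).2 (left_ne_zero_of_mul hd).isUnit

/-- Since `q` is at most linear, `q f'` does not exceed the degree of `f`. Hence the time derivative
preserves the span, and a matrix `D` exists. -/
theorem degree_timeDeriv_lt {c : ℝ} {q f : ℝ[X]} (hq : q.natDegree ≤ 1) {j N : ℕ} (hj : j < N)
    (hf : f.degree = (j : WithBot ℕ)) : (timeDeriv c q f).degree < N := by
  have hjN : f.degree < N := hf ▸ (by exact_mod_cast hj)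
  have hf' : f.natDegree = j := Polynomial.natDegree_eq_of_degree_eq_some hf
  refine (Polynomial.degree_add_le _ _).trans_lt (max_lt ?_ ?_)
  · rw [Polynomial.degree_neg]
    rw [← Polynomial.smul_eq_C_mul]
    exact (Polynomial.degree_smul_le _ _).trans_lt hjN
  · by_cases h0 : f.derivative = 0
    · simp [h0]
    have hd : f.derivative.natDegree < f.natDegree := by
      refine Polynomial.natDegree_derivative_lt fun h => h0 ?_
      exact Polynomial.derivative_of_natDegree_zero h
    refine Polynomial.degree_le_natDegree.trans_lt ?_
    have := Polynomial.natDegree_mul_le (p := q) (q := f.derivative)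
    exact_mod_cast (by omega : (q * f.derivative).natDegree < N)

end Expansion

/-! ### The common theorem for both ensembles -/

section Ensemble

open Matrix Set Filter Topology

theorem diffProd_nonneg {N : ℕ} {x : Fin N → ℝ} (hx : StrictAnti x) : 0 ≤ diffProd x :=
  Finset.prod_nonneg fun _ _ => Finset.prod_nonneg fun _ hk =>
    sub_nonneg.2 (hx (Finset.mem_Ioi.1 hk)).le

/-- The probabilistic part (`SkewSystem.correlation_eq`) and the algebraic part
(`quatKernel_eq_closed`) meet here. The factorization of `ε` on ordered points is `E x ^ α * (E y ^
α)⁻¹`. -/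
theorem ExpTime.ensemble {I J : Set ℝ} {l : ℝ} {q : ℝ[X]} {E : ℝ → ℝ} {L : Filter ℝ}
    (h : ExpTime J l q E L) {c C₀ α : ℝ} (hc : 0 < c) {n : ℕ} {p : Fin (2 * n) → ℝ[X]}
    (hp : ∀ j, (p j).degree = ((j : ℕ) : WithBot ℕ))
    (horth : ∀ j k, ∫ t in J ∩ Ioi l,
      wPoly E c C₀ (p j) t * wPoly E c C₀ (p k) t / q.eval t = if j = k then 1 else 0)
    {w : ℝ → ℝ} (hI : WeightOn I J l q E c C₀ w) (hw : ∀ x ∈ I, 0 ≤ w x) (hα : α < c / 2)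
    {κ ε K : ℝ → ℝ → ℝ} (hκ : ∀ x ∈ I, ∀ y ∈ I, κ x y = expKappa E α x y)
    (hε : ∀ x ∈ I, ∀ y ∈ I, ε x y = expEps E α x y)
    (hK : ∀ x ∈ J, ∀ y ∈ J,
      K x y = (wVec E c C₀ p x ⬝ᵥ wVec E c C₀ p y) / (q.eval x * q.eval y))
    {ρ : (Fin (2 * n) → ℝ) → ℝ} (hρ₀ : ∀ x, ¬(StrictAnti x ∧ ∀ j, x j ∈ I) → ρ x = 0)
    (hρ : ∀ x, StrictAnti x → (∀ j, x j ∈ I) → ρ x = (∏ j, w (x j)) *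
      (∏ j : Fin n, κ (oddCoord x j) (evenCoord x j)) * diffProd x) :
    0 < (∫ x, ρ x) ∧ ∀ R : Fin (2 * n) → ℝ[X], (∀ j, (R j).degree = ((j : ℕ) : WithBot ℕ)) →
      IsUnit (skewMatrix I w κ R) ∧
      (∀ k : ℕ, k ≤ 2 * n → ∀ x : Fin k → ℝ, (∀ j, x j ∈ I) →
        correlation (fun x => (1 / ∫ x, ρ x) * ρ x) k x =
          qdet (blockMatrix (quatKernel I w ε κ R) x)) ∧
      ∀ x ∈ I, ∀ y ∈ I, quatKernel I w ε κ R x y =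
        !![closedDiag J l q E α K y x, closedUpper J q α K x y;
          closedLower l q E α K x y, closedDiag J l q E α K x y] := by
  have hN : Even (2 * n) := even_two_mul n
  obtain ⟨D, hD⟩ := exists_matrix_expansion hp (fun j => timeDeriv c q (p j))
    fun j => degree_timeDeriv_lt h.q_natDegree j.2 (hp j)
  have hF : ExpTimeFamily J l q E L c C₀ p D :=
    { h with c_pos := hc, timeDeriv_eq := hD, orthonormal := horth }
  have hE : ∀ x ∈ I, 0 < E x := fun x hx => h.E_pos x (hI.subset hx).1
  have hκ₀ : ∀ x ∈ I, ∀ y ∈ I, 0 ≤ κ x y := fun x hx y hy => by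
    rw [hκ x hx y hy, expKappa]
    split_ifs
    · exact Real.rpow_nonneg (div_nonneg (hE x hx).le (hE y hy).le) _
    · exact le_rfl
  have hpair : ∀ x : Fin (2 * n) → ℝ, StrictAnti x → ∀ j : Fin n,
      evenCoord x j < oddCoord x j := fun x hx j => hx (by simp [Fin.lt_def])
  obtain ⟨b, m, hS⟩ := hF.skewSystem hI hN hα
  obtain ⟨h0, hcorr⟩ := hS.correlation_eq (w := w) (u := fun x => E x ^ α)
    (v := fun y => (E y ^ α)⁻¹) hp (fun j x => rfl)
    (fun x hx y hy hxy => by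
      rw [expEps, expKappa, expKappa, if_pos hxy, if_neg hxy.not_gt, sub_zero,
        Real.div_rpow (hE x hx).le (hE y hy).le, div_eq_mul_inv])
    (fun x hx => inv_ne_zero (Real.rpow_pos_of_pos (hE x hx) _).ne') hρ₀
    (fun x hx hxI => by
      rw [hρ x hx hxI]
      congr 2
      refine Finset.prod_congr rfl fun j _ => ?_
      rw [hκ (oddCoord x j) (hxI _) (evenCoord x j) (hxI _), expEps, expKappa, expKappa, if_neg (hpair x hx j).not_gt,
        sub_zero])
    (fun x => by
      by_cases hx : StrictAnti x ∧ ∀ j, x j ∈ I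
      · rw [hρ x hx.1 hx.2]
        exact mul_nonneg (mul_nonneg (Finset.prod_nonneg fun j _ => hw _ (hx.2 j))
          (Finset.prod_nonneg fun j _ => hκ₀ _ (hx.2 _) _ (hx.2 _))) (diffProd_nonneg hx.1)
      · rw [hρ₀ x hx])
  refine ⟨h0, fun R hR => ?_⟩
  obtain ⟨T, hT, hRT⟩ := exists_unit_expansion hp hR
  refine ⟨hF.isUnit_skewMatrix hI hN hα hκ hT hRT, fun k hk x hx => ?_, fun x hx y hy =>
    hF.quatKernel_eq_closed hK hI hN hα hκ hε hT hRT hx hy⟩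
  rw [hcorr k hk x hx, ← qdet_blockMatrix_pfKernel]
  congr 1
  ext r s
  rw [blockMatrix, blockMatrix, of_apply, of_apply,
    hF.quatKernel_eq_pfKernel hI hα hκ hε hT hRT (hx r.1) (hx s.1)]

end Ensemble

/-! ### Orthogonality by finite differences and norms by boundary values -/

section Orthonormal

open Matrix Set Filter Topology

/-- The alternating binomial sum is an `l`-th finite difference. It serves for the orthogonality of
both families and for the value of the Jacobi polynomials at `-1`. -/
theorem sum_neg_one_pow_choose_eval (Q : ℝ[X]) (l : ℕ) :
    ∑ m ∈ Finset.range (l + 1), (-1) ^ m * (l.choose m : ℝ) * Q.eval (m : ℝ) =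
      (-1) ^ l * ((fwdDiff 1)^[l] Q.eval) 0 := by
  rw [fwdDiff_iter_eq_sum_shift, Finset.mul_sum]
  refine Finset.sum_congr rfl fun m hm => ?_
  have hm : m ≤ l := Nat.lt_succ_iff.1 (Finset.mem_range.1 hm)
  have : (-1 : ℝ) ^ l * (-1) ^ (l - m) = (-1) ^ m := by
    obtain ⟨d, rfl⟩ := Nat.exists_eq_add_of_le hm
    rw [Nat.add_sub_cancel_left, pow_add, mul_assoc, ← mul_pow]
    simp
  rw [← this]
  simp only [zsmul_eq_mul, nsmul_eq_mul]
  push_cast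
  simp
  ring

theorem sum_neg_one_pow_choose_eval_eq_zero {Q : ℝ[X]} {l : ℕ} (hQ : Q.natDegree < l) :
    ∑ m ∈ Finset.range (l + 1), (-1) ^ m * (l.choose m : ℝ) * Q.eval (m : ℝ) = 0 := by
  rw [sum_neg_one_pow_choose_eval, Polynomial.fwdDiff_iter_eq_zero_of_degree_lt hQ]
  simp

theorem sum_neg_one_pow_choose_eval_natDegree {Q : ℝ[X]} (hQ : Q.Monic) {l : ℕ}
    (hl : Q.natDegree = l) :
    ∑ m ∈ Finset.range (l + 1), (-1) ^ m * (l.choose m : ℝ) * Q.eval (m : ℝ) =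
      (-1) ^ l * (l.factorial : ℝ) := by
  subst hl
  rw [sum_neg_one_pow_choose_eval, Polynomial.fwdDiff_iter_degree_eq_factorial,
    Polynomial.Monic.leadingCoeff hQ]
  simp

variable {J : Set ℝ} {l : ℝ} {q : ℝ[X]} {E : ℝ → ℝ} {L : Filter ℝ} {c : ℝ}

theorem ExpTime.integral_sum_wPoly (h : ExpTime J l q E L) (hc : 0 < c) (C₀ : ℝ) {ι : Type*}
    (s : Finset ι) (a : ι → ℝ) (g : ι → ℝ[X]) (f : ℝ[X]) :
    ∫ t in J ∩ Ioi l, wPoly E c C₀ (∑ i ∈ s, Polynomial.C (a i) * g i) t * wPoly E c C₀ f t /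
        q.eval t =
      ∑ i ∈ s, a i * ∫ t in J ∩ Ioi l, wPoly E c C₀ (g i) t * wPoly E c C₀ f t / q.eval t := by
  simp only [← integral_const_mul]
  rw [← integral_finsetSum _ fun i _ => (h.integrableOn_wPoly_mul hc C₀ (g i) f h.l_mem).const_mul _]
  refine integral_congr_ae (.of_forall fun t => ?_)
  simp only [wPoly, Polynomial.eval_finsetSum, Polynomial.eval_mul, Polynomial.eval_C,
    Finset.mul_sum, Finset.sum_mul, Finset.sum_div]
  exact Finset.sum_congr rfl fun i _ => by ring

theorem ExpTime.integral_wPoly_of_degree_lt (h : ExpTime J l q E L) (hc : 0 < c) (C₀ : ℝ)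
    {g : ℕ → ℝ[X]} (hg : ∀ k : ℕ, (g k).degree = (k : WithBot ℕ)) {P : ℝ[X]} {m : ℕ}
    (horth : ∀ k < m, ∫ t in J ∩ Ioi l, wPoly E c C₀ (g k) t * wPoly E c C₀ P t / q.eval t = 0)
    {f : ℝ[X]} (hf : f.degree < m) :
    ∫ t in J ∩ Ioi l, wPoly E c C₀ f t * wPoly E c C₀ P t / q.eval t = 0 := by
  obtain ⟨a, ha⟩ := exists_expansion (p := fun k : Fin m => g k) (fun k => hg k) f hf
  rw [ha, h.integral_sum_wPoly hc]
  exact Finset.sum_eq_zero fun k _ => by rw [horth k k.2, mul_zero]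

/-- The time derivative of the square of the weighted polynomial integrates to minus its value at
`l`, while it equals `-2μ` times the square up to a term with `g` that integrates to zero. -/
theorem ExpTime.integral_wPoly_sq (h : ExpTime J l q E L) (hc : 0 < c) (C₀ : ℝ) {P g : ℝ[X]}
    {μ : ℝ} (hμ : 0 < μ) (hP : timeDeriv c q P = g - Polynomial.C μ * P)
    (horth : ∫ t in J ∩ Ioi l, wPoly E c C₀ g t * wPoly E c C₀ P t / q.eval t = 0) :
    ∫ t in J ∩ Ioi l, wPoly E c C₀ P t * wPoly E c C₀ P t / q.eval t =
      C₀ ^ 2 * P.eval l ^ 2 / (2 * μ) := by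
  have h1 := h.integral_deriv l h.l_mem (fun t => wPoly E c C₀ P t * wPoly E c C₀ P t) _
    (fun t ht => (h.hasDerivAt_wPoly c C₀ P ht).mul (h.hasDerivAt_wPoly c C₀ P ht)) ?_
    (h.tendsto_wPoly_mul hc C₀ P P)
  · have e : ∀ t, wPoly E c C₀ (timeDeriv c q P) t / q.eval t * wPoly E c C₀ P t +
        wPoly E c C₀ P t * (wPoly E c C₀ (timeDeriv c q P) t / q.eval t) =
        2 * (wPoly E c C₀ g t * wPoly E c C₀ P t / q.eval t) -
          2 * μ * (wPoly E c C₀ P t * wPoly E c C₀ P t / q.eval t) := by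
      intro t
      rw [hP]
      simp only [wPoly, Polynomial.eval_sub, Polynomial.eval_mul, Polynomial.eval_C]
      ring
    simp only [e] at h1
    rw [integral_sub ((h.integrableOn_wPoly_mul hc C₀ g P h.l_mem).const_mul _)
      ((h.integrableOn_wPoly_mul hc C₀ P P h.l_mem).const_mul _), integral_const_mul,
      integral_const_mul, horth] at h1
    have e2 : wPoly E c C₀ P l = C₀ * P.eval l := by simp [wPoly, h.E_l]
    rw [e2] at h1
    rw [eq_div_iff (by positivity)]
    linarith
  · have h2 := (h.integrableOn_wPoly_mul hc C₀ (timeDeriv c q P) P h.l_mem).const_mul 2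
    refine IntegrableOn.congr_fun h2 (fun t _ => ?_) (h.measurableSet_tail l)
    ring

/-- Orthogonality to lower powers and the value at `l` give orthonormality. -/
theorem ExpTime.orthonormal_of_orthogonal (h : ExpTime J l q E L) (hc : 0 < c) (C₀ : ℝ)
    {g P R : ℕ → ℝ[X]} {μ : ℕ → ℝ} (hg : ∀ k : ℕ, (g k).degree = (k : WithBot ℕ))
    (hP : ∀ k : ℕ, (P k).degree = (k : WithBot ℕ))
    (horth : ∀ m, ∀ k < m,
      ∫ t in J ∩ Ioi l, wPoly E c C₀ (g k) t * wPoly E c C₀ (P m) t / q.eval t = 0)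
    (hR : ∀ m : ℕ, (R m).degree < (m : WithBot ℕ)) (hμ : ∀ m, 0 < μ m)
    (hD : ∀ m, timeDeriv c q (P m) = R m - Polynomial.C (μ m) * P m)
    (hl : ∀ m, C₀ ^ 2 * (P m).eval l ^ 2 = 2 * μ m) (j k : ℕ) :
    ∫ t in J ∩ Ioi l, wPoly E c C₀ (P j) t * wPoly E c C₀ (P k) t / q.eval t =
      if j = k then 1 else 0 := by
  have hlt : ∀ j k, j < k →
      ∫ t in J ∩ Ioi l, wPoly E c C₀ (P j) t * wPoly E c C₀ (P k) t / q.eval t = 0 :=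
    fun j k hjk => h.integral_wPoly_of_degree_lt hc C₀ hg (horth k) (by
      rw [hP]
      exact_mod_cast hjk)
  rcases lt_trichotomy j k with hjk | rfl | hjk
  · rw [hlt j k hjk, if_neg hjk.ne]
  · rw [h.integral_wPoly_sq hc C₀ (hμ j) (hD j)
      (h.integral_wPoly_of_degree_lt hc C₀ hg (horth j) (hR j)), hl, if_pos rfl,
      div_self (by have := hμ j; positivity)]
  · simp only [mul_comm (wPoly E c C₀ (P j) _), hlt k j hjk, if_neg hjk.ne']

/-- The polynomial `∑_{m ≤ l} a_m X^m`. -/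
def coeffPoly (a : ℕ → ℝ) (l : ℕ) : ℝ[X] :=
  ∑ m ∈ Finset.range (l + 1), Polynomial.C (a m) * Polynomial.X ^ m

theorem degree_coeffPoly {a : ℕ → ℝ} {l : ℕ} (ha : a l ≠ 0) :
    (coeffPoly a l).degree = (l : WithBot ℕ) := by
  refine Polynomial.degree_eq_of_le_of_coeff_ne_zero ?_ ?_
  · refine (Polynomial.degree_sum_le _ _).trans (Finset.sup_le fun m hm => ?_)
    refine (Polynomial.degree_C_mul_X_pow_le m _).trans ?_
    exact_mod_cast Nat.lt_succ_iff.1 (Finset.mem_range.1 hm)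
  · simpa [coeffPoly, Polynomial.finsetSum_coeff, Polynomial.coeff_C_mul, Polynomial.coeff_X_pow]
      using ha

end Orthonormal

/-! ### Laguerre polynomials and their orthonormality -/

section Laguerre

open Matrix Set Filter Topology

theorem tendsto_exp_rpow_mul_eval {δ : ℝ} (hδ : 0 < δ) (f : ℝ[X]) :
    Tendsto (fun t => Real.exp t ^ (-δ) * f.eval t) atTop (𝓝 0) := by
  have h1 := (Polynomial.tendsto_div_exp_atTop
    (f.comp (Polynomial.C δ⁻¹ * Polynomial.X))).comp (tendsto_id.const_mul_atTop hδ)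
  refine h1.congr fun t => ?_
  simp only [Function.comp, id, Polynomial.eval_comp, Polynomial.eval_mul, Polynomial.eval_C,
    Polynomial.eval_X, inv_mul_cancel_left₀ hδ.ne']
  rw [← Real.exp_mul, mul_neg, Real.exp_neg, mul_comm t]
  ring

theorem integrableOn_exp_rpow_mul_eval {δ : ℝ} (hδ : 0 < δ) (f : ℝ[X]) (x : ℝ) :
    IntegrableOn (fun t => Real.exp t ^ (-δ) * f.eval t) (Ioi x) := by
  -- Half of the exponential decay absorbs the polynomial.
  refine integrable_of_isBigO_exp_neg (half_pos hδ) ?_ ?_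
  · exact ((Real.continuous_exp.rpow_const fun t => Or.inl (Real.exp_pos t).ne').mul
      f.continuous).continuousOn
  · have h1 := (tendsto_exp_rpow_mul_eval (half_pos hδ) f).isBigO_one ℝ
    have h2 := (Asymptotics.isBigO_refl (fun t => Real.exp (-(δ / 2) * t)) atTop).mul h1
    refine (h2.congr_left fun t => ?_).congr_right fun t => mul_one _
    rw [← mul_assoc, ← Real.exp_mul, ← Real.exp_mul, ← Real.exp_add]
    ring_nf

theorem laguerre_expTime : ExpTime univ 0 1 Real.exp atTop where
  isOpen := isOpen_univ
  ordConnected := ordConnected_univ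
  l_mem := mem_univ _
  q_pos := fun x _ => by simp
  q_natDegree := by simp
  E_pos := fun x _ => Real.exp_pos x
  E_l := Real.exp_zero
  E_mono := Real.exp_monotone.monotoneOn _
  hasDerivAt_E := fun x _ => by simpa using Real.hasDerivAt_exp x
  integrable_E := fun δ hδ f x _ => by
    simpa using integrableOn_exp_rpow_mul_eval hδ f x
  tendsto_E := fun δ hδ f => tendsto_exp_rpow_mul_eval hδ f
  integral_deriv := fun x _ f f' hf hi ht => by
    rw [univ_inter] at hi ⊢
    rw [integral_Ioi_of_hasDerivAt_of_tendsto' (fun t _ => hf t (mem_univ t)) hi ht, zero_sub]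
  eventually_mem := by
    filter_upwards [eventually_gt_atTop 0] with t ht using ⟨mem_univ t, ht⟩

theorem integral_exp_neg_mul_pow (k : ℕ) :
    ∫ t in Ioi (0 : ℝ), Real.exp (-t) * t ^ k = (k.factorial : ℝ) := by
  rw [← Real.Gamma_nat_eq_factorial, Real.Gamma_eq_integral (by positivity)]
  refine setIntegral_congr_fun measurableSet_Ioi fun t _ => ?_
  simp

/-- The Laguerre polynomial `L_l`. -/
def laguerrePoly (l : ℕ) : ℝ[X] :=
  coeffPoly (fun m => (-1) ^ m * (l.choose m : ℝ) / (m.factorial : ℝ)) l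

theorem eval_laguerrePoly (l : ℕ) (x : ℝ) : (laguerrePoly l).eval x = laguerreL l x := by
  simp only [laguerrePoly, coeffPoly, laguerreL, Polynomial.eval_finsetSum, Polynomial.eval_mul,
    Polynomial.eval_C, Polynomial.eval_pow, Polynomial.eval_X]
  refine Finset.sum_congr rfl fun m _ => ?_
  rw [neg_pow x]
  ring

theorem degree_laguerrePoly (l : ℕ) : (laguerrePoly l).degree = (l : WithBot ℕ) :=
  degree_coeffPoly (by simp [Nat.factorial_ne_zero])

/-- The moments are `(m + k)!`, and divided by `m!` they become the polynomial `(m + 1)_k` of degree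
`k < l` in `m`, annihilated by the `l`-th difference. -/
theorem integral_pow_mul_laguerrePoly {k l : ℕ} (hk : k < l) :
    ∫ t in univ ∩ Ioi (0 : ℝ), wPoly Real.exp 1 1 (Polynomial.X ^ k) t *
      wPoly Real.exp 1 1 (laguerrePoly l) t / (1 : ℝ[X]).eval t = 0 := by
  simp only [mul_comm (wPoly Real.exp 1 1 (Polynomial.X ^ k) _)]
  rw [laguerrePoly, coeffPoly, laguerre_expTime.integral_sum_wPoly one_pos]
  have e : ∀ m, ∫ t in univ ∩ Ioi (0 : ℝ), wPoly Real.exp 1 1 (Polynomial.X ^ m) t *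
      wPoly Real.exp 1 1 (Polynomial.X ^ k) t / (1 : ℝ[X]).eval t = ((m + k).factorial : ℝ) := by
    intro m
    rw [← integral_exp_neg_mul_pow, univ_inter]
    refine integral_congr_ae (.of_forall fun t => ?_)
    simp only
    rw [laguerre_expTime.wPoly_mul_wPoly 1 1 _ _ (mem_univ t), ← pow_add, ← Real.exp_mul]
    simp
  simp only [e]
  rw [← sum_neg_one_pow_choose_eval_eq_zero (Q := (ascPochhammer ℝ k).comp (Polynomial.X + 1))
    (l := l) ?_]
  · refine Finset.sum_congr rfl fun m _ => ?_
    have : (m.factorial : ℝ) * (ascPochhammer ℝ k).eval ((m : ℝ) + 1) =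
        ((m + k).factorial : ℝ) := by
      rw [← Nat.factorial_mul_ascFactorial m k, Nat.cast_mul, ← ascPochhammer_nat_eq_ascFactorial,
        ascPochhammer_eval_cast, Nat.cast_succ]
    rw [← this]
    have hm : (m.factorial : ℝ) ≠ 0 := by exact_mod_cast m.factorial_ne_zero
    simp only [Polynomial.eval_comp, Polynomial.eval_add, Polynomial.eval_X, Polynomial.eval_one]
    field_simp
  · rw [Polynomial.natDegree_comp, ascPochhammer_natDegree]
    have : (Polynomial.X + 1 : ℝ[X]).natDegree = 1 := by
      simpa using Polynomial.natDegree_X_add_C (1 : ℝ)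
    simpa [this] using hk

theorem laguerre_orthonormal (j k : ℕ) :
    ∫ t in univ ∩ Ioi (0 : ℝ), wPoly Real.exp 1 1 (laguerrePoly j) t *
      wPoly Real.exp 1 1 (laguerrePoly k) t / (1 : ℝ[X]).eval t = if j = k then 1 else 0 := by
  -- The time derivative is `L' - L / 2`, so `μ = 1 / 2`, and `L_m(0) = 1` is the required boundary
  -- value.
  refine laguerre_expTime.orthonormal_of_orthogonal one_pos 1 (g := fun k => Polynomial.X ^ k)
    (P := laguerrePoly) (R := fun m => (laguerrePoly m).derivative) (μ := fun _ => 1 / 2)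
    (fun k => Polynomial.degree_X_pow k) degree_laguerrePoly
    (fun m k hk => integral_pow_mul_laguerrePoly hk) (fun m => ?_) (fun _ => by norm_num)
    (fun m => ?_) (fun m => ?_) j k
  · rw [← degree_laguerrePoly m]
    refine Polynomial.degree_derivative_lt fun h => ?_
    have := degree_laguerrePoly m
    rw [h] at this
    simp at this
  · rw [timeDeriv]
    ring
  · rw [eval_laguerrePoly, laguerreL, Finset.sum_range_succ']
    simp

end Laguerre

/-! ### The Laguerre ensemble -/

section LaguerreEnsemble

open Matrix Set Filter Topology

theorem exp_div_rpow (A x y : ℝ) :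
    (Real.exp x / Real.exp y) ^ (A / 2) = Real.exp (A * (x - y) / 2) := by
  rw [← Real.exp_sub, ← Real.exp_mul]
  ring_nf

theorem laguerre_weightOn : WeightOn (Ici 0) univ 0 1 Real.exp 1 1 wL where
  measurableSet := measurableSet_Ici
  subset := by simp
  superset := by simp
  measurable_w := by
    unfold wL
    fun_prop
  measurable_E := Real.measurable_exp
  weight_eq := fun x _ => by
    rw [← Real.exp_mul, wL]
    simp only [Polynomial.eval_one, mul_one, one_mul]
    ring_nf

theorem kappaL_eq (A x y : ℝ) : kappaL A x y = expKappa Real.exp (A / 2) x y := by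
  rw [kappaL, expKappa, exp_div_rpow]

theorem epsL_eq (A x y : ℝ) : epsL A x y = expEps Real.exp (A / 2) x y := by
  rw [epsL, expEps, expKappa, expKappa, exp_div_rpow, exp_div_rpow]
  rcases lt_trichotomy x y with h | rfl | h
  · rw [if_neg h.not_gt, if_pos h, Real.sign_of_neg (sub_neg.2 h), abs_of_neg (sub_neg.2 h)]
    ring_nf
  · simp
  · rw [if_pos h, if_neg h.not_gt, Real.sign_of_pos (sub_pos.2 h), abs_of_pos (sub_pos.2 h)]
    ring

theorem KL_eq (N : ℕ) (x y : ℝ) :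
    KL N x y = (wVec Real.exp 1 1 (fun j : Fin N => laguerrePoly j) x ⬝ᵥ
      wVec Real.exp 1 1 (fun j : Fin N => laguerrePoly j) y) /
        ((1 : ℝ[X]).eval x * (1 : ℝ[X]).eval y) := by
  have e : Real.exp (-(x + y) / 2) = Real.exp x ^ (-(1 / 2 : ℝ)) * Real.exp y ^ (-(1 / 2 : ℝ)) := by
    rw [← Real.exp_mul, ← Real.exp_mul, ← Real.exp_add]
    ring_nf
  rw [KL, Finset.sum_range, e, Finset.mul_sum]
  simp only [dotProduct, wVec, wPoly, eval_laguerrePoly, Polynomial.eval_one, mul_one, div_one,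
    one_mul]
  exact Finset.sum_congr rfl fun j _ => by ring

theorem f22L_eq (n : ℕ) (A x y : ℝ) :
    f22L n A x y = closedDiag univ 0 1 Real.exp (A / 2) (KL (2 * n)) x y := by
  simp only [f22L, closedDiag, exp_div_rpow, ← Real.exp_mul, univ_inter, Polynomial.eval_one,
    Polynomial.derivative_one, Polynomial.eval_zero, zero_mul, add_zero, mul_one, one_mul]
  ring_nf

theorem f12L_eq (n : ℕ) (A x y : ℝ) :
    f12L n A x y = closedUpper univ 1 (A / 2) (KL (2 * n)) x y := by
  have e : ∀ g x, timeOp 1 (A / 2) g x = opL A g x := fun g x => by simp [timeOp, opL]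
  simp only [f12L, closedUpper, e, univ_inter, Polynomial.eval_one, one_mul]

theorem f21L_eq (n : ℕ) (A x y : ℝ) :
    f21L n A x y = closedLower 0 1 Real.exp (A / 2) (KL (2 * n)) x y := by
  rw [closedLower, ← epsL_eq]
  simp only [f21L, epsL, exp_div_rpow, Polynomial.eval_one, one_mul]

theorem laguerre_ensemble (n : ℕ) (A : ℝ) (hA : A < 1) :
    0 < laguerreNorm n A ∧
      ∀ R : Fin (2 * n) → ℝ[X], (∀ j, (R j).degree = ((j : ℕ) : WithBot ℕ)) →
        IsUnit (skewMatrix (Set.Ici 0) wL (kappaL A) R) ∧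
        (∀ k : ℕ, k ≤ 2 * n → ∀ x : Fin k → ℝ, (∀ j, x j ∈ Set.Ici (0 : ℝ)) →
          correlation (laguerrePDF n A) k x = qdet (blockMatrix (fL A R) x)) ∧
        (∀ x ∈ Set.Ici (0 : ℝ), ∀ y ∈ Set.Ici (0 : ℝ),
          fL A R x y = !![f22L n A y x, f12L n A x y; f21L n A x y, f22L n A x y]) := by
  simp only [f22L_eq, f12L_eq, f21L_eq]
  refine laguerre_expTime.ensemble one_pos (p := fun j : Fin (2 * n) => laguerrePoly j)
    (fun j => degree_laguerrePoly j) (fun j k => by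
      simp only [laguerre_orthonormal, Fin.val_inj])
    laguerre_weightOn (fun x _ => (Real.exp_pos _).le) (by linarith)
    (fun x _ y _ => kappaL_eq A x y) (fun x _ y _ => epsL_eq A x y)
    (fun x _ y _ => KL_eq (2 * n) x y) (ρ := laguerreWeight n A)
    (fun x hx => indicator_of_notMem (show x ∉ {x | StrictAnti x ∧ ∀ j, 0 ≤ x j} from hx) _) (fun x hx hxI => ?_)
  have hpair : ∀ j : Fin n, evenCoord x j < oddCoord x j := fun j => hx (by simp [Fin.lt_def])
  rw [laguerreWeight, indicator_of_mem (show x ∈ {x | StrictAnti x ∧ ∀ j, 0 ≤ x j} from ⟨hx, hxI⟩)]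
  simp only [wL, kappaL, hpair, if_true]

end LaguerreEnsemble

/-! ### Jacobi polynomials and their orthonormality -/

section Jacobi

open Matrix Set Filter Topology

/-- The exponential time `2 / (1 - x)` of the Jacobi case. -/
def jacobiE (x : ℝ) : ℝ := 2 / (1 - x)

theorem jacobiE_rpow_neg {x : ℝ} (hx : x < 1) (s : ℝ) : jacobiE x ^ (-s) = ((1 - x) / 2) ^ s := by
  have h : 0 < 1 - x := sub_pos.2 hx
  rw [jacobiE, Real.rpow_neg (by positivity), ← Real.inv_rpow (by positivity), inv_div]

theorem tendsto_jacobiE_rpow_mul_eval {δ : ℝ} (hδ : 0 < δ) (f : ℝ[X]) :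
    Tendsto (fun t => jacobiE t ^ (-δ) * f.eval t) (𝓝[<] 1) (𝓝 0) := by
  have hc : Continuous fun t : ℝ => ((1 - t) / 2) ^ δ * f.eval t :=
    (((continuous_const.sub continuous_id).div_const 2).rpow_const fun _ => Or.inr hδ.le).mul
      f.continuous
  have h1 := (hc.tendsto 1).mono_left (nhdsWithin_le_nhds (s := Iio 1))
  simp only [sub_self, zero_div, Real.zero_rpow hδ.ne', zero_mul] at h1
  refine h1.congr' ?_
  filter_upwards [self_mem_nhdsWithin] with t ht
  rw [jacobiE_rpow_neg ht]

theorem integrableOn_jacobiE_rpow_mul_eval {δ : ℝ} (hδ : 0 < δ) (f : ℝ[X]) {x : ℝ} (hx : x < 1) :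
    IntegrableOn (fun t => jacobiE t ^ (-δ) * f.eval t / (1 - Polynomial.X : ℝ[X]).eval t)
      (Iio 1 ∩ Ioi x) := by
  have h1 : IntervalIntegrable (fun t : ℝ => (1 - t) ^ (δ - 1)) volume x 1 := by
    have := (intervalIntegral.intervalIntegrable_rpow' (a := 1 - x) (b := 0) (r := δ - 1)
      (by linarith)).comp_sub_left 1
    simpa using this
  have h2 := (h1.mul_continuousOn f.continuous.continuousOn).const_mul ((1 / 2 : ℝ) ^ δ)
  rw [intervalIntegrable_iff_integrableOn_Ioo_of_le hx.le] at h2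
  rw [inter_comm, Ioi_inter_Iio]
  refine IntegrableOn.congr_fun h2 (fun t ht => ?_) measurableSet_Ioo
  have h : 0 < 1 - t := sub_pos.2 ht.2
  rw [jacobiE_rpow_neg ht.2, Real.rpow_sub_one h.ne', div_eq_mul_one_div (1 - t) 2,
    Real.mul_rpow h.le (by norm_num)]
  simp only [Polynomial.eval_sub, Polynomial.eval_one, Polynomial.eval_X]
  ring

/-- The open interval extends to the left of `-1`, so that the starting point is interior and
derivatives exist there. -/
theorem jacobi_expTime : ExpTime (Iio 1) (-1) (1 - Polynomial.X) jacobiE (𝓝[<] 1) where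
  isOpen := isOpen_Iio
  ordConnected := ordConnected_Iio
  l_mem := by norm_num
  q_pos := fun x hx => by simpa using hx
  q_natDegree := by
    refine (Polynomial.natDegree_sub_le _ _).trans ?_
    simp
  E_pos := fun x hx => div_pos two_pos (sub_pos.2 hx)
  E_l := by norm_num [jacobiE]
  E_mono := fun x _ y hy hxy =>
    div_le_div_of_nonneg_left two_pos.le (sub_pos.2 hy) (sub_le_sub_left hxy 1)
  hasDerivAt_E := fun x hx => by
    have h : (1 - x : ℝ) ≠ 0 := (sub_pos.2 hx).ne'
    refine ((hasDerivAt_const x (2 : ℝ)).div ((hasDerivAt_id x).const_sub 1) h).congr_deriv ?_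
    simp only [jacobiE, Polynomial.eval_sub, Polynomial.eval_one, Polynomial.eval_X, id]
    field_simp
    ring
  integrable_E := fun δ hδ f x hx => integrableOn_jacobiE_rpow_mul_eval hδ f hx
  tendsto_E := fun δ hδ f => tendsto_jacobiE_rpow_mul_eval hδ f
  integral_deriv := fun x hx f f' hf hi ht => by
    rw [inter_comm, Ioi_inter_Iio] at hi ⊢
    have hle : x ≤ 1 := le_of_lt hx
    rw [← integral_Ioc_eq_integral_Ioo, ← intervalIntegral.integral_of_le hle,
      intervalIntegral.integral_eq_sub_of_hasDerivAt_of_tendsto hx (fun t ht => hf t ht.2)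
        ((intervalIntegrable_iff_integrableOn_Ioo_of_le hle).2 hi)
        ((hf x hx).continuousAt.tendsto.mono_left nhdsWithin_le_nhds) ht, zero_sub]
  eventually_mem := by
    filter_upwards [Ioo_mem_nhdsLT (show (-1 : ℝ) < 1 by norm_num)] with t ht using ⟨ht.2, ht.1⟩

theorem ExpTime.integral_E_rpow {J : Set ℝ} {l : ℝ} {q : ℝ[X]} {E : ℝ → ℝ} {L : Filter ℝ}
    (h : ExpTime J l q E L) {δ : ℝ} (hδ : 0 < δ) :
    ∫ t in J ∩ Ioi l, E t ^ (-δ) / q.eval t = 1 / δ := by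
  have h0 : IntegrableOn (fun t => E t ^ (-δ) / q.eval t) (J ∩ Ioi l) := by
    simpa using h.integrable_E δ hδ 1 l h.l_mem
  have e : ∀ t, -δ * E t ^ (-δ) / q.eval t = -δ * (E t ^ (-δ) / q.eval t) := fun t =>
    mul_div_assoc _ _ _
  have h1 := h.integral_deriv l h.l_mem _ _ (fun t ht => h.hasDerivAt_E_rpow (-δ) ht)
    (by simp only [e]; exact h0.const_mul (-δ)) (by simpa using h.tendsto_E δ hδ 1)
  simp only [e, integral_const_mul, h.E_l, Real.one_rpow] at h1
  rw [eq_div_iff hδ.ne']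
  linarith

/-- The polynomial `(1 - X) / 2`. -/
def halfPoly : ℝ[X] := Polynomial.C (1 / 2) * (1 - Polynomial.X)

theorem eval_halfPoly (x : ℝ) : halfPoly.eval x = (1 - x) / 2 := by
  simp [halfPoly]
  ring

theorem degree_halfPoly : halfPoly.degree = 1 := by
  have : halfPoly = Polynomial.C (-1 / 2) * Polynomial.X + Polynomial.C (1 / 2) := by
    rw [halfPoly, mul_sub, mul_one, show (-1 / 2 : ℝ) = -(1 / 2) by norm_num, map_neg]
    ring
  rw [this, Polynomial.degree_linear (by norm_num)]

/-- The coefficient of `((1 - x) / 2)^m` in the Jacobi polynomial `P_l^{(a,0)}(x)`. -/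
def jacobiCoeff (a : ℝ) (l m : ℕ) : ℝ :=
  (-1) ^ m * (l.choose m : ℝ) * (ascPochhammer ℝ l).eval (m + (a + 1)) / (l.factorial : ℝ)

/-- The two Pochhammer factors join into `(m + a + 1)_l`, which is a polynomial of degree `l` in
`m`, as the finite differences require. -/
theorem jacobiP_eq (l : ℕ) (a x : ℝ) :
    jacobiP l a 0 x = ∑ m ∈ Finset.range (l + 1), jacobiCoeff a l m * ((1 - x) / 2) ^ m := by
  refine Finset.sum_congr rfl fun m hm => ?_
  have hm : m ≤ l := Nat.lt_succ_iff.1 (Finset.mem_range.1 hm)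
  have h1 : (ascPochhammer ℝ l).eval (m + (a + 1)) =
      (ascPochhammer ℝ (l - m)).eval (a + m + 1) * (ascPochhammer ℝ m).eval (l + a + 0 + 1) := by
    have := congrArg (Polynomial.eval (a + m + 1)) (ascPochhammer_mul ℝ (l - m) m)
    rw [Nat.sub_add_cancel hm, Polynomial.eval_mul, Polynomial.eval_comp] at this
    simp only [Polynomial.eval_add, Polynomial.eval_X, Polynomial.eval_natCast] at this
    rw [show (m : ℝ) + (a + 1) = a + m + 1 by ring, ← this, Nat.cast_sub hm]
    ring_nf
  have h2 : ((l.choose m : ℝ)) / (l.factorial : ℝ) =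
      1 / ((m.factorial : ℝ) * ((l - m).factorial : ℝ)) := by
    rw [Nat.cast_choose ℝ hm]
    have := Nat.factorial_ne_zero l
    field_simp
  have h3 : ((x - 1) / 2) ^ m = (-1) ^ m * ((1 - x) / 2) ^ m := by
    rw [← mul_pow]
    ring_nf
  rw [jacobiCoeff, h1, h3]
  linear_combination (-((-1) ^ m * (ascPochhammer ℝ (l - m)).eval (a + m + 1) *
    (ascPochhammer ℝ m).eval (l + a + 0 + 1) * ((1 - x) / 2) ^ m)) * h2

/-- The orthonormal Jacobi polynomials. -/
def jacobiPoly (a : ℝ) (l : ℕ) : ℝ[X] :=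
  (coeffPoly (fun m => (√(hJ a l))⁻¹ * jacobiCoeff a l m) l).comp halfPoly

theorem jacobiPoly_eq_sum (a : ℝ) (l : ℕ) : jacobiPoly a l = ∑ m ∈ Finset.range (l + 1),
    Polynomial.C ((√(hJ a l))⁻¹ * jacobiCoeff a l m) * halfPoly ^ m := by
  simp only [jacobiPoly, coeffPoly, Polynomial.sum_comp, Polynomial.mul_comp,
    Polynomial.C_comp, Polynomial.X_pow_comp]

theorem eval_jacobiPoly (a : ℝ) (l : ℕ) (x : ℝ) :
    (jacobiPoly a l).eval x = (√(hJ a l))⁻¹ * jacobiP l a 0 x := by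
  simp only [jacobiPoly_eq_sum, jacobiP_eq, Polynomial.eval_finsetSum, Polynomial.eval_mul,
    Polynomial.eval_C, Polynomial.eval_pow, eval_halfPoly, Finset.mul_sum, mul_assoc]

theorem hJ_pos {a : ℝ} (ha : -1 < a) (l : ℕ) : 0 < hJ a l := by
  have : (0 : ℝ) ≤ l := l.cast_nonneg
  exact div_pos (Real.rpow_pos_of_pos two_pos _) (by linarith)

theorem degree_jacobiPoly {a : ℝ} (ha : -1 < a) (l : ℕ) :
    (jacobiPoly a l).degree = (l : WithBot ℕ) := by
  have h1 : (√(hJ a l))⁻¹ * jacobiCoeff a l l ≠ 0 := by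
    refine mul_ne_zero (inv_ne_zero (Real.sqrt_pos.2 (hJ_pos ha l)).ne') ?_
    have : (0 : ℝ) ≤ l := l.cast_nonneg
    have h2 := (ascPochhammer_pos l ((l : ℝ) + (a + 1)) (by linarith)).ne'
    simp [jacobiCoeff, h2, Nat.factorial_ne_zero]
  have h2 := degree_coeffPoly (a := fun m => (√(hJ a l))⁻¹ * jacobiCoeff a l m) h1
  rw [jacobiPoly, Polynomial.degree_comp (by simp [degree_halfPoly]), h2, degree_halfPoly, mul_one]

theorem ascPochhammer_eval_eq_prod (l : ℕ) (x : ℝ) :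
    (ascPochhammer ℝ l).eval x = ∏ i ∈ Finset.range l, (x + i) := by
  induction l with
  | zero => simp
  | succ l ih => rw [ascPochhammer_succ_eval, ih, Finset.prod_range_succ]

theorem integral_halfPoly_pow_mul {a : ℝ} (ha : -1 < a) (C₀ : ℝ) (k m : ℕ) :
    ∫ t in Iio 1 ∩ Ioi (-1 : ℝ), wPoly jacobiE (a + 1) C₀ (halfPoly ^ m) t *
      wPoly jacobiE (a + 1) C₀ (halfPoly ^ k) t / (1 - Polynomial.X : ℝ[X]).eval t =
      C₀ ^ 2 / (m + (a + 1) + k) := by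
  have hδ : 0 < (m : ℝ) + (a + 1) + k := by
    have : (0 : ℝ) ≤ m := m.cast_nonneg
    have : (0 : ℝ) ≤ k := k.cast_nonneg
    linarith
  rw [div_eq_mul_one_div, ← jacobi_expTime.integral_E_rpow hδ, ← integral_const_mul]
  refine setIntegral_congr_fun (jacobi_expTime.measurableSet_tail _) fun t ht => ?_
  have h : 0 < (1 - t) / 2 := half_pos (sub_pos.2 ht.1)
  rw [jacobi_expTime.wPoly_mul_wPoly _ _ _ _ ht.1, jacobiE_rpow_neg ht.1, jacobiE_rpow_neg ht.1,
    ← pow_add, Polynomial.eval_pow, eval_halfPoly, mul_div_assoc,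
    ← Real.rpow_natCast ((1 - t) / 2), ← Real.rpow_add h]
  push_cast
  ring_nf

/-- The moments are proportional to `1 / (m + a + 1 + k)`. As `k < l`, the denominator is one of the
linear factors of `(m + a + 1)_l`, and the quotient `Q` has degree `l - 1` in `m`. -/
theorem integral_halfPoly_pow_mul_jacobiPoly {a : ℝ} (ha : -1 < a) (C₀ : ℝ) {k l : ℕ}
    (hk : k < l) :
    ∫ t in Iio 1 ∩ Ioi (-1 : ℝ), wPoly jacobiE (a + 1) C₀ (halfPoly ^ k) t *
      wPoly jacobiE (a + 1) C₀ (jacobiPoly a l) t / (1 - Polynomial.X : ℝ[X]).eval t = 0 := by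
  simp only [mul_comm (wPoly jacobiE (a + 1) C₀ (halfPoly ^ k) _)]
  rw [jacobiPoly_eq_sum, jacobi_expTime.integral_sum_wPoly (by linarith)]
  simp only [integral_halfPoly_pow_mul ha]
  set Q : ℝ[X] := ∏ i ∈ (Finset.range l).erase k, (Polynomial.X + Polynomial.C (a + 1 + i)) with hQ
  have hdeg : Q.natDegree < l := by
    rw [hQ, Polynomial.natDegree_prod _ _ fun i _ => Polynomial.X_add_C_ne_zero _]
    simp only [Polynomial.natDegree_X_add_C, Finset.sum_const, smul_eq_mul, mul_one]
    rw [Finset.card_erase_of_mem (Finset.mem_range.2 hk), Finset.card_range]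
    omega
  have h0 := sum_neg_one_pow_choose_eval_eq_zero hdeg
  rw [← mul_zero ((√(hJ a l))⁻¹ * C₀ ^ 2 / (l.factorial : ℝ)), ← h0, Finset.mul_sum]
  refine Finset.sum_congr rfl fun m _ => ?_
  have hδ : (m : ℝ) + (a + 1) + k ≠ 0 := by
    have : (0 : ℝ) ≤ m := m.cast_nonneg
    have : (0 : ℝ) ≤ k := k.cast_nonneg
    linarith
  have hev : (ascPochhammer ℝ l).eval (m + (a + 1)) = (m + (a + 1) + k) * Q.eval (m : ℝ) := by
    rw [ascPochhammer_eval_eq_prod, ← Finset.mul_prod_erase _ _ (Finset.mem_range.2 hk), hQ,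
      Polynomial.eval_prod]
    simp [add_assoc]
  rw [jacobiCoeff, hev]
  field_simp

/-- All powers of `(1 - x) / 2` are `1` at `x = -1`, which leaves the `l`-th difference of a monic
polynomial of degree `l`. -/
theorem jacobiP_neg_one (l : ℕ) (a : ℝ) : jacobiP l a 0 (-1) = (-1) ^ l := by
  have hm : ((ascPochhammer ℝ l).comp (Polynomial.X + Polynomial.C (a + 1))).Monic :=
    (monic_ascPochhammer ℝ l).comp_X_add_C _
  have h1 := sum_neg_one_pow_choose_eval_natDegree (l := l) hm (by
    rw [Polynomial.natDegree_comp, ascPochhammer_natDegree, Polynomial.natDegree_X_add_C, mul_one])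
  have hl : (l.factorial : ℝ) ≠ 0 := by exact_mod_cast l.factorial_ne_zero
  rw [jacobiP_eq, ← mul_div_cancel_right₀ ((-1 : ℝ) ^ l) hl, ← h1, Finset.sum_div]
  refine Finset.sum_congr rfl fun m _ => ?_
  rw [jacobiCoeff]
  norm_num

/-- The coefficient of degree `l` in `-X f'` is `-l` times that of `f`, and it cancels. -/
theorem degree_timeDeriv_remainder {f : ℝ[X]} {l : ℕ} (hf : f.degree = (l : WithBot ℕ)) :
    (Polynomial.C (l : ℝ) * f + (1 - Polynomial.X) * f.derivative).degree < (l : WithBot ℕ) := by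
  have h0 : ∀ i, l < i → f.coeff i = 0 := fun i hi =>
    Polynomial.coeff_eq_zero_of_degree_lt (by
      rw [hf]
      exact_mod_cast hi)
  rw [Polynomial.degree_lt_iff_coeff_zero]
  intro i hi
  have hX : (Polynomial.X * f.derivative).coeff i = i * f.coeff i := by
    cases i with
    | zero => simp
    | succ i =>
      rw [Polynomial.coeff_X_mul, Polynomial.coeff_derivative]
      push_cast
      ring
  rw [Polynomial.coeff_add, sub_mul, one_mul, Polynomial.coeff_sub, hX, Polynomial.coeff_C_mul,
    Polynomial.coeff_derivative, h0 (i + 1) (by omega)]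
  rcases hi.eq_or_lt with rfl | hi
  · ring
  · rw [h0 i hi]
    ring

theorem jacobi_orthonormal {a : ℝ} (ha : -1 < a) (j k : ℕ) :
    ∫ t in Iio 1 ∩ Ioi (-1 : ℝ), wPoly jacobiE (a + 1) (2 ^ ((a + 1) / 2)) (jacobiPoly a j) t *
      wPoly jacobiE (a + 1) (2 ^ ((a + 1) / 2)) (jacobiPoly a k) t /
        (1 - Polynomial.X : ℝ[X]).eval t = if j = k then 1 else 0 := by
  -- The boundary condition reads `2^(a+1) / h_m = 2m + a + 1 = 2μ_m`, which is the stated norm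
  -- `h_m`.
  refine jacobi_expTime.orthonormal_of_orthogonal (by linarith) _ (g := fun k => halfPoly ^ k)
    (P := jacobiPoly a) (R := fun l => Polynomial.C (l : ℝ) * jacobiPoly a l +
      (1 - Polynomial.X) * (jacobiPoly a l).derivative) (μ := fun l => (a + 1) / 2 + l)
    (fun k => by simp [Polynomial.degree_pow, degree_halfPoly]) (degree_jacobiPoly ha)
    (fun m k hk => integral_halfPoly_pow_mul_jacobiPoly ha _ hk)
    (fun m => degree_timeDeriv_remainder (degree_jacobiPoly ha m)) (fun m => ?_)
    (fun m => ?_) (fun m => ?_) j k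
  · have : (0 : ℝ) ≤ m := m.cast_nonneg
    linarith
  · rw [timeDeriv, map_add]
    ring
  · have h2 : ((2 : ℝ) ^ ((a + 1) / 2)) ^ 2 = 2 ^ (a + 1) := by
      rw [← Real.rpow_natCast, ← Real.rpow_mul two_pos.le]
      norm_num
    have hh := hJ_pos ha m
    have hpos : (0 : ℝ) < 2 ^ (a + 1) := Real.rpow_pos_of_pos two_pos _
    rw [eval_jacobiPoly, jacobiP_neg_one, h2, mul_pow, inv_pow, Real.sq_sqrt hh.le, ← pow_mul,
      mul_comm m 2, pow_mul, neg_one_sq, one_pow, hJ]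
    field_simp
    ring

end Jacobi

/-! ### The Jacobi ensemble -/

section JacobiEnsemble

open Matrix Set Filter Topology

theorem jacobiE_div (x t : ℝ) : jacobiE x / jacobiE t = (1 - t) / (1 - x) := by
  rw [jacobiE, jacobiE, div_div_div_cancel_left' _ _ two_ne_zero]

theorem jacobi_weightOn (a : ℝ) : WeightOn (Ioo (-1) 1) (Iio 1) (-1) (1 - Polynomial.X) jacobiE
    (a + 1) (2 ^ ((a + 1) / 2)) (wJ a) where
  measurableSet := measurableSet_Ioo
  subset := fun x hx => ⟨hx.2, hx.1.le⟩
  superset := fun x hx => ⟨hx.2, hx.1⟩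
  measurable_w := (measurable_const.sub measurable_id).pow_const _
  measurable_E := measurable_const.div (measurable_const.sub measurable_id)
  -- The constant `2^((a+1)/2)` compensates the `2` in `E = 2 / (1 - x)`, which is there to make
  -- `E(-1) = 1`.
  weight_eq := fun x hx => by
    have h : (0 : ℝ) < 1 - x := sub_pos.2 hx
    rw [jacobiE_rpow_neg hx, ← Real.mul_rpow two_pos.le (by positivity),
      mul_div_cancel₀ _ two_ne_zero, wJ, show (a + 1) / 2 = (a - 1) / 2 + 1 by ring, Real.rpow_add_one h.ne']
    simp

theorem jacobi_ratio_rpow_neg (A : ℝ) {x y : ℝ} (hx : x < 1) (hy : y < 1) :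
    ((1 - x) / (1 - y)) ^ (-A / 2) = (jacobiE x / jacobiE y) ^ (A / 2) := by
  have h1 : (0 : ℝ) < 1 - x := sub_pos.2 hx
  have h2 : (0 : ℝ) < 1 - y := sub_pos.2 hy
  rw [jacobiE_div, neg_div, Real.rpow_neg (by positivity), ← Real.inv_rpow (by positivity), inv_div]

theorem kappaJ_eq (A : ℝ) {x y : ℝ} (hx : x < 1) (hy : y < 1) :
    kappaJ A x y = expKappa jacobiE (A / 2) x y := by
  rw [kappaJ, expKappa, jacobi_ratio_rpow_neg A hx hy]

theorem epsJ_eq (A : ℝ) {x y : ℝ} (hx : x < 1) (hy : y < 1) :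
    epsJ A x y = expEps jacobiE (A / 2) x y := by
  rw [epsJ, expEps, expKappa, expKappa]
  rcases lt_trichotomy x y with h | rfl | h
  · rw [if_neg h.not_gt, if_pos h, Real.sign_of_neg (sub_neg.2 h), jacobiE_div]
    simp
  · simp
  · rw [if_pos h, if_neg h.not_gt, Real.sign_of_pos (sub_pos.2 h), mul_one, mul_one,
      jacobi_ratio_rpow_neg A hx hy, sub_zero]

theorem KJ_eq {a : ℝ} (ha : -1 < a) (N : ℕ) {x y : ℝ} (hx : x < 1) (hy : y < 1) :
    KJ a N x y = (wVec jacobiE (a + 1) (2 ^ ((a + 1) / 2)) (fun j : Fin N => jacobiPoly a j) x ⬝ᵥ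
      wVec jacobiE (a + 1) (2 ^ ((a + 1) / 2)) (fun j : Fin N => jacobiPoly a j) y) /
        ((1 - Polynomial.X : ℝ[X]).eval x * (1 - Polynomial.X : ℝ[X]).eval y) := by
  have hqx := (jacobi_expTime.q_pos x hx).ne'
  have hqy := (jacobi_expTime.q_pos y hy).ne'
  rw [KJ, Finset.sum_range, Finset.mul_sum]
  simp only [dotProduct, wVec, wPoly, ← (jacobi_weightOn a).weight_eq x hx,
    ← (jacobi_weightOn a).weight_eq y hy, eval_jacobiPoly, Finset.sum_div, wJ]
  refine Finset.sum_congr rfl fun j _ => ?_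
  have hh := hJ_pos ha j
  have hs : 1 / hJ a j = (√(hJ a j))⁻¹ * (√(hJ a j))⁻¹ := by
    rw [← mul_inv, Real.mul_self_sqrt hh.le, one_div]
  rw [hs]
  field_simp

theorem integral_Iio_inter_Ioi (f : ℝ → ℝ) {x : ℝ} (hx : x ≤ 1) :
    ∫ t in Iio 1 ∩ Ioi x, f t = ∫ t in x..1, f t := by
  rw [inter_comm, Ioi_inter_Iio, ← integral_Ioc_eq_integral_Ioo, intervalIntegral.integral_of_le hx]

theorem f22J_eq (n : ℕ) (a A x : ℝ) {y : ℝ} (hy : y < 1) :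
    f22J n a A x y = closedDiag (Iio 1) (-1) (1 - Polynomial.X) jacobiE (A / 2) (KJ a (2 * n))
      x y := by
  -- Here `q' = -1`; the integrand is minus the one in `closedDiag`, which accounts for the opposite
  -- sign in front.
  have e : ∀ t, ∫ u in y..1, (KJ a (2 * n) u t - (1 - t) * deriv (fun t' => KJ a (2 * n) u t') t) =
      -∫ u in y..1, ((1 - t) * deriv (fun t' => KJ a (2 * n) u t') t + -1 * KJ a (2 * n) u t) := by
    intro t
    rw [← intervalIntegral.integral_neg]
    congr 1
    ext u
    ring
  simp only [f22J, closedDiag, jacobiE_div, integral_Iio_inter_Ioi _ hy.le,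
    integral_Iio_inter_Ioi _ (show (-1 : ℝ) ≤ 1 by norm_num), Polynomial.eval_sub,
    Polynomial.eval_one, Polynomial.eval_X, Polynomial.derivative_sub, Polynomial.derivative_one,
    Polynomial.derivative_X, zero_sub, Polynomial.eval_neg, e, mul_neg,
    intervalIntegral.integral_neg]
  rw [jacobiE, show A / 2 / (2 * (1 - y)) = A / (4 * (1 - y)) by
    rw [div_div, ← mul_assoc]
    norm_num]
  ring

/-- Agreement near the point is what is available in `f12J_eq`: the set integrals are rewritten as
interval integrals to `1` only at points left of `1`. -/
theorem timeOp_congr {q : ℝ[X]} {α : ℝ} {f g : ℝ → ℝ} {x : ℝ} (h : f =ᶠ[𝓝 x] g) :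
    timeOp q α f x = timeOp q α g x := by
  rw [timeOp, timeOp, h.deriv_eq, h.eq_of_nhds]

theorem f12J_eq (n : ℕ) (a A : ℝ) {x y : ℝ} (hx : x < 1) (hy : y < 1) :
    f12J n a A x y = closedUpper (Iio 1) (1 - Polynomial.X) (A / 2) (KJ a (2 * n)) x y := by
  have e : ∀ g x, opJ A g x = timeOp (1 - Polynomial.X) (A / 2) g x := fun g x => by
    rw [timeOp, opJ, div_div]
    simp
  simp only [f12J, closedUpper, e]
  congr 1
  refine timeOp_congr ?_
  filter_upwards [Iio_mem_nhds hx] with x' hx'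
  refine timeOp_congr ?_
  filter_upwards [Iio_mem_nhds hy] with y' hy'
  rw [integral_Iio_inter_Ioi _ (le_of_lt hx'), integral_Iio_inter_Ioi _ (le_of_lt hy')]
  simp

theorem f21J_eq (n : ℕ) (a A : ℝ) {x y : ℝ} (hx : x < 1) (hy : y < 1) :
    f21J n a A x y =
      closedLower (-1) (1 - Polynomial.X) jacobiE (A / 2) (KJ a (2 * n)) x y := by
  rw [closedLower, ← epsJ_eq A hx hy]
  simp only [f21J, epsJ, jacobiE_div, Polynomial.eval_sub, Polynomial.eval_one, Polynomial.eval_X]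

theorem jacobi_ensemble (n : ℕ) (a A : ℝ) (ha : -1 < a) (hA : A < a + 1) :
    0 < jacobiNorm n a A ∧
      ∀ R : Fin (2 * n) → ℝ[X], (∀ j, (R j).degree = ((j : ℕ) : WithBot ℕ)) →
        IsUnit (skewMatrix (Set.Ioo (-1) 1) (wJ a) (kappaJ A) R) ∧
        (∀ k : ℕ, k ≤ 2 * n → ∀ x : Fin k → ℝ, (∀ j, x j ∈ Set.Ioo (-1 : ℝ) 1) →
          correlation (jacobiPDF n a A) k x = qdet (blockMatrix (fJ a A R) x)) ∧
        (∀ x ∈ Set.Ioo (-1 : ℝ) 1, ∀ y ∈ Set.Ioo (-1 : ℝ) 1,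
          fJ a A R x y =
            !![f22J n a A y x, f12J n a A x y; f21J n a A x y, f22J n a A x y]) := by
  obtain ⟨h0, h1⟩ := jacobi_expTime.ensemble (c := a + 1) (C₀ := 2 ^ ((a + 1) / 2)) (α := A / 2)
    (by linarith) (p := fun j : Fin (2 * n) => jacobiPoly a j)
    (fun j => degree_jacobiPoly ha j) (fun j k => by
      simp only [jacobi_orthonormal ha, Fin.val_inj])
    (jacobi_weightOn a) (fun x hx => Real.rpow_nonneg (sub_nonneg.2 hx.2.le) _) (by linarith)
    (fun x hx y hy => kappaJ_eq A hx.2 hy.2) (fun x hx y hy => epsJ_eq A hx.2 hy.2)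
    (fun x hx y hy => KJ_eq ha (2 * n) hx hy) (ρ := jacobiWeight n a A)
    (fun x hx => indicator_of_notMem
      (show x ∉ {x | StrictAnti x ∧ ∀ j, -1 < x j ∧ x j < 1} from hx) _)
    (fun x hx hxI => by
      have hpair : ∀ j : Fin n, evenCoord x j < oddCoord x j := fun j => hx (by simp [Fin.lt_def])
      rw [jacobiWeight, indicator_of_mem
        (show x ∈ {x | StrictAnti x ∧ ∀ j, -1 < x j ∧ x j < 1} from ⟨hx, hxI⟩)]
      simp only [wJ, kappaJ, hpair, if_true])
  refine ⟨h0, fun R hR => ⟨(h1 R hR).1, (h1 R hR).2.1, fun x hx y hy => ?_⟩⟩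
  rw [f22J_eq n a A y hx.2, f22J_eq n a A x hy.2, f12J_eq n a A hx.2 hy.2, f21J_eq n a A hx.2 hy.2]
  exact (h1 R hR).2.2 x hx y hy

end JacobiEnsemble

end

end DecimatedEnsemble

theorem mainTheorem2 :
    (∀ (n : ℕ) (A : ℝ), A < 1 →
      0 < laguerreNorm n A ∧
      ∀ R : Fin (2 * n) → ℝ[X], (∀ j, (R j).degree = ((j : ℕ) : WithBot ℕ)) →
        IsUnit (skewMatrix (Set.Ici 0) wL (kappaL A) R) ∧
        (∀ k : ℕ, k ≤ 2 * n → ∀ x : Fin k → ℝ, (∀ j, x j ∈ Set.Ici (0 : ℝ)) →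
          correlation (laguerrePDF n A) k x = qdet (blockMatrix (fL A R) x)) ∧
        (∀ x ∈ Set.Ici (0 : ℝ), ∀ y ∈ Set.Ici (0 : ℝ),
          fL A R x y = !![f22L n A y x, f12L n A x y; f21L n A x y, f22L n A x y])) ∧
    (∀ (n : ℕ) (a A : ℝ), -1 < a → A < a + 1 →
      0 < jacobiNorm n a A ∧
      ∀ R : Fin (2 * n) → ℝ[X], (∀ j, (R j).degree = ((j : ℕ) : WithBot ℕ)) →
        IsUnit (skewMatrix (Set.Ioo (-1) 1) (wJ a) (kappaJ A) R) ∧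
        (∀ k : ℕ, k ≤ 2 * n → ∀ x : Fin k → ℝ, (∀ j, x j ∈ Set.Ioo (-1 : ℝ) 1) →
          correlation (jacobiPDF n a A) k x = qdet (blockMatrix (fJ a A R) x)) ∧
        (∀ x ∈ Set.Ioo (-1 : ℝ) 1, ∀ y ∈ Set.Ioo (-1 : ℝ) 1,
          fJ a A R x y = !![f22J n a A y x, f12J n a A x y; f21J n a A x y, f22J n a A x y])) := by
  exact ⟨laguerre_ensemble, jacobi_ensemble⟩
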